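/- Fix $n\ge 2$. An object $\bar K=(K,K_1,\dots,K_n)$ of the category $\mathcal K_n$ consists of a CW-complex $K$ of dimension at most two with a chosen vertex $*$ as base point, and subcomplexes $K_1,\dots,K_n$ with $K=K_1\cup\dots\cup K_n$ and $K_1\cap\dots\cap K_n=K^1$, the 1-skeleton of $K$. A morphism $\bar K\to\bar L$ is a base-point preserving map $f:K^1\to L^1$ that can be extended to a map $\bar f:K\to L$ with $\bar f(K_i)\subseteq L_i$ for $i=1,\dots,n$. Put $$Q(\bar K)=\pi_2(K)/(i_1\pi_2(K_1)+\dots+i_n\pi_2(K_n)),$$ where $i_j:\pi_2(K_j)\to\pi_2(K)$ is induced by the inclusion. Let $\bar S_n=(S^2,L_1,\dots,L_n)\in\mathcal K_n$, where $S^2$ is regarded as the standard 2-complex of the presentation $$\langle x_1,\dots,x_{n-1}\mid x_1,\dots,x_{n-1},\ x_{n-1}^{-1}\cdots x_1^{-1}\rangle$$ and $L_i$ is the union of the 1-skeleton with the 2-cell of the $i$-th relator. Let $\iota\in\pi_2(S^2)$ be the class of the identity map of $S^2$. **Proposition.** For a morphism $f:\bar S_n\to\bar K$ choose an extension $\bar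 f:S^2\to K$ with $\bar f(L_i)\subseteq K_i$ for all $i$, and let $q(f)\in Q(\bar K)$ be the class of $\bar f_*(\iota)$. Then: 1. (Well defined.) $q(f)$ does not depend on the choice of $\bar f$, and it depends only on the homotopy class of $f:(S^2)^1\to K^1$ relative to the base point. 2. (Natural.) Every morphism $g:\bar K\to\bar L$ of $\mathcal K_n$ induces a homomorphism $g_*:Q(\bar K)\to Q(\bar L)$, $[a]\mapsto[\bar g_*(a)]$, which does not depend on the extension $\bar g$ and depends only on the homotopy class of $g$ relative to the base point. This makes $Q$ a functor on $\mathcal K_n$, and $g_*(q(f))=q(g\circ f)$ for all $f:\bar S_n\to\bar K$. 3. (Surjective.) For every $\bar K\in\mathcal K_n$ the map $q:\mathrm{Hom}_{\mathcal K_n}(\bar S_n,\bar K)\to Q(\bar K)$ is surjective. -/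

import Mathlib

open Set Topology Topology.CWComplex
open scoped unitInterval Topology.Homotopy

universe u v w

noncomputable section

/-! ## Induced maps on second homotopy groups -/

/-- The class in `π₂(X, x)` of a map `I² → X` that is constantly `x` on the boundary. -/
def piTwoMk {X : Type u} [TopologicalSpace X] {x : X} (γ : Ω^ (Fin 2) X x) : π_ 2 X x :=
  Quotient.mk _ γ

/-- The generalized loop obtained by composing with a pointed map. -/
def genLoopMap {X : Type u} {Y : Type v} [TopologicalSpace X] [TopologicalSpace Y]
    (F : C(X, Y)) {x : X} {y : Y} (h : F x = y) (γ : Ω^ (Fin 2) X x) : Ω^ (Fin 2) Y y :=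
  ⟨F.comp γ.1, fun t ht => by
    rw [ContinuousMap.comp_apply, γ.2 t ht, h]⟩

lemma genLoopMap_transAt {X : Type u} {Y : Type v} [TopologicalSpace X] [TopologicalSpace Y]
    (F : C(X, Y)) {x : X} {y : Y} (h : F x = y) (a b : Ω^ (Fin 2) X x) :
    genLoopMap F h (GenLoop.transAt 0 a b) =
      GenLoop.transAt 0 (genLoopMap F h a) (genLoopMap F h b) := by
  ext t
  change F (GenLoop.transAt 0 a b t) = _
  simp only [GenLoop.transAt, GenLoop.coe_copy]
  split_ifs <;> rfl

/-- The homomorphism `π₂(X, x) → π₂(Y, y)` induced by a pointed map. -/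
def piTwoMap {X : Type u} {Y : Type v} [TopologicalSpace X] [TopologicalSpace Y]
    (F : C(X, Y)) {x : X} {y : Y} (h : F x = y) : π_ 2 X x →* π_ 2 Y y :=
  MonoidHom.mk' (Quotient.map (genLoopMap F h) (fun a b (hab : GenLoop.Homotopic a b) => by
      obtain ⟨H⟩ := hab
      exact ⟨H.compContinuousMap F⟩)) (by
    rintro ⟨a⟩ ⟨b⟩
    have h1 : piTwoMk a * piTwoMk b = piTwoMk (GenLoop.transAt 0 b a) :=
      HomotopyGroup.mul_spec
    have h2 : piTwoMk (genLoopMap F h a) * piTwoMk (genLoopMap F h b) =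
        piTwoMk (GenLoop.transAt 0 (genLoopMap F h b) (genLoopMap F h a)) :=
      HomotopyGroup.mul_spec
    rw [← genLoopMap_transAt] at h2
    exact (congrArg _ h1).trans h2.symm)

lemma piTwoMap_piTwoMk {X : Type u} {Y : Type v} [TopologicalSpace X] [TopologicalSpace Y]
    (F : C(X, Y)) {x : X} {y : Y} (h : F x = y) (γ : Ω^ (Fin 2) X x) :
    piTwoMap F h (piTwoMk γ) = piTwoMk (genLoopMap F h γ) := rfl

/-! ## The category of `n`-fold covered two-dimensional complexes -/

/-- An object `(K, K₁, …, Kₙ)`: a pointed CW-complex `K` of dimension at most two, with a vertex as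
base point, together with subcomplexes `K₁, …, Kₙ` whose union is `K` and whose intersection is the
1-skeleton. -/
structure KObj (n : ℕ) where
  /-- the underlying space -/
  X : Type u
  [top : TopologicalSpace X]
  [t2 : T2Space X]
  [cw : CWComplex (univ : Set X)]
  dim_le_two : ∀ m, 2 < m → IsEmpty (cell (univ : Set X) m)
  /-- the base point -/
  base : X
  base_mem : base ∈ skeleton (univ : Set X) 0
  /-- the subcomplexes -/
  sub : Fin n → Subcomplex (univ : Set X)
  iUnion_sub : ⋃ i, (sub i : Set X) = univ
  iInter_sub : ⋂ i, (sub i : Set X) = skeleton (univ : Set X) 1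

attribute [instance] KObj.top KObj.t2 KObj.cw

namespace KObj

variable {n : ℕ}

/-- The 1-skeleton `K¹`. -/
abbrev skel (K : KObj.{u} n) : Set K.X := skeleton (univ : Set K.X) 1

lemma base_mem_skel (K : KObj.{u} n) : K.base ∈ K.skel :=
  skeleton_mono (C := (univ : Set K.X)) (zero_le (a := (1 : ℕ∞))) K.base_mem

lemma skel_subset_sub (K : KObj.{u} n) (i : Fin n) : K.skel ⊆ K.sub i := by
  rw [skel, ← K.iInter_sub]
  exact iInter_subset _ i

/-- The base point as a point of `K¹`. -/
abbrev skelBase (K : KObj.{u} n) : K.skel := ⟨K.base, K.base_mem_skel⟩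

/-- The base point as a point of `Kᵢ`. -/
abbrev subBase (K : KObj.{u} n) (i : Fin n) : (K.sub i : Set K.X) :=
  ⟨K.base, K.skel_subset_sub i K.base_mem_skel⟩

/-- The homomorphism `π₂(Kᵢ) → π₂(K)` induced by the inclusion. -/
def inclPiTwo (K : KObj.{u} n) (i : Fin n) :
    π_ 2 (K.sub i : Set K.X) (K.subBase i) →* π_ 2 K.X K.base :=
  piTwoMap ⟨Subtype.val, continuous_subtype_val⟩ rfl

/-- The quotient `π₂(K) / (i₁π₂(K₁) + … + iₙπ₂(Kₙ))`; Mathlib writes the abelian group `π₂`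
multiplicatively. -/
abbrev PiTwoQuot (K : KObj.{u} n) : Type u :=
  π_ 2 K.X K.base ⧸ (⨆ i, (K.inclPiTwo i).range)

/-- `F : K → L` is an extension of `f : K¹ → L¹` that carries each `Kᵢ` into `Lᵢ`. -/
structure IsExtension {K : KObj.{u} n} {L : KObj.{v} n} (f : C(K.skel, L.skel))
    (F : C(K.X, L.X)) : Prop where
  eq_on_skel : ∀ x : K.skel, F x = f x
  mapsTo_sub : ∀ i, MapsTo F (K.sub i) (L.sub i)

/-- A morphism: a pointed map `K¹ → L¹` which can be extended to a map `K → L` carrying each `Kᵢ`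
into `Lᵢ`. -/
structure Hom (K : KObj.{u} n) (L : KObj.{v} n) where
  /-- the map between 1-skeletons -/
  toMap : C(K.skel, L.skel)
  map_base : toMap K.skelBase = L.skelBase
  exists_extension : ∃ F : C(K.X, L.X), IsExtension toMap F

lemma Hom.extension_base {K : KObj.{u} n} {L : KObj.{v} n} (f : Hom K L) {F : C(K.X, L.X)}
    (hF : IsExtension f.toMap F) : F K.base = L.base := by
  have h := hF.eq_on_skel K.skelBase
  rw [f.map_base] at h
  exact h

/-- The identity morphism. -/
def Hom.id (K : KObj.{u} n) : Hom K K where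
  toMap := ContinuousMap.id _
  map_base := rfl
  exists_extension := ⟨ContinuousMap.id _, fun _ => rfl, fun _ => mapsTo_id _⟩

/-- The composite `g ∘ f` of morphisms. -/
def Hom.comp {K : KObj.{u} n} {L : KObj.{v} n} {M : KObj.{w} n} (g : Hom L M) (f : Hom K L) :
    Hom K M where
  toMap := g.toMap.comp f.toMap
  map_base := by rw [ContinuousMap.comp_apply, f.map_base, g.map_base]
  exists_extension := by
    obtain ⟨F, hF⟩ := f.exists_extension
    obtain ⟨G, hG⟩ := g.exists_extension
    refine ⟨G.comp F, fun x => ?_, fun i => (hG.mapsTo_sub i).comp (hF.mapsTo_sub i)⟩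
    rw [ContinuousMap.comp_apply, hF.eq_on_skel, hG.eq_on_skel, ContinuousMap.comp_apply]

/-- Two morphisms are homotopic if the maps between 1-skeletons are homotopic (within the target
1-skeleton) relative to the base point. -/
def Hom.Homotopic {K : KObj.{u} n} {L : KObj.{v} n} (f g : Hom K L) : Prop :=
  ContinuousMap.HomotopicRel f.toMap g.toMap {K.skelBase}

end KObj

/-! ## The object `S̄ₙ`

The 2-sphere with the cell structure of the presentation
`⟨x₁, …, xₙ₋₁ ∣ x₁, …, xₙ₋₁, xₙ₋₁⁻¹ ⋯ x₁⁻¹⟩`. We cut the unit square along `b = 1/2`, and the upper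
half along the vertical lines `a = k / (n - 1)`, and collapse the boundary of the square and these
vertical segments to one point, the vertex. The horizontal segments
`[(i - 1) / (n - 1), i / (n - 1)] × {1/2}` become the loops `xᵢ`, the `n - 1` upper rectangles become
2-cells attached along `xᵢ`, and the lower half becomes a 2-cell attached along
`xₙ₋₁⁻¹ ⋯ x₁⁻¹` (boundaries traversed counterclockwise). The complement of the collapsed set
in the square is an open disc, so the quotient is a 2-sphere. -/

/-- The part of the unit square that is collapsed to a point. -/
def collapsed (n : ℕ) : Set (I^ Fin 2) :=
  Cube.boundary (Fin 2) ∪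
    {p | (1 / 2 : ℝ) ≤ p 1 ∧ ∃ k : ℕ, ((n - 1 : ℕ) : ℝ) * (p 0 : ℝ) = k}

lemma isClosed_collapsed (n : ℕ) : IsClosed (collapsed n) := by
  refine IsClosed.union ?_ (IsClosed.inter ?_ ?_)
  · have : Cube.boundary (Fin 2) = ⋃ i : Fin 2, {y : I^ Fin 2 | y i = 0 ∨ y i = 1} := by
      ext y; simp [Cube.boundary]
    rw [this]
    refine isClosed_iUnion_of_finite fun i => IsClosed.union ?_ ?_
    · exact isClosed_eq (continuous_apply i) continuous_const
    · exact isClosed_eq (continuous_apply i) continuous_const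
  · exact isClosed_le continuous_const 
      (show Continuous fun p : I^ Fin 2 => ((p 1 : I) : ℝ) by fun_prop)
  · have hc : Continuous fun p : I^ Fin 2 => ((n - 1 : ℕ) : ℝ) * (p 0 : ℝ) := by fun_prop
    have h := Nat.isClosedEmbedding_coe_real.isClosed_range.preimage hc
    have he : {p : I^ Fin 2 | ∃ k : ℕ, ((n - 1 : ℕ) : ℝ) * (p 0 : ℝ) = k} =
        (fun p : I^ Fin 2 => ((n - 1 : ℕ) : ℝ) * (p 0 : ℝ)) ⁻¹' range Nat.cast := by
      ext p
      simp [eq_comm]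
    change IsClosed {p : I^ Fin 2 | ∃ k : ℕ, ((n - 1 : ℕ) : ℝ) * (p 0 : ℝ) = k}
    rw [he]
    exact h

lemma zero_mem_collapsed (n : ℕ) : (0 : I^ Fin 2) ∈ collapsed n := Or.inl ⟨0, Or.inl rfl⟩

/-- The equivalence relation that collapses `collapsed n` to a point. -/
def collapseSetoid (n : ℕ) : Setoid (I^ Fin 2) where
  r p q := p = q ∨ (p ∈ collapsed n ∧ q ∈ collapsed n)
  iseqv := ⟨fun _ => Or.inl rfl, fun h => h.elim (fun h => Or.inl h.symm) fun h => Or.inr h.symm,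
    fun {p q r} h h' => by
      rcases h with rfl | h
      · exact h'
      · rcases h' with rfl | h'
        · exact Or.inr h
        · exact Or.inr ⟨h.1, h'.2⟩⟩

/-- The underlying space of `S̄ₙ`. -/
def SphereSpace (n : ℕ) : Type := Quotient (collapseSetoid n)

namespace SphereSpace

variable {n : ℕ}

instance : TopologicalSpace (SphereSpace n) :=
  inferInstanceAs (TopologicalSpace (Quotient (collapseSetoid n)))

/-- The quotient map from the unit square. -/
def proj (n : ℕ) : C(I^ Fin 2, SphereSpace n) := ⟨Quotient.mk _, continuous_quotient_mk'⟩

lemma proj_eq_iff {p q : I^ Fin 2} :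
    proj n p = proj n q ↔ p = q ∨ (p ∈ collapsed n ∧ q ∈ collapsed n) :=
  Quotient.eq (r := collapseSetoid n)

lemma proj_surjective : Function.Surjective (proj n) := Quotient.mk_surjective

instance : T2Space (SphereSpace n) := by
  let d : (I^ Fin 2) → ℝ := fun p => Metric.infDist p (collapsed n)
  have hd : Continuous d := Metric.continuous_infDist_pt _
  have hd0 : ∀ p, d p = 0 ↔ p ∈ collapsed n := fun p =>
    ((isClosed_collapsed n).mem_iff_infDist_zero ⟨_, zero_mem_collapsed n⟩).symm
  let g : (I^ Fin 2) → ℝ × ℝ × ℝ := fun p => (d p * p 0, d p * p 1, d p)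
  have hg : Continuous g := by fun_prop
  have hgr : ∀ p q, (collapseSetoid n).r p q → g p = g q := by
    rintro p q (rfl | ⟨h1, h2⟩)
    · rfl
    · simp only [g, (hd0 p).2 h1, (hd0 q).2 h2, zero_mul]
  have hl : Continuous (Quotient.lift g hgr) := hg.quotient_lift hgr
  refine T2Space.of_injective_continuous (f := (Quotient.lift g hgr : SphereSpace n → _)) ?_ hl
  rintro ⟨p⟩ ⟨q⟩ (h : g p = g q)
  refine proj_eq_iff.2 ?_
  simp only [g, Prod.mk.injEq] at h
  obtain ⟨h0, h1, h2⟩ := h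
  by_cases hp : d p = 0
  · exact Or.inr ⟨(hd0 p).1 hp, (hd0 q).1 (h2 ▸ hp)⟩
  · left
    rw [← h2] at h0 h1
    ext i
    fin_cases i
    · exact mul_left_cancel₀ hp h0
    · exact mul_left_cancel₀ hp h1

/-- The image in the sphere of the point of the unit square with coordinates `a` and `b`
(clamped to the unit interval). -/
def pt (n : ℕ) (c : ℝ × ℝ) : SphereSpace n :=
  proj n ![projIcc 0 1 zero_le_one c.1, projIcc 0 1 zero_le_one c.2]

lemma continuous_pt (n : ℕ) : Continuous (pt n) := by
  refine (proj n).continuous.comp (continuous_pi fun i => ?_)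
  fin_cases i
  · exact (continuous_projIcc (h := zero_le_one (α := ℝ))).comp continuous_fst
  · exact (continuous_projIcc (h := zero_le_one (α := ℝ))).comp continuous_snd

/-- The coordinates of the points of the collapsed set. -/
def IsBad (n : ℕ) (c : ℝ × ℝ) : Prop :=
  c.1 = 0 ∨ c.1 = 1 ∨ c.2 = 0 ∨ c.2 = 1 ∨ (1 / 2 ≤ c.2 ∧ ∃ k : ℕ, ((n - 1 : ℕ) : ℝ) * c.1 = k)

lemma mem_collapsed_iff {p : I^ Fin 2} : p ∈ collapsed n ↔ IsBad n (p 0, p 1) := by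
  have h0 : ∀ t : I, t = 0 ↔ (t : ℝ) = 0 := fun t => Subtype.ext_iff
  have h1 : ∀ t : I, t = 1 ↔ (t : ℝ) = 1 := fun t => Subtype.ext_iff
  rw [collapsed, mem_union, Cube.boundary, mem_ofPred_eq, mem_ofPred_eq, Fin.exists_fin_two]
  simp only [IsBad, h0, h1, or_assoc]

lemma pt_eq_iff {c c' : ℝ × ℝ} (h : c ∈ Icc (0 : ℝ) 1 ×ˢ Icc (0 : ℝ) 1)
    (h' : c' ∈ Icc (0 : ℝ) 1 ×ˢ Icc (0 : ℝ) 1) :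
    pt n c = pt n c' ↔ c = c' ∨ (IsBad n c ∧ IsBad n c') := by
  obtain ⟨a, b⟩ := c
  obtain ⟨a', b'⟩ := c'
  rw [pt, pt, proj_eq_iff, mem_collapsed_iff, mem_collapsed_iff]
  simp [projIcc_of_mem _ h.1, projIcc_of_mem _ h.2, projIcc_of_mem _ h'.1, projIcc_of_mem _ h'.2,
    funext_iff, Fin.forall_fin_two]

lemma exists_pt_eq (s : SphereSpace n) : ∃ c ∈ Icc (0 : ℝ) 1 ×ˢ Icc (0 : ℝ) 1, pt n c = s := by
  obtain ⟨p, rfl⟩ := proj_surjective s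
  refine ⟨(p 0, p 1), ⟨(p 0).2, (p 1).2⟩, congrArg (proj n) ?_⟩
  ext i
  fin_cases i <;> simp

/-- The cells: one vertex, `n - 1` loops, `n` 2-cells. -/
abbrev Cell (n : ℕ) : ℕ → Type
  | 0 => Unit
  | 1 => Fin (n - 1)
  | 2 => Fin n
  | _ + 3 => Empty

/-- The characteristic maps in coordinates, on the cube `[-1, 1]^d`. -/
def cellCoord (n : ℕ) : (d : ℕ) → Cell n d → (Fin d → ℝ) → ℝ × ℝ
  | 0, _, _ => (0, 0)
  | 1, (i : Fin (n - 1)), x => (((i : ℕ) + (x 0 + 1) / 2) / (n - 1 : ℕ), 1 / 2)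
  | 2, (i : Fin n), x =>
    if (i : ℕ) < n - 1 then (((i : ℕ) + (x 0 + 1) / 2) / (n - 1 : ℕ), (x 1 + 3) / 4)
    else ((x 0 + 1) / 2, (x 1 + 1) / 4)
  | _ + 3, i, _ => i.elim

/-- The characteristic maps. -/
def cellFun (n d : ℕ) (i : Cell n d) (x : Fin d → ℝ) : SphereSpace n := pt n (cellCoord n d i x)

lemma continuous_cellFun (n d : ℕ) (i : Cell n d) : Continuous (cellFun n d i) := by
  refine (continuous_pt n).comp ?_
  match d, i with
  | 0, _ => exact continuous_const
  | 1, (i : Fin (n - 1)) =>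
    change Continuous fun x : Fin 1 → ℝ =>
      (((i : ℕ) + (x 0 + 1) / 2) / (n - 1 : ℕ), (1 / 2 : ℝ))
    fun_prop
  | 2, (i : Fin n) =>
    change Continuous fun x : Fin 2 → ℝ => if (i : ℕ) < n - 1 then
      (((i : ℕ) + (x 0 + 1) / 2) / (n - 1 : ℕ), (x 1 + 3) / 4) else ((x 0 + 1) / 2, (x 1 + 1) / 4)
    split_ifs <;> fun_prop
  | _ + 3, i => exact i.elim

/-- The open rectangles, segments and the point that the open cells correspond to. -/
def Inside (n : ℕ) : (d : ℕ) → Cell n d → ℝ × ℝ → Prop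
  | 0, _, c => c = (0, 0)
  | 1, (i : Fin (n - 1)), c =>
    (i : ℝ) < (n - 1 : ℕ) * c.1 ∧ (n - 1 : ℕ) * c.1 < (i : ℝ) + 1 ∧ c.2 = 1 / 2
  | 2, (i : Fin n), c => if (i : ℕ) < n - 1 then
      (i : ℝ) < (n - 1 : ℕ) * c.1 ∧ (n - 1 : ℕ) * c.1 < (i : ℝ) + 1 ∧ 1 / 2 < c.2 ∧ c.2 < 1
    else 0 < c.1 ∧ c.1 < 1 ∧ 0 < c.2 ∧ c.2 < 1 / 2
  | _ + 3, i, _ => i.elim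

/-- The corresponding closed rectangles and segments. -/
def InsideClosed (n : ℕ) : (d : ℕ) → Cell n d → ℝ × ℝ → Prop
  | 0, _, c => c = (0, 0)
  | 1, (i : Fin (n - 1)), c =>
    (i : ℝ) ≤ (n - 1 : ℕ) * c.1 ∧ (n - 1 : ℕ) * c.1 ≤ (i : ℝ) + 1 ∧ c.2 = 1 / 2
  | 2, (i : Fin n), c => if (i : ℕ) < n - 1 then
      (i : ℝ) ≤ (n - 1 : ℕ) * c.1 ∧ (n - 1 : ℕ) * c.1 ≤ (i : ℝ) + 1 ∧ 1 / 2 ≤ c.2 ∧ c.2 ≤ 1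
    else 0 ≤ c.1 ∧ c.1 ≤ 1 ∧ 0 ≤ c.2 ∧ c.2 ≤ 1 / 2
  | _ + 3, i, _ => i.elim

lemma abs_lt_of_mem_ball {d : ℕ} {x : Fin d → ℝ} (hx : x ∈ Metric.ball (0 : Fin d → ℝ) 1)
    (j : Fin d) : -1 < x j ∧ x j < 1 := by
  rw [mem_ball_zero_iff, pi_norm_lt_iff one_pos] at hx
  exact abs_lt.1 (hx j)

lemma abs_le_of_mem_closedBall {d : ℕ} {x : Fin d → ℝ}
    (hx : x ∈ Metric.closedBall (0 : Fin d → ℝ) 1) (j : Fin d) : -1 ≤ x j ∧ x j ≤ 1 := by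
  rw [mem_closedBall_zero_iff, pi_norm_le_iff_of_nonneg zero_le_one] at hx
  exact abs_le.1 (hx j)

lemma exists_of_mem_sphere {d : ℕ} {x : Fin d → ℝ} (hx : x ∈ Metric.sphere (0 : Fin d → ℝ) 1) :
    ∃ j, x j = -1 ∨ x j = 1 := by
  by_contra! h
  have hc := abs_le_of_mem_closedBall (Metric.sphere_subset_closedBall hx)
  have : x ∈ Metric.ball (0 : Fin d → ℝ) 1 := by
    rw [mem_ball_zero_iff, pi_norm_lt_iff one_pos]
    exact fun j => abs_lt.2 ⟨(hc j).1.lt_of_ne' (h j).1, (hc j).2.lt_of_ne (h j).2⟩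
  rw [mem_ball_zero_iff] at this
  rw [mem_sphere_zero_iff_norm] at hx
  exact this.ne hx

lemma pos_of_lt {k : ℕ} (i : Fin k) : (0 : ℝ) < k := by
  exact_mod_cast (Nat.zero_le _).trans_lt i.2

lemma inside_of_mem_ball {d : ℕ} (i : Cell n d) {x : Fin d → ℝ}
    (hx : x ∈ Metric.ball (0 : Fin d → ℝ) 1) : Inside n d i (cellCoord n d i x) := by
  have h := abs_lt_of_mem_ball hx
  match d, i with
  | 0, _ => rfl
  | 1, (i : Fin (n - 1)) =>
    have hm := pos_of_lt i
    have h0 := h 0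
    simp only [cellCoord, Inside]
    rw [mul_div_cancel₀ _ hm.ne']
    refine ⟨?_, ?_, trivial⟩ <;> linarith
  | 2, (i : Fin n) =>
    have h0 := h 0
    have h1 := h 1
    simp only [cellCoord, Inside]
    split_ifs with hi
    · have hm := pos_of_lt (⟨i, hi⟩ : Fin (n - 1))
      rw [mul_div_cancel₀ _ hm.ne']
      refine ⟨?_, ?_, ?_, ?_⟩ <;> linarith
    · refine ⟨?_, ?_, ?_, ?_⟩ <;> linarith
  | _ + 3, i => exact i.elim

lemma insideClosed_of_mem_closedBall {d : ℕ} (i : Cell n d) {x : Fin d → ℝ}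
    (hx : x ∈ Metric.closedBall (0 : Fin d → ℝ) 1) : InsideClosed n d i (cellCoord n d i x) := by
  have h := abs_le_of_mem_closedBall hx
  match d, i with
  | 0, _ => rfl
  | 1, (i : Fin (n - 1)) =>
    have hm := pos_of_lt i
    have h0 := h 0
    simp only [cellCoord, InsideClosed]
    rw [mul_div_cancel₀ _ hm.ne']
    refine ⟨?_, ?_, trivial⟩ <;> linarith
  | 2, (i : Fin n) =>
    have h0 := h 0
    have h1 := h 1
    simp only [cellCoord, InsideClosed]
    split_ifs with hi
    · have hm := pos_of_lt (⟨i, hi⟩ : Fin (n - 1))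
      rw [mul_div_cancel₀ _ hm.ne']
      refine ⟨?_, ?_, ?_, ?_⟩ <;> linarith
    · refine ⟨?_, ?_, ?_, ?_⟩ <;> linarith
  | _ + 3, i => exact i.elim

lemma exists_of_insideClosed {d : ℕ} (i : Cell n d) {c : ℝ × ℝ} (hc : InsideClosed n d i c) :
    ∃ x ∈ Metric.closedBall (0 : Fin d → ℝ) 1, cellCoord n d i x = c := by
  have key : ∀ {d : ℕ} (x : Fin d → ℝ), (∀ j, -1 ≤ x j ∧ x j ≤ 1) →
      x ∈ Metric.closedBall (0 : Fin d → ℝ) 1 := fun x h => by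
    rw [mem_closedBall_zero_iff, pi_norm_le_iff_of_nonneg zero_le_one]
    exact fun j => abs_le.2 (h j)
  obtain ⟨a, b⟩ := c
  match d, i with
  | 0, _ => exact ⟨0, by simp, hc.symm⟩
  | 1, (i : Fin (n - 1)) =>
    have hm := pos_of_lt i
    obtain ⟨h1, h2, h3⟩ := hc
    refine ⟨![2 * ((n - 1 : ℕ) * a - i) - 1], key _ fun j => ?_, ?_⟩
    · fin_cases j
      simp only [Fin.zero_eta, Matrix.cons_val_zero]
      dsimp only at h1 h2
      constructor <;> linarith
    · simp only [cellCoord, Matrix.cons_val_zero, Prod.mk.injEq]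
      refine ⟨?_, h3.symm⟩
      field_simp
      ring
  | 2, (i : Fin n) =>
    simp only [cellCoord, InsideClosed] at hc ⊢
    split_ifs at hc ⊢ with hi
    · have hm := pos_of_lt (⟨i, hi⟩ : Fin (n - 1))
      obtain ⟨h1, h2, h3, h4⟩ := hc
      refine ⟨![2 * ((n - 1 : ℕ) * a - i) - 1, 4 * b - 3], key _ fun j => ?_, ?_⟩
      · fin_cases j <;> simp <;> constructor <;> linarith
      · simp only [Matrix.cons_val_zero, Matrix.cons_val_one, Prod.mk.injEq]
        refine ⟨?_, by ring⟩
        field_simp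
        ring
    · obtain ⟨h1, h2, h3, h4⟩ := hc
      refine ⟨![2 * a - 1, 4 * b - 1], key _ fun j => ?_, ?_⟩
      · fin_cases j <;> simp <;> constructor <;> linarith
      · simp only [Matrix.cons_val_zero, Matrix.cons_val_one, Prod.mk.injEq]
        constructor <;> ring
  | _ + 3, i => exact i.elim

lemma mem_square_of_insideClosed {d : ℕ} (i : Cell n d) {c : ℝ × ℝ} (hc : InsideClosed n d i c) :
    c ∈ Icc (0 : ℝ) 1 ×ˢ Icc (0 : ℝ) 1 := by
  obtain ⟨a, b⟩ := c
  have key : ∀ i : ℕ, i < n - 1 → (i : ℝ) ≤ (n - 1 : ℕ) * a → (n - 1 : ℕ) * a ≤ (i : ℝ) + 1 →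
      a ∈ Icc (0 : ℝ) 1 := fun i hi h1 h2 => by
    have hm := pos_of_lt (⟨i, hi⟩ : Fin (n - 1))
    have hi' : (i : ℝ) + 1 ≤ (n - 1 : ℕ) := by exact_mod_cast hi
    constructor
    · exact nonneg_of_mul_nonneg_right ((Nat.cast_nonneg i).trans h1) hm
    · exact le_of_mul_le_mul_left (by linarith) hm
  match d, i with
  | 0, _ =>
    obtain ⟨rfl, rfl⟩ := Prod.mk.inj hc
    simp
  | 1, (i : Fin (n - 1)) =>
    obtain ⟨h1, h2, h3⟩ := hc
    dsimp only at h1 h2 h3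
    exact ⟨key i i.2 h1 h2, by rw [h3]; norm_num⟩
  | 2, (i : Fin n) =>
    simp only [InsideClosed] at hc
    split_ifs at hc with hi
    · obtain ⟨h1, h2, h3, h4⟩ := hc
      exact ⟨key i hi h1 h2, by constructor <;> dsimp only <;> linarith⟩
    · obtain ⟨h1, h2, h3, h4⟩ := hc
      exact ⟨⟨h1, h2⟩, by constructor <;> dsimp only <;> linarith⟩
  | _ + 3, i => exact i.elim

lemma Inside.closed {d : ℕ} {i : Cell n d} {c : ℝ × ℝ} (hc : Inside n d i c) :
    InsideClosed n d i c := by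
  match d, i with
  | 0, _ => exact hc
  | 1, (i : Fin (n - 1)) => exact ⟨hc.1.le, hc.2.1.le, hc.2.2⟩
  | 2, (i : Fin n) =>
    simp only [InsideClosed, Inside] at hc ⊢
    split_ifs at hc ⊢ with hi
    · exact ⟨hc.1.le, hc.2.1.le, hc.2.2.1.le, hc.2.2.2.le⟩
    · exact ⟨hc.1.le, hc.2.1.le, hc.2.2.1.le, hc.2.2.2.le⟩
  | _ + 3, i => exact i.elim

lemma isBad_zero (n : ℕ) : IsBad n (0, 0) := Or.inl rfl

lemma nat_not_between {i k : ℕ} (h1 : (i : ℝ) < k) (h2 : (k : ℝ) < (i : ℝ) + 1) : False := by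
  have h1' : i < k := by exact_mod_cast h1
  have h2' : k < i + 1 := by exact_mod_cast h2
  omega

/-- Open cells of positive dimension avoid the vertex. -/
lemma Inside.not_isBad {d : ℕ} {i : Cell n d} {c : ℝ × ℝ} (hc : Inside n d i c) (hd : d ≠ 0) :
    ¬ IsBad n c := by
  obtain ⟨a, b⟩ := c
  have key : ∀ i : ℕ, i < n - 1 → (i : ℝ) < (n - 1 : ℕ) * a → (n - 1 : ℕ) * a < (i : ℝ) + 1 →
      0 < b → b < 1 → ¬ IsBad n (a, b) := fun i hi h1 h2 h3 h4 hb => by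
    have hi' : (i : ℝ) + 1 ≤ (n - 1 : ℕ) := by exact_mod_cast hi
    rcases hb with hb | hb | hb | hb | ⟨-, k, hb⟩ <;> dsimp only at hb
    · rw [hb, mul_zero] at h1
      exact absurd h1 (not_lt.2 (Nat.cast_nonneg _))
    · rw [hb] at h2
      linarith
    · exact h3.ne' hb
    · exact h4.ne hb
    · rw [hb] at h1 h2
      exact nat_not_between h1 h2
  match d, i with
  | 0, _ => exact absurd rfl hd
  | 1, (i : Fin (n - 1)) =>
    obtain ⟨h1, h2, h3⟩ := hc
    dsimp only at h1 h2 h3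
    exact key i i.2 h1 h2 (by rw [h3]; norm_num) (by rw [h3]; norm_num)
  | 2, (i : Fin n) =>
    simp only [Inside] at hc
    split_ifs at hc with hi
    · obtain ⟨h1, h2, h3, h4⟩ := hc
      exact key i hi h1 h2 (by linarith) h4
    · obtain ⟨h1, h2, h3, h4⟩ := hc
      rintro (hb | hb | hb | hb | ⟨hb, -⟩) <;> dsimp only at hb <;> linarith
  | _ + 3, i => exact i.elim

lemma eq_of_between {i j : ℕ} {t : ℝ} (h1 : (i : ℝ) < t) (h2 : t < (i : ℝ) + 1)
    (h3 : (j : ℝ) < t) (h4 : t < (j : ℝ) + 1) : i = j := by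
  have h : (i : ℝ) < (j : ℝ) + 1 := h1.trans h4
  have h' : (j : ℝ) < (i : ℝ) + 1 := h3.trans h2
  have : i < j + 1 := by exact_mod_cast h
  have : j < i + 1 := by exact_mod_cast h'
  omega

/-- Distinct open cells are disjoint. -/
lemma Inside.unique {d e : ℕ} {i : Cell n d} {j : Cell n e} {c : ℝ × ℝ} (hc : Inside n d i c)
    (hc' : Inside n e j c) : (⟨d, i⟩ : Σ d, Cell n d) = ⟨e, j⟩ := by
  have hz : ∀ {d : ℕ} {i : Cell n d} , Inside n d i (0, 0) → d = 0 := fun h => by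
    by_contra hd
    exact h.not_isBad hd (isBad_zero n)
  match d, i, e, j with
  | 0, _, 0, _ => rfl
  | 0, _, e + 1, j =>
    obtain rfl : c = (0, 0) := hc
    exact absurd (hz hc') (by omega)
  | d + 1, i, 0, _ =>
    obtain rfl : c = (0, 0) := hc'
    exact absurd (hz hc) (by omega)
  | 1, (i : Fin (n - 1)), 1, (j : Fin (n - 1)) =>
    have h : i = j := Fin.ext (eq_of_between hc.1 hc.2.1 hc'.1 hc'.2.1)
    rw [h]
  | 1, (i : Fin (n - 1)), 2, (j : Fin n) =>
    exfalso
    have h := hc.2.2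
    simp only [Inside] at hc'
    split_ifs at hc' <;> linarith [hc'.2.2.1, hc'.2.2.2]
  | 2, (i : Fin n), 1, (j : Fin (n - 1)) =>
    exfalso
    have h := hc'.2.2
    simp only [Inside] at hc
    split_ifs at hc <;> linarith [hc.2.2.1, hc.2.2.2]
  | 2, (i : Fin n), 2, (j : Fin n) =>
    have h : i = j := by
      simp only [Inside] at hc hc'
      split_ifs at hc hc' with hi hj hj
      · exact Fin.ext (eq_of_between hc.1 hc.2.1 hc'.1 hc'.2.1)
      · linarith [hc.2.2.1, hc'.2.2.2]
      · linarith [hc'.2.2.1, hc.2.2.2]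
      · exact Fin.ext (by omega)
    rw [h]
  | _ + 3, i, _, _ => exact i.elim
  | _, _, _ + 3, j => exact j.elim

lemma cellCoord_injective {d : ℕ} (i : Cell n d) : Function.Injective (cellCoord n d i) := by
  intro x y h
  match d, i with
  | 0, _ => exact Subsingleton.elim _ _
  | 1, (i : Fin (n - 1)) =>
    have hm := pos_of_lt i
    simp only [cellCoord, Prod.mk.injEq, and_true] at h
    rw [div_left_inj' hm.ne'] at h
    ext j
    fin_cases j
    simp only [Fin.zero_eta]
    linarith
  | 2, (i : Fin n) =>
    simp only [cellCoord] at h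
    split_ifs at h with hi
    · have hm := pos_of_lt (⟨i, hi⟩ : Fin (n - 1))
      simp only [Prod.mk.injEq] at h
      rw [div_left_inj' hm.ne'] at h
      ext j
      fin_cases j
      · simp only [Fin.zero_eta]; linarith
      · simp only [Fin.mk_one]; linarith
    · simp only [Prod.mk.injEq] at h
      ext j
      fin_cases j
      · simp only [Fin.zero_eta]; linarith
      · simp only [Fin.mk_one]; linarith
  | _ + 3, i => exact i.elim

/-- The boundary of a cell lies in cells of lower dimension. -/
lemma boundary_coord {d : ℕ} (i : Cell n d) {x : Fin d → ℝ}
    (hx : x ∈ Metric.sphere (0 : Fin d → ℝ) 1) :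
    0 < d ∧ (IsBad n (cellCoord n d i x) ∨ (d = 2 ∧ (cellCoord n d i x).2 = 1 / 2)) := by
  obtain ⟨j, hj⟩ := exists_of_mem_sphere hx
  refine ⟨(Nat.zero_le _).trans_lt j.2, ?_⟩
  match d, i with
  | 0, _ => exact j.elim0
  | 1, (i : Fin (n - 1)) =>
    have hm := pos_of_lt i
    left
    obtain rfl : j = 0 := Subsingleton.elim _ _
    simp only [cellCoord]
    refine Or.inr (Or.inr (Or.inr (Or.inr ⟨le_rfl, ?_⟩)))
    simp only
    rw [mul_div_cancel₀ _ hm.ne']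
    rcases hj with hj | hj <;> rw [hj]
    · exact ⟨i, by norm_num⟩
    · exact ⟨i + 1, by norm_num⟩
  | 2, (i : Fin n) =>
    have h1 := abs_le_of_mem_closedBall (Metric.sphere_subset_closedBall hx) 1
    simp only [cellCoord, true_and]
    split_ifs with hi
    · have hm := pos_of_lt (⟨i, hi⟩ : Fin (n - 1))
      fin_cases j
      · left
        simp only [Fin.zero_eta] at hj
        refine Or.inr (Or.inr (Or.inr (Or.inr ⟨by dsimp only; linarith, ?_⟩)))
        simp only
        rw [mul_div_cancel₀ _ hm.ne']
        rcases hj with hj | hj <;> rw [hj]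
        · exact ⟨i, by norm_num⟩
        · exact ⟨i + 1, by norm_num⟩
      · simp only [Fin.mk_one] at hj
        rcases hj with hj | hj
        · right; simp only; rw [hj]; norm_num
        · left; right; right; right; left; simp only; rw [hj]; norm_num
    · fin_cases j
      · left
        simp only [Fin.zero_eta] at hj
        rcases hj with hj | hj
        · left; simp only; rw [hj]; norm_num
        · right; left; simp only; rw [hj]; norm_num
      · simp only [Fin.mk_one] at hj
        rcases hj with hj | hj
        · left; right; right; left; simp only; rw [hj]; norm_num
        · right; simp only; rw [hj]; norm_num
  | _ + 3, i => exact i.elim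

lemma exists_between (hn : 2 ≤ n) {a : ℝ} (ha : a ∈ Icc (0 : ℝ) 1) :
    ∃ j : Fin (n - 1), (j : ℝ) ≤ (n - 1 : ℕ) * a ∧ (n - 1 : ℕ) * a ≤ (j : ℝ) + 1 := by
  have hm : (0 : ℝ) ≤ (n - 1 : ℕ) := Nat.cast_nonneg _
  have h0 : 0 ≤ (n - 1 : ℕ) * a := mul_nonneg hm ha.1
  have h1 : (n - 1 : ℕ) * a ≤ (n - 1 : ℕ) := mul_le_of_le_one_right hm ha.2
  by_cases h : ⌊(n - 1 : ℕ) * a⌋₊ < n - 1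
  · exact ⟨⟨_, h⟩, Nat.floor_le h0, (Nat.lt_floor_add_one _).le⟩
  · refine ⟨⟨n - 2, by omega⟩, ?_, ?_⟩
    · rw [not_lt, Nat.le_floor_iff h0] at h
      refine le_trans ?_ h
      exact_mod_cast Nat.sub_le_sub_left (by norm_num) n
    · refine h1.trans ?_
      have : n - 1 = n - 2 + 1 := by omega
      exact_mod_cast this.le

lemma cellFun_injOn {d : ℕ} (i : Cell n d) : InjOn (cellFun n d i) (Metric.ball 0 1) := by
  intro x hx y hy h
  have hx' := inside_of_mem_ball i hx
  have hy' := inside_of_mem_ball i hy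
  rcases (pt_eq_iff (mem_square_of_insideClosed i hx'.closed)
    (mem_square_of_insideClosed i hy'.closed)).1 h with h | h
  · exact cellCoord_injective i h
  · by_cases hd : d = 0
    · subst hd
      exact Subsingleton.elim _ _
    · exact absurd h.1 (hx'.not_isBad hd)

lemma cellFun_ball_disjoint_sphere {d : ℕ} (i : Cell n d) {x y : Fin d → ℝ}
    (hx : x ∈ Metric.ball (0 : Fin d → ℝ) 1) (hy : y ∈ Metric.sphere (0 : Fin d → ℝ) 1) :
    cellFun n d i x ≠ cellFun n d i y := by
  intro h
  have hx' := inside_of_mem_ball i hx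
  have hy' := insideClosed_of_mem_closedBall i (Metric.sphere_subset_closedBall hy)
  obtain ⟨hd, hb⟩ := boundary_coord i hy
  rcases (pt_eq_iff (mem_square_of_insideClosed i hx'.closed)
    (mem_square_of_insideClosed i hy')).1 h with h | h
  · have := cellCoord_injective i h
    subst this
    rw [mem_ball_zero_iff] at hx
    rw [mem_sphere_zero_iff_norm] at hy
    exact hx.ne hy
  · exact hx'.not_isBad hd.ne' h.1

/-- The characteristic map of a cell as a partial equivalence. -/
def cellMap (n d : ℕ) (i : Cell n d) : PartialEquiv (Fin d → ℝ) (SphereSpace n) :=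
  (cellFun_injOn i).toPartialEquiv (cellFun n d i) (Metric.ball 0 1)

lemma cellMap_apply (n d : ℕ) (i : Cell n d) (x : Fin d → ℝ) :
    cellMap n d i x = cellFun n d i x := rfl

lemma continuousOn_cellMap_symm (n d : ℕ) (i : Cell n d) :
    ContinuousOn (cellMap n d i).symm (cellMap n d i).target := by
  rw [continuousOn_iff_isClosed]
  intro A hA
  refine ⟨cellFun n d i '' (A ∩ Metric.closedBall 0 1),
    (((isCompact_closedBall _ _).inter_left hA).image (continuous_cellFun n d i)).isClosed, ?_⟩
  ext s
  simp only [mem_inter_iff, mem_preimage, and_congr_left_iff]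
  intro hs
  have hball : (cellMap n d i).symm s ∈ Metric.ball (0 : Fin d → ℝ) 1 :=
    (cellMap n d i).map_target hs
  have hright : cellFun n d i ((cellMap n d i).symm s) = s := (cellMap n d i).right_inv hs
  constructor
  · intro h
    exact ⟨_, ⟨h, Metric.ball_subset_closedBall hball⟩, hright⟩
  · rintro ⟨x, ⟨hxA, hx⟩, hxs⟩
    rw [← Metric.sphere_union_ball] at hx
    rcases hx with hx | hx
    · exact absurd (hright.trans hxs.symm) (cellFun_ball_disjoint_sphere i hball hx)
    · rwa [cellFun_injOn i hball hx (hright.trans hxs.symm)]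

instance finite_cell (n : ℕ) : ∀ d, Finite (Cell n d)
  | 0 => inferInstanceAs (Finite Unit)
  | 1 => inferInstanceAs (Finite (Fin (n - 1)))
  | 2 => inferInstanceAs (Finite (Fin n))
  | _ + 3 => inferInstanceAs (Finite Empty)

lemma isEmpty_cell (n : ℕ) : ∀ d, 2 < d → IsEmpty (Cell n d)
  | 0, h => absurd h (by omega)
  | 1, h => absurd h (by omega)
  | 2, h => absurd h (by omega)
  | _ + 3, _ => inferInstanceAs (IsEmpty Empty)

lemma pt_mem_closedCell {d : ℕ} (i : Cell n d) {c : ℝ × ℝ} (hc : InsideClosed n d i c) :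
    pt n c ∈ cellMap n d i '' Metric.closedBall 0 1 := by
  obtain ⟨x, hx, rfl⟩ := exists_of_insideClosed i hc
  exact ⟨x, hx, rfl⟩

/-- The vertex. -/
def vertex (n : ℕ) : SphereSpace n := pt n (0, 0)

lemma pt_eq_vertex {c : ℝ × ℝ} (hc : c ∈ Icc (0 : ℝ) 1 ×ˢ Icc (0 : ℝ) 1) (hb : IsBad n c) :
    pt n c = vertex n :=
  (pt_eq_iff hc (by simp)).2 (Or.inr ⟨hb, isBad_zero n⟩)

lemma mapsTo_sphere (hn : 2 ≤ n) (d : ℕ) (i : Cell n d) :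
    MapsTo (cellMap n d i) (Metric.sphere 0 1)
      (⋃ (m < d) (j : Cell n m), cellMap n m j '' Metric.closedBall 0 1) := by
  intro x hx
  have hy := insideClosed_of_mem_closedBall i (Metric.sphere_subset_closedBall hx)
  have hsq := mem_square_of_insideClosed i hy
  obtain ⟨hd, hb⟩ := boundary_coord i hx
  simp only [mem_iUnion]
  rcases hb with hb | ⟨rfl, hb⟩
  · refine ⟨0, hd, (), ?_⟩
    rw [cellMap_apply, cellFun, pt_eq_vertex hsq hb]
    exact pt_mem_closedCell (d := 0) () rfl
  · obtain ⟨j, h1, h2⟩ := exists_between hn hsq.1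
    exact ⟨1, by norm_num, j, pt_mem_closedCell (d := 1) j ⟨h1, h2, hb⟩⟩

lemma iUnion_closedCell (hn : 2 ≤ n) :
    ⋃ (d : ℕ) (j : Cell n d), cellMap n d j '' Metric.closedBall 0 1 = univ := by
  rw [eq_univ_iff_forall]
  intro s
  obtain ⟨c, hc, rfl⟩ := exists_pt_eq s
  simp only [mem_iUnion]
  by_cases hb : c.2 ≤ 1 / 2
  · refine ⟨2, (⟨n - 1, by omega⟩ : Fin n), pt_mem_closedCell (d := 2) _ ?_⟩
    simp only [InsideClosed, lt_irrefl, if_false]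
    exact ⟨hc.1.1, hc.1.2, hc.2.1, hb⟩
  · obtain ⟨j, h1, h2⟩ := exists_between hn hc.1
    have hj := j.2
    refine ⟨2, (⟨j, by omega⟩ : Fin n), pt_mem_closedCell (d := 2) _ ?_⟩
    simp only [InsideClosed, hj, if_true]
    exact ⟨h1, h2, (not_le.1 hb).le, hc.2.2⟩

/-- The CW structure. -/
@[reducible]
def cwComplex (n : ℕ) (hn : 2 ≤ n) : CWComplex (univ : Set (SphereSpace n)) :=
  CWComplex.mkFinite univ (Cell n) (cellMap n)
    (Filter.eventually_atTop.2 ⟨3, fun d hd => isEmpty_cell n d hd⟩)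
    (finite_cell n) (fun _ _ => rfl) (fun d i => (continuous_cellFun n d i).continuousOn)
    (continuousOn_cellMap_symm n)
    (by
      rintro ⟨d, i⟩ - ⟨e, j⟩ - hne
      rw [Function.onFun, Set.disjoint_left]
      rintro s ⟨x, hx, rfl⟩ ⟨y, hy, hxy⟩
      have hx' := inside_of_mem_ball i hx
      have hy' := inside_of_mem_ball j hy
      have hxs := mem_square_of_insideClosed i hx'.closed
      have hys := mem_square_of_insideClosed j hy'.closed
      rcases (pt_eq_iff hys hxs).1 hxy with h | ⟨h1, h2⟩
      · rw [h] at hy'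
        exact hne (hx'.unique hy')
      · have hd : d = 0 := by
          by_contra hd
          exact hx'.not_isBad hd h2
        have he : e = 0 := by
          by_contra he
          exact hy'.not_isBad he h1
        subst hd he
        exact hne rfl)
    (mapsTo_sphere hn) (iUnion_closedCell hn)

end SphereSpace

/-! ### Subcomplexes with one 2-cell -/

/-- The subcomplex `X¹ ∪ e` for a 2-cell `e` of a CW-complex `X`. -/
def skelUnionCell {X : Type u} [TopologicalSpace X] [T2Space X] [CWComplex (univ : Set X)]
    (e : cell (univ : Set X) 2) : Subcomplex (univ : Set X) :=
  RelCWComplex.Subcomplex.mk ((skeleton (univ : Set X) 1 : Set X) ∪ closedCell 2 e)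
    (fun m => {j | m ≤ 1 ∨ (⟨m, j⟩ : Σ m, cell (univ : Set X) m) = ⟨2, e⟩})
    ((Subcomplex.closed _).union isClosed_closedCell) (by
    rw [empty_union]
    ext x
    simp only [mem_iUnion, mem_union, SetLike.mem_coe, CWComplex.mem_skeleton_iff]
    constructor
    · rintro ⟨m, ⟨j, hm | hj⟩, hx⟩
      · exact Or.inl ⟨m, by exact_mod_cast hm, j, hx⟩
      · obtain ⟨rfl, hj⟩ := Sigma.mk.inj hj
        obtain rfl := eq_of_heq hj
        exact Or.inr (openCell_subset_closedCell _ _ hx)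
    · rintro (⟨m, hm, j, hx⟩ | hx)
      · exact ⟨m, ⟨j, Or.inl (by exact_mod_cast hm)⟩, hx⟩
      · rw [← cellFrontier_union_openCell_eq_closedCell] at hx
        rcases hx with hx | hx
        · have := cellFrontier_subset_skeleton (C := (univ : Set X)) 1 e hx
          obtain ⟨m, hm, j, hx⟩ := CWComplex.mem_skeleton_iff.1 this
          exact ⟨m, ⟨j, Or.inl (by exact_mod_cast hm)⟩, hx⟩
        · exact ⟨2, ⟨e, Or.inr rfl⟩, hx⟩)

/-- The `i`-th 2-cell of the sphere, attached along `xᵢ` for `i < n` and along `xₙ₋₁⁻¹ ⋯ x₁⁻¹` for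
`i = n` (counting from one). -/
def sphereFace (n : ℕ) (hn : 2 ≤ n) (i : Fin n) :
    letI := SphereSpace.cwComplex n hn
    cell (univ : Set (SphereSpace n)) 2 := i

/-- The object `S̄ₙ = (S², L₁, …, Lₙ)`, where `Lᵢ` is the union of the 1-skeleton and the `i`-th
2-cell. -/
def sphereObj (n : ℕ) (hn : 2 ≤ n) : KObj.{0} n :=
  letI := SphereSpace.cwComplex n hn
  { X := SphereSpace n
    dim_le_two := SphereSpace.isEmpty_cell n
    base := SphereSpace.vertex n
    base_mem := by
      refine CWComplex.mem_skeleton_iff.2 ⟨0, le_rfl, (), ⟨0, by simp, rfl⟩⟩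
    sub := fun i => skelUnionCell (sphereFace n hn i)
    iUnion_sub := by
      rw [eq_univ_iff_forall]
      intro x
      have hx : x ∈ ⋃ (d : ℕ) (j : cell (univ : Set (SphereSpace n)) d), closedCell d j := by
        rw [CWComplex.union]; trivial
      simp only [mem_iUnion] at hx ⊢
      obtain ⟨d, j, hx⟩ := hx
      have h1 : ∀ (d : ℕ) (j : cell (univ : Set (SphereSpace n)) d), d ≤ 1 → x ∈ closedCell d j →
          ∃ i : Fin n, x ∈ (skelUnionCell (sphereFace n hn i) :
            Set (SphereSpace n)) := fun d j hd hx =>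
        ⟨⟨0, by omega⟩, Or.inl (skeleton_mono (by exact_mod_cast hd)
          (closedCell_subset_skeleton d j hx))⟩
      match d, j, hx with
      | 0, j, hx => exact h1 0 j (by norm_num) hx
      | 1, j, hx => exact h1 1 j le_rfl hx
      | 2, j, hx => exact ⟨j, Or.inr hx⟩
      | _ + 3, j, _ => exact Empty.elim j
    iInter_sub := by
      refine subset_antisymm (fun x hx => ?_) (subset_iInter fun i => subset_union_left)
      by_contra hs
      have h : ∀ i : Fin n, x ∈ openCell (C := (univ : Set (SphereSpace n))) 2 (sphereFace n hn i) :=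
          fun i => by
        rcases mem_iInter.1 hx i with h | h
        · exact absurd h hs
        · rw [← cellFrontier_union_openCell_eq_closedCell] at h
          refine h.resolve_left fun h => hs ?_
          exact cellFrontier_subset_skeleton (C := (univ : Set (SphereSpace n))) 1 _ h
      refine (disjoint_openCell_of_ne (C := (univ : Set (SphereSpace n))) ?_).notMem_of_mem_left
        (h ⟨0, by omega⟩) (h ⟨1, by omega⟩)
      intro he
      have h01 : (⟨0, by omega⟩ : Fin n) = ⟨1, by omega⟩ := eq_of_heq (Sigma.mk.inj he).2
      exact absurd (congrArg Fin.val h01) (by norm_num) }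

/-- The fundamental class of the 2-sphere: the class in `π₂(S²)` of the quotient map `I² → S²`. -/
def sphereClass (n : ℕ) (hn : 2 ≤ n) : π_ 2 (sphereObj n hn).X (sphereObj n hn).base :=
  piTwoMk (X := SphereSpace n) (x := SphereSpace.vertex n)
    ⟨SphereSpace.proj n, fun p hp => by
      refine SphereSpace.proj_eq_iff.2 (Or.inr ⟨Or.inl hp, ?_⟩)
      exact SphereSpace.mem_collapsed_iff.2 (by simp [SphereSpace.isBad_zero])⟩

end

/-! ## Groups with two retractions onto a subgroup -/

/-! Let A = K¹ and let G be the fundamental group of the space of paths in K with both ends in A,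
based at a constant path. An element of G is a square in K whose vertical sides are constant and
whose horizontal sides run in A. Start and end points give homomorphisms s, t : G → π₁(A), both
split by the constant paths, and ker s commutes with ker t by an Eckmann–Hilton argument
(`commute_ker`), so G is a cat¹-group. Spheres in K give classes in ker s ∩ ker t. The kernel of
π₂(K) → G lies in the image of every π₂(Kᵢ) (`mem_range_inclHom_of_mem_ker`), so nothing relevant to
the quotient is lost in G.

Let Nᵢ ≤ G consist of the classes of squares inside Kᵢ. The geometric heart is that the Nᵢ generate
G (`iSup_confined_eq_top`). Perturb a square so that the lines of a fine grid miss the centres of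
all 2-cells, then stretch the cells radially until the grid lines land in K¹ and each grid square
lands in a single Kᵢ. The square is then a product of conjugates of its pieces, by a calculation in
the fundamental groupoid of the preimage of A (`mem_iSup_confined_of_grid`).

Because the kernels commute, Nᵢ ∩ ker s and Nᵢ ∩ ker s ∩ ker t are normal in G, and the latter comes
from π₂(Kᵢ) (`inf_ker_le_map_range_inclHom`).

Well-definedness and naturality: extensions of homotopic maps of 1-skeletons induce homomorphisms φ,
ψ of the groups G. For g ∈ Nᵢ the element φ(g)ψ(g)⁻¹ lies in the target's Nᵢ ∩ ker s ∩ ker t. Hence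
φ and ψ agree on generators modulo a normal subgroup, so everywhere, in particular on spheres
(`piTwoMap_mul_inv_mem`).

Surjectivity: a sphere lies in ker s, which is the join of the normal subgroups Nᵢ ∩ ker s, so its
class is a product c₁⋯cₙ with one relative disc in each Kᵢ. Discs for c₁⁻¹, …, cₙ₋₁⁻¹ side by side,
turned upside down, fill the upper half of the square defining S̄ₙ, and a disc for cₙ fills the
lower half. Since t of the product is trivial, the two halves fit along the seam, and the result is
a morphism from S̄ₙ with the given class (`exists_hom_of_prod`). -/

section CatOneGroup

variable {G H ι : Type*} [Group G] [Group H] {s t : G →* H} {e : H →* G}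

/-- If `ker t` commutes with `ker s`, then a subgroup of `ker s` that is normalized by the image of
the common section of `s` and `t` is normal. -/
lemma normal_of_conj_section (ht : ∀ h, t (e h) = h)
    (hst : ∀ a ∈ t.ker, ∀ b ∈ s.ker, Commute a b) {N : Subgroup G} (hN : N ≤ s.ker)
    (he : ∀ h, ∀ g ∈ N, e h * g * (e h)⁻¹ ∈ N) : N.Normal := by
  refine ⟨fun g hg x => ?_⟩
  -- Every x is an element of ker t times an element of the section. The section normalizes N, and
  -- ker t commutes with N because N lies in ker s.
  have h1 : x * (e (t x))⁻¹ ∈ t.ker := by simp [MonoidHom.mem_ker, ht]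
  have h2 := hst _ h1 _ (hN (he (t x) g hg))
  have h3 : x * g * x⁻¹ = (x * (e (t x))⁻¹) * (e (t x) * g * (e (t x))⁻¹) *
      (x * (e (t x))⁻¹)⁻¹ := by group
  rw [h3, h2.eq, mul_inv_cancel_right]
  exact he _ _ hg

lemma normal_inf_ker (ht : ∀ h, t (e h) = h)
    (hst : ∀ a ∈ t.ker, ∀ b ∈ s.ker, Commute a b) {N : Subgroup G} (he : ∀ h, e h ∈ N) :
    (N ⊓ s.ker).Normal :=
  normal_of_conj_section ht hst inf_le_right fun h _ hg =>
    ⟨N.mul_mem (N.mul_mem (he h) hg.1) (N.inv_mem (he h)), s.normal_ker.conj_mem _ hg.2 _⟩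

/-- For squares confined to a subspace these are the spherical classes. Their normality is what
allows working modulo them. -/
lemma normal_inf_ker_inf_ker (ht : ∀ h, t (e h) = h)
    (hst : ∀ a ∈ t.ker, ∀ b ∈ s.ker, Commute a b) {N : Subgroup G} (he : ∀ h, e h ∈ N) :
    (N ⊓ s.ker ⊓ t.ker).Normal :=
  haveI := normal_inf_ker ht hst he
  haveI := t.normal_ker
  inferInstance

/-- Each g in N i factors as g · e(s g)⁻¹, which lies in N i ∩ ker s, times e(s g). So the join on
the right together with the section is the whole group, and in an element of ker s the section part
is trivial. -/
lemma ker_le_iSup_inf_ker (hs : ∀ h, s (e h) = h) (ht : ∀ h, t (e h) = h)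
    (hst : ∀ a ∈ t.ker, ∀ b ∈ s.ker, Commute a b) {N : ι → Subgroup G} (he : ∀ i h, e h ∈ N i)
    (hN : ⨆ i, N i = ⊤) : s.ker ≤ ⨆ i, N i ⊓ s.ker := by
  have : ∀ i, (N i ⊓ s.ker).Normal := fun i => normal_inf_ker ht hst (he i)
  have hnormal : (⨆ i, N i ⊓ s.ker).Normal := Subgroup.iSup_normal _
  have htop : (⨆ i, N i ⊓ s.ker) ⊔ e.range = ⊤ := by
    rw [eq_top_iff, ← hN]
    refine iSup_le fun i g hg => ?_
    have h1 : g * (e (s g))⁻¹ ∈ N i ⊓ s.ker :=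
      ⟨(N i).mul_mem hg ((N i).inv_mem (he i _)), by simp [hs]⟩
    rw [← inv_mul_cancel_right g (e (s g))]
    exact Subgroup.mul_mem _ (Subgroup.mem_sup_left (Subgroup.mem_iSup_of_mem i h1))
      (Subgroup.mem_sup_right ⟨_, rfl⟩)
  intro g hg
  have hg' : g ∈ (⨆ i, N i ⊓ s.ker) ⊔ e.range := htop ▸ Subgroup.mem_top g
  obtain ⟨m, hm, _, ⟨h, rfl⟩, rfl⟩ := Subgroup.mem_sup_of_normal_left.1 hg'
  have hm' : s m = 1 := (iSup_le fun i => inf_le_right : (⨆ i, N i ⊓ s.ker) ≤ s.ker) hm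
  have : h = 1 := by simpa [MonoidHom.mem_ker, hm', hs] using hg
  simpa [this] using hm

/-- Two homomorphisms that agree modulo a normal subgroup on generators agree modulo it. -/
lemma mul_inv_mem_of_iSup_eq_top {N : ι → Subgroup G} (hN : ⨆ i, N i = ⊤) {φ ψ : G →* H}
    {Z : Subgroup H} [Z.Normal] (h : ∀ i, ∀ g ∈ N i, φ g * (ψ g)⁻¹ ∈ Z) (g : G) :
    φ g * (ψ g)⁻¹ ∈ Z := by
  have key : ∀ g, φ g * (ψ g)⁻¹ ∈ Z ↔
      g ∈ ((QuotientGroup.mk' Z).comp φ).eqLocus ((QuotientGroup.mk' Z).comp ψ) := fun g => by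
    rw [← div_eq_mul_inv, ← QuotientGroup.eq_iff_div_mem]
    rfl
  have hle : ⨆ i, N i ≤ ((QuotientGroup.mk' Z).comp φ).eqLocus ((QuotientGroup.mk' Z).comp ψ) :=
    iSup_le fun i g hg => (key g).1 (h i g hg)
  rw [key]
  exact hle (hN ▸ Subgroup.mem_top g)

/-- An element of the join of finitely many normal subgroups is a product of elements of these, the
factor of the last subgroup coming last. -/
lemma exists_prod_of_mem_iSup : ∀ {m : ℕ} {N : Fin m → Subgroup G} [∀ i, (N i).Normal] {g : G},
    g ∈ ⨆ i, N i → ∃ c : Fin m → G, (∀ i, c i ∈ N i) ∧ g = (List.ofFn c).prod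
  | 0, N, _, g, hg => ⟨fun i => i.elim0, fun i => i.elim0, by simpa [iSup_of_empty] using hg⟩
  | m + 1, N, _, g, hg => by
    have h1 : ⨆ i, N i ≤ N 0 ⊔ ⨆ i : Fin m, N i.succ := iSup_le fun i => by
      refine Fin.cases le_sup_left (fun i => ?_) i
      exact (le_iSup (fun i : Fin m => N i.succ) i).trans le_sup_right
    obtain ⟨a, ha, b, hb, rfl⟩ := Subgroup.mem_sup_of_normal_left.1 (h1 hg)
    obtain ⟨c, hc, rfl⟩ := exists_prod_of_mem_iSup hb
    exact ⟨Fin.cons a c, fun i => Fin.cases ha hc i, by simp [List.ofFn_succ]⟩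

end CatOneGroup

noncomputable section

/-! ## Straight edges -/

section Edge

variable {E : Type*} [AddCommGroup E] [Module ℝ E] [TopologicalSpace E] [IsTopologicalAddGroup E]
  [ContinuousSMul ℝ E] {Y : Type*} [TopologicalSpace Y] {y : Y}

/-- The straight path between two points of a real vector space. -/
def segPath (a b : E) : Path a b where
  toFun t := AffineMap.lineMap a b (t : ℝ)
  continuous_toFun := by
    simp only [AffineMap.lineMap_apply_module]
    fun_prop
  source' := by simp
  target' := by simp

/-- The class of the loop that a map on a real vector space traces along a straight edge. -/
def edgeClass (S : C(E, Y)) {a b : E} (ha : S a = y) (hb : S b = y) : FundamentalGroup Y y :=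
  FundamentalGroup.fromPath (.mk (((segPath a b).map S.continuous).cast ha.symm hb.symm))

/-- E is contractible, so two consecutive edges are homotopic to the third side of the triangle. The
factors are reversed because the product in `FundamentalGroup` composes from right to left. -/
lemma edgeClass_mul (S : C(E, Y)) {a b c : E} (ha : S a = y) (hb : S b = y) (hc : S c = y) :
    edgeClass S hb hc * edgeClass S ha hb = edgeClass S ha hc := by
  rw [FundamentalGroup.mul_def]
  subst hb
  have : ContractibleSpace E := RealTopologicalVectorSpace.contractibleSpace
  have h := SimplyConnectedSpace.paths_homotopic ((segPath a b).trans (segPath b c)) (segPath a c)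
  refine Path.Homotopic.Quotient.eq.2 ?_
  have h2 := (h.map S).pathCast ha.symm hc.symm
  rw [Path.map_trans] at h2
  exact h2

lemma edgeClass_eq (S : C(E, Y)) {a b : E} (ha : S a = y) (hb : S b = y) (θ : Path y y)
    (h : ∀ s : I, S (AffineMap.lineMap a b (s : ℝ)) = θ s) :
    edgeClass S ha hb = FundamentalGroup.fromPath (.mk θ) := by
  refine congrArg FundamentalGroup.fromPath (congrArg Path.Homotopic.Quotient.mk ?_)
  ext s
  exact h s

end Edge

/-! ## Paths with both endpoints in a subset -/

variable {X : Type u} [TopologicalSpace X] {A : Set X}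

/-- The space of paths in `X` with both endpoints in `A`. -/
abbrev RelPath (A : Set X) : Type u := {γ : C(I, X) // γ 0 ∈ A ∧ γ 1 ∈ A}

namespace RelPath

/-- The starting point. -/
def src : C(RelPath A, A) := ⟨fun γ => ⟨γ.1 0, γ.2.1⟩, by
  refine Continuous.subtype_mk ?_ _
  exact (continuous_eval_const (0 : I)).comp continuous_subtype_val⟩

/-- The end point. -/
def tgt : C(RelPath A, A) := ⟨fun γ => ⟨γ.1 1, γ.2.2⟩, by
  refine Continuous.subtype_mk ?_ _
  exact (continuous_eval_const (1 : I)).comp continuous_subtype_val⟩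

/-- The constant paths. -/
def const : C(A, RelPath A) :=
  ⟨fun a => ⟨ContinuousMap.const I a, a.2, a.2⟩, by
    refine Continuous.subtype_mk ?_ _
    exact ContinuousMap.const'.continuous.comp continuous_subtype_val⟩

/-- A continuous family of paths. -/
def ofFamily {E : Type*} [TopologicalSpace E] (S : E → ℝ → X) (hS : Continuous fun p : E × ℝ => S p.1 p.2)
    (h0 : ∀ e, S e 0 ∈ A) (h1 : ∀ e, S e 1 ∈ A) : C(E, RelPath A) where
  toFun e := ⟨⟨fun t => S e t, by fun_prop⟩, by simpa using h0 e, by simpa using h1 e⟩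
  continuous_toFun := by
    refine Continuous.subtype_mk ?_ _
    refine ContinuousMap.continuous_of_continuous_uncurry _ ?_
    change Continuous fun p : E × I => S p.1 p.2
    fun_prop

/-- Loops of paths, based at a constant path. -/
abbrev Loop (x : A) : Type u := Path (const x) (const x)

variable {x : A}

/-- The loop of paths given by a map of a square. -/
def loopOf (S : ℝ → ℝ → X) (hS : Continuous fun p : ℝ × ℝ => S p.1 p.2) (h0 : ∀ s : I, S s 0 ∈ A)
    (h1 : ∀ s : I, S s 1 ∈ A) (hl : ∀ t : I, S 0 t = x) (hr : ∀ t : I, S 1 t = x) : Loop x where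
  toContinuousMap := ofFamily (fun (s : I) t => S s t) (by fun_prop) h0 h1
  source' := Subtype.ext (ContinuousMap.ext fun t => by
    change S (0 : I) t = x; rw [← hl t]; rfl)
  target' := Subtype.ext (ContinuousMap.ext fun t => by
    change S (1 : I) t = x; rw [← hr t]; rfl)

@[simp] lemma loopOf_apply (S : ℝ → ℝ → X) (hS h0 h1 hl hr) (s t : I) :
    (loopOf (A := A) (x := x) S hS h0 h1 hl hr s).1 t = S s t := rfl

/-- The map of the plane that a loop of paths defines. -/
def sheet (θ : Loop x) (s t : ℝ) : X :=
  (θ (projIcc 0 1 zero_le_one s)).1 (projIcc 0 1 zero_le_one t)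

@[fun_prop]
lemma continuous_sheet (θ : Loop x) : Continuous fun p : ℝ × ℝ => sheet θ p.1 p.2 := by
  have h : Continuous fun p : I × I => (θ p.1).1 p.2 := by fun_prop
  exact h.comp (f := fun p : ℝ × ℝ =>
    (projIcc (0 : ℝ) 1 zero_le_one p.1, projIcc (0 : ℝ) 1 zero_le_one p.2))
    ((continuous_projIcc.comp continuous_fst).prodMk (continuous_projIcc.comp continuous_snd))

@[fun_prop]
lemma Continuous.sheet {Z : Type*} [TopologicalSpace Z] (θ : Loop x) {f g : Z → ℝ}
    (hf : Continuous f) (hg : Continuous g) : Continuous fun z => sheet θ (f z) (g z) :=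
  (continuous_sheet θ).comp (hf.prodMk hg)

@[simp] lemma sheet_coe (θ : Loop x) (s t : I) : sheet θ s t = (θ s).1 t := by
  simp [sheet]

lemma sheet_of_fst_le (θ : Loop x) {s : ℝ} (hs : s ≤ 0) (t : ℝ) : sheet θ s t = x := by
  rw [sheet, projIcc_of_le_left _ hs]
  exact congrArg (fun γ : RelPath A => γ.1 _) θ.source

lemma sheet_of_le_fst (θ : Loop x) {s : ℝ} (hs : 1 ≤ s) (t : ℝ) : sheet θ s t = x := by
  rw [sheet, projIcc_of_right_le _ hs]
  exact congrArg (fun γ : RelPath A => γ.1 _) θ.target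

lemma sheet_of_snd_le (θ : Loop x) (s : ℝ) {t : ℝ} (ht : t ≤ 0) :
    sheet θ s t = src (θ (projIcc 0 1 zero_le_one s)) := by
  rw [sheet, projIcc_of_le_left _ ht]
  rfl

lemma sheet_of_le_snd (θ : Loop x) (s : ℝ) {t : ℝ} (ht : 1 ≤ t) :
    sheet θ s t = tgt (θ (projIcc 0 1 zero_le_one s)) := by
  rw [sheet, projIcc_of_right_le _ ht]
  rfl

lemma sheet_mem_of_snd_le (θ : Loop x) (s : ℝ) {t : ℝ} (ht : t ≤ 0) : sheet θ s t ∈ A := by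
  rw [sheet_of_snd_le θ s ht]; exact Subtype.coe_prop _

lemma sheet_mem_of_le_snd (θ : Loop x) (s : ℝ) {t : ℝ} (ht : 1 ≤ t) : sheet θ s t ∈ A := by
  rw [sheet_of_le_snd θ s ht]; exact Subtype.coe_prop _

/-- The class of a loop of paths. -/
def cls (θ : Loop x) : FundamentalGroup (RelPath A) (const x) :=
  FundamentalGroup.fromPath (.mk θ)

lemma cls_surjective (g : FundamentalGroup (RelPath A) (const x)) : ∃ θ : Loop x, cls θ = g :=
  Path.Homotopic.Quotient.mk_surjective g

/-- The reversal of factors here fixes the order of all products below. -/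
lemma cls_trans (θ θ' : Loop x) : cls (θ.trans θ') = cls θ' * cls θ := rfl

lemma cls_symm (θ : Loop x) : cls θ.symm = (cls θ)⁻¹ := rfl

lemma cls_refl : cls (Path.refl (const x)) = 1 := rfl

/-- The horizontal sides may move freely in A: a homotopy of loops in `RelPath A` only pins down the
vertical sides. -/
lemma cls_eq_of_homotopy {θ θ' : Loop x} (H : ℝ → ℝ → ℝ → X)
    (hH : Continuous fun p : ℝ × ℝ × ℝ => H p.1 p.2.1 p.2.2)
    (h0 : ∀ r s : I, H r s 0 ∈ A) (h1 : ∀ r s : I, H r s 1 ∈ A)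
    (hl : ∀ r t : I, H r 0 t = x) (hr : ∀ r t : I, H r 1 t = x)
    (hθ : ∀ s t : I, H 0 s t = (θ s).1 t) (hθ' : ∀ s t : I, H 1 s t = (θ' s).1 t) :
    cls θ = cls θ' := by
  refine congrArg FundamentalGroup.fromPath (Path.Homotopic.Quotient.eq.2 ⟨?_⟩)
  refine ⟨⟨ofFamily (E := I × I) (fun e t => H e.1 e.2 t) (by fun_prop) (fun e => h0 _ _)
    (fun e => h1 _ _), fun s => ?_, fun s => ?_⟩, ?_⟩
  · exact Subtype.ext (ContinuousMap.ext fun t => hθ s t)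
  · exact Subtype.ext (ContinuousMap.ext fun t => hθ' s t)
  · rintro r s (rfl | rfl)
    · refine Subtype.ext (ContinuousMap.ext fun t => (hl r t).trans ?_)
      exact (congrArg (fun γ : RelPath A => γ.1 t) θ.source).symm
    · refine Subtype.ext (ContinuousMap.ext fun t => (hr r t).trans ?_)
      exact (congrArg (fun γ : RelPath A => γ.1 t) θ.target).symm

/-- The homomorphism induced by the starting points. -/
def srcHom (x : A) : FundamentalGroup (RelPath A) (const x) →* FundamentalGroup A x :=
  FundamentalGroup.map src (const x)

/-- The homomorphism induced by the end points. -/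
def tgtHom (x : A) : FundamentalGroup (RelPath A) (const x) →* FundamentalGroup A x :=
  FundamentalGroup.map tgt (const x)

/-- The homomorphism induced by the constant paths. -/
def constHom (x : A) : FundamentalGroup A x →* FundamentalGroup (RelPath A) (const x) :=
  FundamentalGroup.map const x

lemma srcHom_constHom (g : FundamentalGroup A x) : srcHom x (constHom x g) = g := by
  obtain ⟨p, rfl⟩ := Path.Homotopic.Quotient.mk_surjective g
  rfl

lemma tgtHom_constHom (g : FundamentalGroup A x) : tgtHom x (constHom x g) = g := by
  obtain ⟨p, rfl⟩ := Path.Homotopic.Quotient.mk_surjective g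
  rfl

/-- The loop of starting points of a loop of paths. -/
def srcLoop (θ : Loop x) : Path x x := θ.map src.continuous

/-- The loop of end points of a loop of paths. -/
def tgtLoop (θ : Loop x) : Path x x := θ.map tgt.continuous

lemma srcLoop_apply (θ : Loop x) (s : I) : (srcLoop θ s : X) = (θ s).1 0 := rfl

lemma tgtLoop_apply (θ : Loop x) (s : I) : (tgtLoop θ s : X) = (θ s).1 1 := rfl

lemma srcHom_cls (θ : Loop x) : srcHom x (cls θ) = FundamentalGroup.fromPath (.mk (srcLoop θ)) :=
  rfl

lemma tgtHom_cls (θ : Loop x) : tgtHom x (cls θ) = FundamentalGroup.fromPath (.mk (tgtLoop θ)) :=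
  rfl

/-- The classes of the loops of paths that lie in `Y`. -/
def confined (Y : Set X) (x : A) (hx : (x : X) ∈ Y) :
    Subgroup (FundamentalGroup (RelPath A) (const x)) where
  carrier := {g | ∃ θ : Loop x, cls θ = g ∧ ∀ s t, (θ s).1 t ∈ Y}
  one_mem' := ⟨Path.refl _, rfl, fun _ _ => hx⟩
  mul_mem' := by
    rintro _ _ ⟨θ, rfl, h⟩ ⟨θ', rfl, h'⟩
    refine ⟨θ'.trans θ, rfl, fun s t => ?_⟩
    rw [Path.trans_apply]
    split_ifs
    · exact h' _ _
    · exact h _ _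
  inv_mem' := by
    rintro _ ⟨θ, rfl, h⟩
    exact ⟨θ.symm, rfl, fun s t => h _ _⟩

/-- Constant paths at points of A never leave A. So each of these subgroups contains the section, as
the algebraic lemmas require. -/
lemma constHom_mem_confined {Y : Set X} (hA : A ⊆ Y) (g : FundamentalGroup A x) :
    constHom x g ∈ confined Y x (hA x.2) := by
  obtain ⟨p, rfl⟩ := Path.Homotopic.Quotient.mk_surjective g
  exact ⟨p.map const.continuous, rfl, fun s t => hA (p s).2⟩

end RelPath
end

/-! ### Changing the ends of loops of paths, Eckmann–Hilton, gluing of discs -/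

noncomputable section

variable {X : Type u} [TopologicalSpace X] {A : Set X}

namespace RelPath

variable {x : A}

/-- A loop of paths can be changed by homotopies of its endpoint loops. -/
lemma exists_adjust (θ : Loop x) {ω₀ ω₁ : Path x x} (h₀ : (srcLoop θ).Homotopic ω₀)
    (h₁ : (tgtLoop θ).Homotopic ω₁) :
    ∃ θ' : Loop x, cls θ' = cls θ ∧ srcLoop θ' = ω₀ ∧ tgtLoop θ' = ω₁ ∧
      ∀ Y : Set X, A ⊆ Y → (∀ s t, (θ s).1 t ∈ Y) → ∀ s t, (θ' s).1 t ∈ Y := by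
  obtain ⟨H₀⟩ := h₀
  obtain ⟨H₁⟩ := h₁
  let clamp : ℝ → I := projIcc 0 1 zero_le_one
  have hc : Continuous clamp := continuous_projIcc
  have hcI : ∀ s : I, clamp s = s := fun s => projIcc_val _ s
  -- The sheet of θ on 0 ≤ z ≤ 1 with two collars in A swept out by the homotopies, one for −1 ≤ z ≤
  -- 0 and one for 1 ≤ z ≤ 2.
  let W : ℝ → ℝ → X := fun s z => if z ≤ 0 then H₀ (clamp (-z), clamp s) else
    if z ≤ 1 then sheet θ s z else H₁ (clamp (z - 1), clamp s)
  have hW : Continuous fun p : ℝ × ℝ => W p.1 p.2 := by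
    refine Continuous.if_le (by fun_prop) (Continuous.if_le (by fun_prop) (by fun_prop)
      (by fun_prop) (by fun_prop) ?_) (by fun_prop) (by fun_prop) ?_
    · rintro ⟨s, z⟩ (rfl : z = 1)
      dsimp only
      rw [sub_self, sheet_of_le_snd θ s le_rfl, show clamp 0 = 0 from hcI 0, H₁.apply_zero]
      rfl
    · rintro ⟨s, z⟩ (rfl : z = 0)
      dsimp only
      rw [neg_zero, if_pos zero_le_one, sheet_of_snd_le θ s le_rfl, show clamp 0 = 0 from hcI 0,
        H₀.apply_zero]
      rfl
  have hWA₀ : ∀ s z, z ≤ 0 → W s z ∈ A := fun s z hz => by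
    simp only [W, if_pos hz]; exact Subtype.coe_prop _
  have hWA₁ : ∀ s z, 1 ≤ z → W s z ∈ A := fun s z hz => by
    have : ¬ z ≤ 0 := by linarith
    simp only [W, if_neg this]
    split_ifs
    · exact sheet_mem_of_le_snd θ s hz
    · exact Subtype.coe_prop _
  have hl : ∀ z, W 0 z = x := fun z => by
    simp only [W, show clamp 0 = 0 from hcI 0]
    split_ifs
    · rw [H₀.source]
    · exact sheet_of_fst_le θ le_rfl z
    · rw [H₁.source]
  have hr : ∀ z, W 1 z = x := fun z => by
    simp only [W, show clamp 1 = 1 from hcI 1]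
    split_ifs
    · rw [H₀.target]
    · exact sheet_of_le_fst θ le_rfl z
    · rw [H₁.target]
  refine ⟨loopOf (fun s t => W s (3 * t - 1)) ?_ (fun s => hWA₀ _ _ (by norm_num))
    (fun s => hWA₁ _ _ (by norm_num)) (fun t => hl _) (fun t => hr _), ?_, ?_, ?_, ?_⟩
  · exact hW.comp (f := fun p : ℝ × ℝ => (p.1, 3 * p.2 - 1)) (by fun_prop)
  · symm
    -- The height interval grows from [0, 1] to [−r, 1 + r] and takes in both collars at r = 1. Its
    -- ends stay in A throughout.
    refine cls_eq_of_homotopy (fun r s t => W s ((1 + 2 * r) * t - r))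
      (hW.comp (f := fun p : ℝ × ℝ × ℝ => (p.2.1, (1 + 2 * p.1) * p.2.2 - p.1)) (by fun_prop))
      (fun r s => hWA₀ _ _ ?_) (fun r s => hWA₁ _ _ ?_) (fun r t => hl _) (fun r t => hr _)
      (fun s t => ?_) (fun s t => ?_)
    · have := r.2.1; linarith
    · have := r.2.1; linarith
    · rw [mul_zero, add_zero, one_mul, sub_zero]
      simp only [W, if_pos t.2.2, sheet_coe]
      split_ifs with ht
      · have ht0 : t = 0 := Subtype.ext (le_antisymm ht t.2.1)
        rw [ht0, hcI s]
        have := congrArg Subtype.val (H₀.apply_zero s)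
        simp only [Icc.coe_zero, neg_zero, show clamp 0 = 0 from hcI 0]
        exact this
      · rfl
    · rw [loopOf_apply]; ring_nf
  · ext s
    rw [srcLoop_apply, loopOf_apply]
    simp only [W, Icc.coe_zero, mul_zero, zero_sub, neg_neg, hcI s,
      show clamp 1 = 1 from hcI 1, H₀.apply_one]
    norm_num
  · ext s
    rw [tgtLoop_apply, loopOf_apply]
    have h : clamp ((3 : ℝ) * (1 : I) - 1 - 1) = 1 := by
      rw [show (3 : ℝ) * (1 : I) - 1 - 1 = (1 : I) by norm_num, hcI]
    simp only [W, hcI s, h, H₁.apply_one]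
    norm_num
  · intro Y hY hθ s t
    rw [loopOf_apply]
    simp only [W]
    split_ifs
    · exact hY (Subtype.coe_prop _)
    · exact hθ _ _
    · exact hY (Subtype.coe_prop _)

/-- Two loops of paths, the paths of the first ending and those of the second starting at the base
point, can be multiplied by concatenating the paths, and they commute. -/
lemma exists_concat (α β : Loop x) (hα : ∀ s, (α s).1 1 = x) (hβ : ∀ s, (β s).1 0 = x) :
    ∃ γ : Loop x, (∀ s t : I, (γ s).1 t = if (t : ℝ) ≤ 1 / 2 then sheet α s (2 * t) else
      sheet β s (2 * t - 1)) ∧ cls γ = cls β * cls α ∧ cls γ = cls α * cls β := by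
  have hα' : ∀ s t : ℝ, 1 ≤ t → sheet α s t = x := fun s t ht => by
    rw [sheet_of_le_snd α s ht]; exact hα _
  have hβ' : ∀ s t : ℝ, t ≤ 0 → sheet β s t = x := fun s t ht => by
    rw [sheet_of_snd_le β s ht]; exact hβ _
  -- Eckmann–Hilton: α and β get independent parameters e.1 and e.2. The sides of the unit square
  -- read α or β, the diagonal reads their concatenation, and both routes around the square are
  -- homotopic to the diagonal.
  let F : ℝ × ℝ → ℝ → X := fun e t =>
    if t ≤ 1 / 2 then sheet α e.1 (2 * t) else sheet β e.2 (2 * t - 1)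
  have hF : Continuous fun p : (ℝ × ℝ) × ℝ => F p.1 p.2 := by
    refine Continuous.if_le (by fun_prop) (by fun_prop) (by fun_prop) (by fun_prop) ?_
    rintro ⟨e, t⟩ (rfl : t = 1 / 2)
    rw [hα' _ _ (by norm_num), hβ' _ _ (by norm_num)]
  have hF0 : ∀ e, F e 0 ∈ A := fun e => by
    simp only [F]
    rw [if_pos (by norm_num)]
    exact sheet_mem_of_snd_le α _ (by norm_num)
  have hF1 : ∀ e, F e 1 ∈ A := fun e => by
    simp only [F]
    rw [if_neg (by norm_num)]
    exact sheet_mem_of_le_snd β _ (by norm_num)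
  have hFx : ∀ e : ℝ × ℝ, (e.1 ≤ 0 ∨ 1 ≤ e.1) → (e.2 ≤ 0 ∨ 1 ≤ e.2) → ∀ t, F e t = x := by
    rintro e h1 h2 t
    simp only [F]
    split_ifs
    · exact h1.elim (fun h => sheet_of_fst_le α h _) fun h => sheet_of_le_fst α h _
    · exact h2.elim (fun h => sheet_of_fst_le β h _) fun h => sheet_of_le_fst β h _
  let S := ofFamily (A := A) F hF hF0 hF1
  have hS : ∀ e : ℝ × ℝ, (e.1 ≤ 0 ∨ 1 ≤ e.1) → (e.2 ≤ 0 ∨ 1 ≤ e.2) → S e = const x :=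
    fun e h1 h2 => Subtype.ext (ContinuousMap.ext fun t => hFx e h1 h2 t)
  have h00 : S (0, 0) = const x := hS _ (by simp) (by simp)
  have h01 : S (0, 1) = const x := hS _ (by simp) (by simp)
  have h10 : S (1, 0) = const x := hS _ (by simp) (by simp)
  have h11 : S (1, 1) = const x := hS _ (by simp) (by simp)
  let α₁ : Loop x := loopOf (fun s t => sheet α s (2 * t)) (by fun_prop)
    (fun s => sheet_mem_of_snd_le α _ (by norm_num))
    (fun s => sheet_mem_of_le_snd α _ (by norm_num))
    (fun t => sheet_of_fst_le α le_rfl _) (fun t => sheet_of_le_fst α le_rfl _)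
  let β₁ : Loop x := loopOf (fun s t => sheet β s (2 * t - 1)) (by fun_prop)
    (fun s => sheet_mem_of_snd_le β _ (by norm_num))
    (fun s => sheet_mem_of_le_snd β _ (by norm_num))
    (fun t => sheet_of_fst_le β le_rfl _) (fun t => sheet_of_le_fst β le_rfl _)
  -- Along a side of the parameter square one of the two paths is constant. Removing this pause is a
  -- reparametrization of the height.
  have hα₁ : cls α = cls α₁ := by
    refine cls_eq_of_homotopy (fun r s t => sheet α s ((1 + r) * t)) (by fun_prop)
      (fun r s => sheet_mem_of_snd_le α _ (by norm_num))
      (fun r s => sheet_mem_of_le_snd α _ (by have := r.2.1; linarith))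
      (fun r t => sheet_of_fst_le α le_rfl _) (fun r t => sheet_of_le_fst α le_rfl _)
      (fun s t => by simp) (fun s t => ?_)
    simp only [α₁, loopOf_apply]; norm_num
  have hβ₁ : cls β = cls β₁ := by
    refine cls_eq_of_homotopy (fun r s t => sheet β s ((1 + r) * t - r)) (by fun_prop)
      (fun r s => sheet_mem_of_snd_le β _ (by have := r.2.1; linarith))
      (fun r s => sheet_mem_of_le_snd β _ (by norm_num))
      (fun r t => sheet_of_fst_le β le_rfl _) (fun r t => sheet_of_le_fst β le_rfl _)
      (fun s t => by simp) (fun s t => ?_)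
    simp only [β₁, loopOf_apply]; norm_num
  have key : ∀ (a b : ℝ × ℝ) (ha : S a = const x) (hb : S b = const x) (θ : Loop x),
      (∀ s t : I, F (AffineMap.lineMap a b (s : ℝ)) t = (θ s).1 t) → edgeClass S ha hb = cls θ :=
    fun a b ha hb θ h => edgeClass_eq S ha hb θ fun s => Subtype.ext (ContinuousMap.ext (h s))
  have eα : ∀ r : ℝ, (r ≤ 0 ∨ 1 ≤ r) → ∀ (ha : S (0, r) = const x) (hb : S (1, r) = const x),
      edgeClass S ha hb = cls α := fun r hr ha hb => by
    rw [hα₁]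
    refine key _ _ _ _ _ fun s t => ?_
    simp only [F, α₁, loopOf_apply, AffineMap.lineMap_apply_module, Prod.smul_mk, Prod.mk_add_mk]
    split_ifs with h
    · simp
    · rw [hα' _ _ (by linarith)]
      have : (1 - (s : ℝ)) • r + (s : ℝ) • r = r := by simp only [smul_eq_mul]; ring
      rw [this]
      exact hr.elim (fun h => sheet_of_fst_le β h _) fun h => sheet_of_le_fst β h _
  have eβ : ∀ r : ℝ, (r ≤ 0 ∨ 1 ≤ r) → ∀ (ha : S (r, 0) = const x) (hb : S (r, 1) = const x),
      edgeClass S ha hb = cls β := fun r hr ha hb => by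
    rw [hβ₁]
    refine key _ _ _ _ _ fun s t => ?_
    simp only [F, β₁, loopOf_apply, AffineMap.lineMap_apply_module, Prod.smul_mk, Prod.mk_add_mk]
    split_ifs with h
    · rw [hβ' _ _ (by linarith)]
      have : (1 - (s : ℝ)) • r + (s : ℝ) • r = r := by simp only [smul_eq_mul]; ring
      rw [this]
      exact hr.elim (fun h => sheet_of_fst_le α h _) fun h => sheet_of_le_fst α h _
    · simp
  let γ : Loop x := loopOf (fun s t => F (s, s) t)
    (hF.comp (f := fun p : ℝ × ℝ => ((p.1, p.1), p.2)) (by fun_prop))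
    (fun s => hF0 _) (fun s => hF1 _) (fun t => hFx _ (by simp) (by simp) _)
    (fun t => hFx _ (by simp) (by simp) _)
  have hγ : edgeClass S h00 h11 = cls γ := by
    refine key _ _ _ _ _ fun s t => ?_
    simp only [γ, loopOf_apply, AffineMap.lineMap_apply_module, Prod.smul_mk, Prod.mk_add_mk]
    simp
  refine ⟨γ, fun s t => rfl, ?_, ?_⟩
  · rw [← hγ, ← edgeClass_mul S h00 h10 h11, eα 0 (by simp), eβ 1 (by simp)]
  · rw [← hγ, ← edgeClass_mul S h00 h01 h11, eα 1 (by simp), eβ 0 (by simp)]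

/-- A null-homotopy of the end loop is attached as a collar, which makes the end points constant on
the nose. -/
lemma exists_rep_of_mem_ker_tgtHom {g : FundamentalGroup (RelPath A) (const x)}
    (hg : g ∈ (tgtHom x).ker) : ∃ θ : Loop x, cls θ = g ∧ ∀ s, (θ s).1 1 = x := by
  obtain ⟨θ, rfl⟩ := cls_surjective g
  obtain ⟨θ', h1, -, h3, -⟩ := exists_adjust θ (Path.Homotopic.refl _)
    (Path.Homotopic.Quotient.exact (show Path.Homotopic.Quotient.mk (tgtLoop θ) =
      .mk (Path.refl x) from hg))
  refine ⟨θ', h1, fun s => ?_⟩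
  rw [← tgtLoop_apply, h3]
  rfl

lemma exists_rep_of_mem_ker_srcHom {g : FundamentalGroup (RelPath A) (const x)}
    (hg : g ∈ (srcHom x).ker) : ∃ θ : Loop x, cls θ = g ∧ ∀ s, (θ s).1 0 = x := by
  obtain ⟨θ, rfl⟩ := cls_surjective g
  obtain ⟨θ', h1, h2, -⟩ := exists_adjust θ
    (Path.Homotopic.Quotient.exact (show Path.Homotopic.Quotient.mk (srcLoop θ) =
      .mk (Path.refl x) from hg)) (Path.Homotopic.refl _)
  refine ⟨θ', h1, fun s => ?_⟩
  rw [← srcLoop_apply, h2]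
  rfl

/-- With representatives whose ends are constant, the paths of α can be followed by those of β, and
`exists_concat` evaluates the result in both orders. -/
lemma commute_ker (a : FundamentalGroup (RelPath A) (const x)) (ha : a ∈ (tgtHom x).ker)
    (b : FundamentalGroup (RelPath A) (const x)) (hb : b ∈ (srcHom x).ker) : Commute a b := by
  obtain ⟨α, rfl, hα⟩ := exists_rep_of_mem_ker_tgtHom ha
  obtain ⟨β, rfl, hβ⟩ := exists_rep_of_mem_ker_srcHom hb
  obtain ⟨γ, -, h1, h2⟩ := exists_concat α β hα hβ
  exact h2.symm.trans h1

/-- A sphere that is glued from two discs along their boundary is the quotient of the discs. -/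
lemma cls_eq_mul_of_glue (F e θ : Loop x) (hθ : ∀ s, (θ s).1 0 = x)
    (heθ : ∀ s, (e s).1 1 = (θ s).1 1)
    (hF : ∀ s t : I, (F s).1 t = if (t : ℝ) ≤ 1 / 2 then sheet e s (2 * t) else
      sheet θ s (2 - 2 * t)) : cls e = cls F * cls θ := by
  have hF1 : ∀ s, (F s).1 1 = x := fun s => by
    rw [hF, if_neg (by norm_num), sheet_of_snd_le θ s (by norm_num)]
    exact hθ _
  obtain ⟨γ, hγ, -, h⟩ := exists_concat F θ hF1 hθ
  rw [← h]
  -- The path of e followed by that of θ run backwards, with the height z going from 0 to 2.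
  let W : ℝ → ℝ → X := fun s z => if z ≤ 1 then sheet e s z else sheet θ s (2 - z)
  have hW : Continuous fun p : ℝ × ℝ => W p.1 p.2 := by
    refine Continuous.if_le (by fun_prop) (by fun_prop) (by fun_prop) (by fun_prop) ?_
    rintro ⟨s, z⟩ (rfl : z = 1)
    dsimp only
    rw [sheet_of_le_snd e s le_rfl, sheet_of_le_snd θ s (by norm_num)]
    exact heθ _
  have hl : ∀ z, W 0 z = x := fun z => by
    simp only [W]
    split_ifs
    · exact sheet_of_fst_le e le_rfl _
    · exact sheet_of_fst_le θ le_rfl _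
  have hr : ∀ z, W 1 z = x := fun z => by
    simp only [W]
    split_ifs
    · exact sheet_of_le_fst e le_rfl _
    · exact sheet_of_le_fst θ le_rfl _
  -- The path of F followed by that of θ climbs to height 2 at speed 4 and returns to height 1 at
  -- speed 2; this is min(4t, 3 − 2t). Pulling the detour tight to height t leaves e.
  refine cls_eq_of_homotopy
    (fun r s t => W s ((1 - r) * t + r * min (4 * t) (3 - 2 * t)))
    (hW.comp (f := fun p : ℝ × ℝ × ℝ =>
      (p.2.1, (1 - p.1) * p.2.2 + p.1 * min (4 * p.2.2) (3 - 2 * p.2.2))) (by fun_prop))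
    (fun r s => ?_) (fun r s => ?_) (fun r t => hl _) (fun r t => hr _)
    (fun s t => ?_) (fun s t => ?_)
  · have : (1 - (r : ℝ)) * 0 + r * min (4 * 0) (3 - 2 * 0) = 0 := by norm_num
    simp only [this, W, zero_le_one, if_true]
    exact sheet_mem_of_snd_le e _ le_rfl
  · have : (1 - (r : ℝ)) * 1 + r * min (4 * 1) (3 - 2 * 1) = 1 := by norm_num
    simp only [this, W, le_rfl, if_true]
    exact sheet_mem_of_le_snd e _ le_rfl
  · simp [W, t.2.2]
  · rw [hγ, sub_self, zero_mul, zero_add, one_mul]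
    have ht0 := t.2.1
    have ht1 := t.2.2
    by_cases h : (t : ℝ) ≤ 1 / 2
    · rw [if_pos h, min_eq_left (by linarith)]
      have h2 : (2 * (t : ℝ)) ∈ I := ⟨by linarith, by linarith⟩
      have h3 := sheet_coe F s ⟨_, h2⟩
      rw [hF] at h3
      dsimp only at h3
      rw [h3]
      simp only [W]
      by_cases h4 : 4 * (t : ℝ) ≤ 1
      · rw [if_pos h4, if_pos (by linarith)]; ring_nf
      · rw [if_neg h4, if_neg (by linarith)]; ring_nf
    · rw [if_neg h, min_eq_right (by linarith)]
      simp only [W]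
      -- At the last instant the height is exactly 1, where W is read through e rather than θ; the
      -- two agree on their common boundary.
      by_cases h4 : (t : ℝ) = 1
      · rw [h4, if_pos (by norm_num), sheet_of_le_snd e _ (by norm_num),
          sheet_of_le_snd θ _ (by norm_num)]
        exact heθ _
      · have : (t : ℝ) < 1 := lt_of_le_of_ne ht1 h4
        rw [if_neg (by linarith)]; ring_nf

end RelPath
end

/-! ### Comparison with second homotopy groups -/

noncomputable section

variable {X : Type u} [TopologicalSpace X] {A : Set X}

namespace RelPath

variable {x : A}

/-- The coordinates of a point of the square, clamped to the unit interval. -/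
def squarePt (s t : ℝ) : I^ Fin 2 := ![projIcc 0 1 zero_le_one s, projIcc 0 1 zero_le_one t]

@[fun_prop]
lemma continuous_squarePt {Z : Type*} [TopologicalSpace Z] {f g : Z → ℝ} (hf : Continuous f)
    (hg : Continuous g) : Continuous fun z => squarePt (f z) (g z) := by
  refine continuous_pi fun i => ?_
  fin_cases i
  · exact (continuous_projIcc (h := zero_le_one (α := ℝ))).comp hf
  · exact (continuous_projIcc (h := zero_le_one (α := ℝ))).comp hg

@[simp] lemma squarePt_coe (p : I^ Fin 2) : squarePt (p 0) (p 1) = p := by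
  ext i
  fin_cases i <;> simp [squarePt]

@[simp] lemma squarePt_apply_zero (s : I) (t : ℝ) : squarePt s t 0 = s := by simp [squarePt]

@[simp] lemma squarePt_apply_one (s : ℝ) (t : I) : squarePt s t 1 = t := by simp [squarePt]

lemma squarePt_mem_boundary_fst {s : ℝ} (hs : s = 0 ∨ s = 1) (t : ℝ) :
    squarePt s t ∈ Cube.boundary (Fin 2) := by
  refine ⟨0, ?_⟩
  rcases hs with rfl | rfl
  · left; exact projIcc_left (h := zero_le_one (α := ℝ))
  · right; exact projIcc_right (h := zero_le_one (α := ℝ))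

lemma squarePt_mem_boundary_snd (s : ℝ) {t : ℝ} (ht : t = 0 ∨ t = 1) :
    squarePt s t ∈ Cube.boundary (Fin 2) := by
  refine ⟨1, ?_⟩
  rcases ht with rfl | rfl
  · left; exact projIcc_left (h := zero_le_one (α := ℝ))
  · right; exact projIcc_right (h := zero_le_one (α := ℝ))

/-- The loop of loops that an element of the double loop space defines. -/
def ofGenLoop (a : Ω^ (Fin 2) X x) : Loop x :=
  loopOf (fun s t => a (squarePt s t)) (a.1.continuous.comp (by fun_prop))
    (fun s => by rw [GenLoop.boundary a _ (squarePt_mem_boundary_snd _ (Or.inl rfl))]; exact x.2)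
    (fun s => by rw [GenLoop.boundary a _ (squarePt_mem_boundary_snd _ (Or.inr rfl))]; exact x.2)
    (fun t => a.2 _ (squarePt_mem_boundary_fst (Or.inl rfl) _))
    (fun t => a.2 _ (squarePt_mem_boundary_fst (Or.inr rfl) _))

lemma ofGenLoop_apply (a : Ω^ (Fin 2) X x) (s t : I) :
    (ofGenLoop a s).1 t = a (squarePt s t) := rfl

lemma cls_ofGenLoop_eq {a b : Ω^ (Fin 2) X x} (h : GenLoop.Homotopic a b) :
    cls (ofGenLoop a) = cls (ofGenLoop b) := by
  obtain ⟨H⟩ := h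
  have hb : ∀ r : I, ∀ p ∈ Cube.boundary (Fin 2), H (r, p) = x := fun r p hp => by
    rw [H.eq_fst r hp]; exact a.2 p hp
  refine cls_eq_of_homotopy (fun r s t => H (projIcc 0 1 zero_le_one r, squarePt s t)) ?_
    (fun r s => ?_) (fun r s => ?_)
    (fun r t => hb _ _ (squarePt_mem_boundary_fst (Or.inl rfl) _))
    (fun r t => hb _ _ (squarePt_mem_boundary_fst (Or.inr rfl) _)) (fun s t => ?_) fun s t => ?_
  · refine H.continuous.comp (Continuous.prodMk ?_ (by fun_prop))
    exact continuous_projIcc.comp continuous_fst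
  · rw [hb _ _ (squarePt_mem_boundary_snd _ (Or.inl rfl))]; exact x.2
  · rw [hb _ _ (squarePt_mem_boundary_snd _ (Or.inr rfl))]; exact x.2
  · rw [projIcc_left]; exact H.apply_zero _
  · rw [projIcc_right]; exact H.apply_one _

/-- The homomorphism from the second homotopy group. -/
def ofPiTwo (x : A) : π_ 2 X x →* FundamentalGroup (RelPath A) (const x) :=
  MonoidHom.mk' (Quotient.lift (fun a => cls (ofGenLoop a)) fun _ _ h => cls_ofGenLoop_eq h) (by
    rintro ⟨a⟩ ⟨b⟩
    have h1 : piTwoMk a * piTwoMk b = piTwoMk (GenLoop.transAt 0 b a) := HomotopyGroup.mul_spec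
    refine (congrArg (Quotient.lift (fun a => cls (ofGenLoop a)) fun _ _ h => cls_ofGenLoop_eq h)
      h1).trans ?_
    change cls (ofGenLoop (GenLoop.transAt 0 b a)) = cls (ofGenLoop a) * cls (ofGenLoop b)
    rw [← cls_trans]
    congr 1
    refine Path.ext (funext fun s => Subtype.ext (ContinuousMap.ext fun t => ?_))
    rw [ofGenLoop_apply, Path.trans_apply, GenLoop.transAt, GenLoop.coe_copy]
    have hup : ∀ r : I, Function.update (squarePt (s : ℝ) t) 0 r = squarePt r t := fun r => by
      ext i
      fin_cases i <;> simp [squarePt]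
    simp only [hup, squarePt_apply_zero]
    split_ifs with h
    · rw [ofGenLoop_apply, projIcc_of_mem zero_le_one (by
        constructor <;> linarith [s.2.1] : (2 * (s : ℝ)) ∈ I)]
    · rw [ofGenLoop_apply, projIcc_of_mem zero_le_one (by
        constructor <;> linarith [s.2.2] : (2 * (s : ℝ) - 1) ∈ I)])

lemma srcHom_ofPiTwo (z : π_ 2 X x) : srcHom x (ofPiTwo x z) = 1 := by
  obtain ⟨a, rfl⟩ := Quotient.mk_surjective z
  change srcHom x (cls (ofGenLoop a)) = 1
  rw [srcHom_cls]
  have : srcLoop (ofGenLoop a) = Path.refl x := by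
    ext s
    rw [srcLoop_apply, ofGenLoop_apply]
    exact a.2 _ (squarePt_mem_boundary_snd _ (Or.inl rfl))
  rw [this]
  rfl

lemma tgtHom_ofPiTwo (z : π_ 2 X x) : tgtHom x (ofPiTwo x z) = 1 := by
  obtain ⟨a, rfl⟩ := Quotient.mk_surjective z
  change tgtHom x (cls (ofGenLoop a)) = 1
  rw [tgtHom_cls]
  have : tgtLoop (ofGenLoop a) = Path.refl x := by
    ext s
    rw [tgtLoop_apply, ofGenLoop_apply]
    exact a.2 _ (squarePt_mem_boundary_snd _ (Or.inr rfl))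
  rw [this]
  rfl

/-- A map of the square into a subspace that is constant on the boundary. -/
def genLoopOf {Y : Set X} {y : Y} (S : ℝ → ℝ → X) (hS : Continuous fun p : ℝ × ℝ => S p.1 p.2)
    (hY : ∀ s t : I, S s t ∈ Y) (hs : ∀ s : I, S s 0 = y ∧ S s 1 = y)
    (ht : ∀ t : I, S 0 t = y ∧ S 1 t = y) : Ω^ (Fin 2) Y y :=
  ⟨⟨fun p => ⟨S (p 0) (p 1), hY _ _⟩, Continuous.subtype_mk
    (hS.comp (f := fun p : I^ Fin 2 => ((p 0 : ℝ), (p 1 : ℝ))) (by fun_prop)) _⟩, by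
    rintro p ⟨i, hi⟩
    refine Subtype.ext ?_
    change S (p 0) (p 1) = y
    fin_cases i
    · rcases hi with hi | hi <;> replace hi : p 0 = _ := hi <;> rw [hi]
      · exact (ht _).1
      · exact (ht _).2
    · rcases hi with hi | hi <;> replace hi : p 1 = _ := hi <;> rw [hi]
      · exact (hs _).1
      · exact (hs _).2⟩

/-- The homomorphism on second homotopy groups induced by the inclusion of a subspace. -/
abbrev inclHom {Y : Set X} (hx : (x : X) ∈ Y) : π_ 2 Y ⟨x, hx⟩ →* π_ 2 X x :=
  piTwoMap (⟨Subtype.val, continuous_subtype_val⟩ : C(Y, X)) rfl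

/-- A null-homotopy in the space of paths is a cube with the sphere on the face r = 0, the base
point on r = 1 and on s = 0, 1, and values in A on t = 0, 1. Pushing the square across the cube onto
the other faces carries it into A, hence into Y. -/
lemma mem_range_inclHom_of_mem_ker {Y : Set X} (hA : A ⊆ Y) {z : π_ 2 X x}
    (hz : z ∈ (ofPiTwo x).ker) : z ∈ (inclHom (hA x.2)).range := by
  obtain ⟨a, rfl⟩ := Quotient.mk_surjective z
  change cls (ofGenLoop a) = 1 at hz
  obtain ⟨H⟩ : (ofGenLoop a).Homotopic (Path.refl (const x)) := Path.Homotopic.Quotient.exact hz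
  let W : ℝ → ℝ → ℝ → X := fun r s t => (H (projIcc 0 1 zero_le_one r,
    projIcc 0 1 zero_le_one s)).1 (projIcc 0 1 zero_le_one t)
  have hW : Continuous fun p : ℝ × ℝ × ℝ => W p.1 p.2.1 p.2.2 := by
    have h : Continuous fun p : I × I × I => (H (p.1, p.2.1)).1 p.2.2 := by fun_prop
    exact h.comp (f := fun p : ℝ × ℝ × ℝ => (projIcc (0 : ℝ) 1 zero_le_one p.1,
      projIcc (0 : ℝ) 1 zero_le_one p.2.1, projIcc (0 : ℝ) 1 zero_le_one p.2.2))
      ((continuous_projIcc.comp continuous_fst).prodMk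
        ((continuous_projIcc.comp (continuous_fst.comp continuous_snd)).prodMk
          (continuous_projIcc.comp (continuous_snd.comp continuous_snd))))
  have hWs0 : ∀ r t, W r 0 t = x := fun r t => by
    simp only [W, projIcc_left]
    exact congrArg (fun γ : RelPath A => γ.1 _) (H.source _)
  have hWs1 : ∀ r t, W r 1 t = x := fun r t => by
    simp only [W, projIcc_right]
    exact congrArg (fun γ : RelPath A => γ.1 _) (H.target _)
  have hWr1 : ∀ r s t, 1 ≤ r → W r s t = x := fun r s t hr => by
    simp only [W, projIcc_of_right_le _ hr]
    exact congrArg (fun γ : RelPath A => γ.1 _) (H.apply_one _)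
  have hWr0 : ∀ s t : ℝ, W 0 s t = a (squarePt s t) := fun s t => by
    simp only [W, projIcc_left]
    have := congrArg (fun γ : RelPath A => γ.1 (projIcc 0 1 zero_le_one t))
      (H.apply_zero (projIcc 0 1 zero_le_one s))
    refine this.trans ?_
    change a (squarePt _ _) = _
    simp [squarePt]
  have hWt0 : ∀ r s t, t ≤ 0 → W r s t ∈ A := fun r s t ht => by
    simp only [W, projIcc_of_le_left _ ht]
    exact (H _).2.1
  have hWt1 : ∀ r s t, 1 ≤ t → W r s t ∈ A := fun r s t ht => by
    simp only [W, projIcc_of_right_le _ ht]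
    exact (H _).2.2
  -- Profile of the pushed square in the (r, t)-plane: up the face t = 0 during the first third,
  -- along r = 1 during the second, down the face t = 1 during the last. The clamping in W absorbs
  -- the overshoot.
  let k : ℝ → ℝ := fun t => 3 * min t (1 - t)
  have hk : Continuous k := by fun_prop
  let b : Ω^ (Fin 2) Y ⟨x, hA x.2⟩ := genLoopOf (fun s t => W (k t) s (3 * t - 1))
    (hW.comp (f := fun p : ℝ × ℝ => (k p.2, p.1, 3 * p.2 - 1)) (by fun_prop))
    (fun s t => hA ?_) (fun s => ⟨?_, ?_⟩) (fun t => ⟨hWs0 _ _, hWs1 _ _⟩)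
  · refine ⟨piTwoMk b, Quotient.sound (GenLoop.Homotopic.symm ?_)⟩
    have hbd : ∀ (r : ℝ) (s t : I), (s = 0 ∨ s = 1 ∨ t = 0 ∨ t = 1) →
        W (r * k t) s ((1 - r) * t + r * projIcc (0 : ℝ) 1 zero_le_one (3 * t - 1)) = x := by
      rintro r s t (rfl | rfl | rfl | rfl)
      · exact hWs0 _ _
      · exact hWs1 _ _
      · have h1 : r * k (0 : I) = 0 := by simp [k]
        have h2 : ((1 - r) * ((0 : I) : ℝ) +
            r * projIcc (0 : ℝ) 1 zero_le_one (3 * (0 : I) - 1)) = 0 := by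
          rw [projIcc_of_le_left _ (by norm_num)]; simp
        rw [h1, h2, hWr0]
        exact a.2 _ (squarePt_mem_boundary_snd _ (Or.inl rfl))
      · have h1 : r * k (1 : I) = 0 := by simp [k]
        have h2 : ((1 - r) * ((1 : I) : ℝ) +
            r * projIcc (0 : ℝ) 1 zero_le_one (3 * (1 : I) - 1)) = 1 := by
          rw [projIcc_of_right_le _ (by norm_num)]; simp
        rw [h1, h2, hWr0]
        exact a.2 _ (squarePt_mem_boundary_snd _ (Or.inr rfl))
    -- Straight-line interpolation in the (r, t)-plane between the face r = 0 and this profile; by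
    -- `hbd` the boundary stays at the base point.
    refine ⟨⟨⟨⟨fun q => W (q.1 * k (q.2 1)) (q.2 0) ((1 - q.1) * q.2 1 +
      q.1 * projIcc (0 : ℝ) 1 zero_le_one (3 * q.2 1 - 1)), ?_⟩, fun p => ?_, fun p => ?_⟩, ?_⟩⟩
    · have hp : Continuous fun q : I × (I^ Fin 2) =>
          ((projIcc (0 : ℝ) 1 zero_le_one (3 * (q.2 1 : ℝ) - 1) : I) : ℝ) :=
        continuous_subtype_val.comp (continuous_projIcc.comp (by fun_prop))
      exact hW.comp (f := fun q : I × (I^ Fin 2) => ((q.1 : ℝ) * k (q.2 1), ((q.2 0 : I) : ℝ),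
        (1 - (q.1 : ℝ)) * q.2 1 + q.1 * projIcc (0 : ℝ) 1 zero_le_one (3 * q.2 1 - 1)))
        (by fun_prop)
    · simp [hWr0]
    · change W _ _ _ = W _ _ _
      simp only [Icc.coe_one, one_mul, sub_self, zero_mul, zero_add]
      simp [W]
    · rintro r p ⟨i, hi⟩
      have hi' : p 0 = 0 ∨ p 0 = 1 ∨ p 1 = 0 ∨ p 1 = 1 := by
        fin_cases i
        · exact hi.elim Or.inl fun h => Or.inr (Or.inl h)
        · exact hi.elim (fun h => Or.inr (Or.inr (Or.inl h))) fun h => Or.inr (Or.inr (Or.inr h))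
      exact (hbd r (p 0) (p 1) hi').trans (a.2 p ⟨i, hi⟩).symm
  · by_cases h1 : (t : ℝ) ≤ 1 / 3
    · exact hWt0 _ _ _ (by linarith)
    · by_cases h2 : 2 / 3 ≤ (t : ℝ)
      · exact hWt1 _ _ _ (by linarith)
      · rw [hWr1 _ _ _ ?_]
        · exact x.2
        · have : 1 / 3 ≤ min (t : ℝ) (1 - t) := le_min (by linarith) (by linarith)
          simp only [k]; linarith
  · have h1 : k 0 = 0 := by simp [k]
    rw [h1, hWr0, show (3 * 0 - 1 : ℝ) = -1 by norm_num]
    exact a.2 _ ⟨1, Or.inl (projIcc_of_le_left (zero_le_one (α := ℝ)) (by norm_num))⟩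
  · have h1 : k 1 = 0 := by simp [k]
    rw [h1, hWr0, show (3 * 1 - 1 : ℝ) = 2 by norm_num]
    exact a.2 _ ⟨1, Or.inr (projIcc_of_right_le (zero_le_one (α := ℝ)) (by norm_num))⟩

/-- Both end loops are null-homotopic in A. Collars in A ⊆ Y make them constant without leaving Y,
and then the square is a sphere in Y. -/
lemma inf_ker_le_map_range_inclHom {Y : Set X} (hA : A ⊆ Y) :
    confined Y x (hA x.2) ⊓ (srcHom x).ker ⊓ (tgtHom x).ker ≤
      (inclHom (hA x.2)).range.map (ofPiTwo x) := by
  rintro _ ⟨⟨⟨θ, rfl, hθ⟩, hs⟩, ht⟩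
  obtain ⟨θ', h1, h2, h3, h4⟩ := exists_adjust θ
    (Path.Homotopic.Quotient.exact (show Path.Homotopic.Quotient.mk (srcLoop θ) =
      .mk (Path.refl x) from hs))
    (Path.Homotopic.Quotient.exact (show Path.Homotopic.Quotient.mk (tgtLoop θ) =
      .mk (Path.refl x) from ht))
  let b : Ω^ (Fin 2) Y ⟨x, hA x.2⟩ := genLoopOf (sheet θ') (continuous_sheet θ')
    (fun s t => h4 Y hA hθ _ _) (fun s => ⟨?_, ?_⟩)
    (fun t => ⟨sheet_of_fst_le θ' le_rfl _, sheet_of_le_fst θ' le_rfl _⟩)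
  · refine ⟨_, ⟨piTwoMk b, rfl⟩, ?_⟩
    rw [← h1]
    refine congrArg cls ?_
    refine Path.ext (funext fun s => Subtype.ext (ContinuousMap.ext fun t => ?_))
    change sheet θ' (squarePt s t 0) (squarePt s t 1) = _
    simp
  · rw [sheet_of_snd_le θ' _ le_rfl]
    change ((srcLoop θ' _ : A) : X) = x
    rw [h2]; rfl
  · rw [sheet_of_le_snd θ' _ le_rfl]
    change ((tgtLoop θ' _ : A) : X) = x
    rw [h3]; rfl

/-- Injectivity of `ofPiTwo` is not needed: its kernel already lies in each of the images, so
membership can be pulled back as soon as there is at least one index. -/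
lemma mem_of_ofPiTwo_mem_map {ι : Type*} [Nonempty ι] {Y : ι → Set X} (hA : ∀ i, A ⊆ Y i)
    {z : π_ 2 X x} (hz : ofPiTwo x z ∈ (⨆ i, (inclHom (hA i x.2)).range).map (ofPiTwo x)) :
    z ∈ ⨆ i, (inclHom (hA i x.2)).range := by
  obtain ⟨w, hw, hwz⟩ := hz
  obtain ⟨i⟩ := ‹Nonempty ι›
  rw [← inv_mul_cancel_right z w]
  refine Subgroup.mul_mem _ (Subgroup.mem_iSup_of_mem i
    (mem_range_inclHom_of_mem_ker (hA i) ?_)) hw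
  rw [MonoidHom.mem_ker, map_mul, map_inv, hwz, mul_inv_cancel]

end RelPath
end

noncomputable section

/-! ## Dependence on the map -/

namespace RelPath

variable {X : Type u} [TopologicalSpace X] {A : Set X} {x : A}
  {X' : Type v} [TopologicalSpace X'] {A' : Set X'} {x' : A'}

/-- The map of path spaces induced by a map of pairs. -/
def map (F : C(X, X')) (hF : MapsTo F A A') : C(RelPath A, RelPath A') :=
  ⟨fun γ => ⟨F.comp γ.1, hF γ.2.1, hF γ.2.2⟩,
    Continuous.subtype_mk (F.continuous_postcomp.comp continuous_subtype_val) _⟩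

lemma map_const (F : C(X, X')) (hF : MapsTo F A A') (h : F x = x') :
    map F hF (const x) = const x' :=
  Subtype.ext (ContinuousMap.ext fun _ => h)

/-- The homomorphism induced by a map of pairs. -/
def mapHom (F : C(X, X')) (hF : MapsTo F A A') (h : F x = x') :
    FundamentalGroup (RelPath A) (const x) →* FundamentalGroup (RelPath A') (const x') :=
  FundamentalGroup.mapOfEq (map F hF) (map_const F hF h)

/-- The image of a loop of paths. -/
def mapLoop (F : C(X, X')) (hF : MapsTo F A A') (h : F x = x') (θ : Loop x) : Loop x' :=
  (θ.map (map F hF).continuous).cast (map_const F hF h).symm (map_const F hF h).symm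

lemma mapHom_cls (F : C(X, X')) (hF : MapsTo F A A') (h : F x = x') (θ : Loop x) :
    mapHom F hF h (cls θ) = cls (mapLoop F hF h θ) :=
  FundamentalGroup.mapOfEq_apply _ _ _

lemma mapHom_ofPiTwo (F : C(X, X')) (hF : MapsTo F A A') (h : F x = x') (z : π_ 2 X x) :
    mapHom F hF h (ofPiTwo x z) = ofPiTwo x' (piTwoMap F h z) := by
  obtain ⟨a, rfl⟩ := Quotient.mk_surjective z
  exact mapHom_cls F hF h _

lemma mapHom_mem_confined (F : C(X, X')) (hF : MapsTo F A A') (h : F x = x') {Y : Set X}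
    {Y' : Set X'} (hY : MapsTo F Y Y') {hx : (x : X) ∈ Y} {hx' : (x' : X') ∈ Y'}
    {g : FundamentalGroup (RelPath A) (const x)} (hg : g ∈ confined Y x hx) :
    mapHom F hF h g ∈ confined Y' x' hx' := by
  obtain ⟨θ, rfl, hθ⟩ := hg
  exact ⟨mapLoop F hF h θ, (mapHom_cls _ _ _ _).symm, fun s t => hY (hθ s t)⟩

lemma homotopic_map_cast {B B' : Type*} [TopologicalSpace B] [TopologicalSpace B'] {b : B} {b' : B'}
    {f f' : C(B, B')} (h : f.HomotopicRel f' {b}) (hf : f b = b') (hf' : f' b = b') (p : Path b b) :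
    ((p.map f.continuous).cast hf.symm hf.symm).Homotopic
      ((p.map f'.continuous).cast hf'.symm hf'.symm) := by
  obtain ⟨H⟩ := h
  refine ⟨⟨⟨⟨fun q => H (q.1, p q.2), by fun_prop⟩, fun s => ?_, fun s => ?_⟩, ?_⟩⟩
  · exact H.apply_zero _
  · exact H.apply_one _
  · rintro r s (rfl | rfl)
    · change H (r, p 0) = f (p 0)
      rw [p.source]; exact H.eq_fst r rfl
    · change H (r, p 1) = f (p 1)
      rw [p.target]; exact H.eq_fst r rfl

/-- If the group is generated by the classes of the loops of paths in the subsets `Y i`, then the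
homomorphisms on second homotopy groups induced by two maps that carry `Y i` into `Y' i` and are
homotopic on `A` agree modulo the images of the second homotopy groups of the subsets `Y' i`. -/
lemma piTwoMap_mul_inv_mem {ι : Type*} [Nonempty ι] {Y : ι → Set X} {Y' : ι → Set X'}
    (hA : ∀ i, A ⊆ Y i) (hA' : ∀ i, A' ⊆ Y' i) (hgen : ⨆ i, confined (Y i) x (hA i x.2) = ⊤)
    {f f' : C(A, A')} (hff' : f.HomotopicRel f' {x}) {F F' : C(X, X')}
    (hf : ∀ a : A, F a = f a) (hf' : ∀ a : A, F' a = f' a) (hF : ∀ i, MapsTo F (Y i) (Y' i))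
    (hF' : ∀ i, MapsTo F' (Y i) (Y' i)) (h : F x = x') (h' : F' x = x') (z : π_ 2 X x) :
    piTwoMap F h z * (piTwoMap F' h' z)⁻¹ ∈ ⨆ i, (inclHom (hA' i x'.2)).range := by
  have hFA : MapsTo F A A' := fun a ha => by
    have := hf ⟨a, ha⟩
    dsimp only at this
    rw [this]; exact Subtype.coe_prop _
  have hFA' : MapsTo F' A A' := fun a ha => by
    have := hf' ⟨a, ha⟩
    dsimp only at this
    rw [this]; exact Subtype.coe_prop _
  -- The spherical classes inside each Y' i: normal subgroups that come from π₂(Y' i).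
  let Z : ι → Subgroup (FundamentalGroup (RelPath A') (const x')) := fun i =>
    confined (Y' i) x' (hA' i x'.2) ⊓ (srcHom x').ker ⊓ (tgtHom x').ker
  have hZ : ∀ i, (Z i).Normal := fun i => normal_inf_ker_inf_ker (e := constHom x')
    tgtHom_constHom commute_ker fun g => constHom_mem_confined (hA' i) g
  have hZ' : (⨆ i, Z i).Normal := Subgroup.iSup_normal _
  have hfx : f x = x' := Subtype.ext ((hf x).symm.trans h)
  have hfx' : f' x = x' := Subtype.ext ((hf' x).symm.trans h')
  -- For a square in Y i both images lie in Y' i. Their end loops are homotopic because f and f'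
  -- are, so the two images differ by a spherical class.
  have key : ∀ i, ∀ g ∈ confined (Y i) x (hA i x.2),
      mapHom F hFA h g * (mapHom F' hFA' h' g)⁻¹ ∈ ⨆ i, Z i := fun i g hg => by
    refine Subgroup.mem_iSup_of_mem i
      (Subgroup.mem_inf.2 ⟨Subgroup.mem_inf.2 ⟨?_, ?_⟩, ?_⟩)
    · exact Subgroup.mul_mem _ (mapHom_mem_confined F hFA h (hF i) hg)
        (Subgroup.inv_mem _ (mapHom_mem_confined F' hFA' h' (hF' i) hg))
    · obtain ⟨θ, rfl⟩ := cls_surjective g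
      rw [MonoidHom.mem_ker, map_mul, map_inv, mul_inv_eq_one, mapHom_cls,
        mapHom_cls, srcHom_cls, srcHom_cls]
      have h1 : srcLoop (mapLoop F hFA h θ) =
          ((srcLoop θ).map f.continuous).cast hfx.symm hfx.symm := by
        ext s; exact hf (srcLoop θ s)
      have h2 : srcLoop (mapLoop F' hFA' h' θ) =
          ((srcLoop θ).map f'.continuous).cast hfx'.symm hfx'.symm := by
        ext s; exact hf' (srcLoop θ s)
      rw [h1, h2]
      exact congrArg FundamentalGroup.fromPath
        (Path.Homotopic.Quotient.eq.2 (homotopic_map_cast hff' hfx hfx' _))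
    · obtain ⟨θ, rfl⟩ := cls_surjective g
      rw [MonoidHom.mem_ker, map_mul, map_inv, mul_inv_eq_one, mapHom_cls,
        mapHom_cls, tgtHom_cls, tgtHom_cls]
      have h1 : tgtLoop (mapLoop F hFA h θ) =
          ((tgtLoop θ).map f.continuous).cast hfx.symm hfx.symm := by
        ext s; exact hf (tgtLoop θ s)
      have h2 : tgtLoop (mapLoop F' hFA' h' θ) =
          ((tgtLoop θ).map f'.continuous).cast hfx'.symm hfx'.symm := by
        ext s; exact hf' (tgtLoop θ s)
      rw [h1, h2]
      exact congrArg FundamentalGroup.fromPath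
        (Path.Homotopic.Quotient.eq.2 (homotopic_map_cast hff' hfx hfx' _))
  -- The detour through the larger group pays off here: z is a sphere, but its factors in the Y i
  -- need not be spherical.
  have h1 := mul_inv_mem_of_iSup_eq_top hgen key (ofPiTwo x z)
  rw [mapHom_ofPiTwo, mapHom_ofPiTwo, ← map_inv, ← map_mul] at h1
  have h2 : ⨆ i, Z i ≤ (⨆ i, (inclHom (hA' i x'.2)).range).map (ofPiTwo x') := by
    rw [Subgroup.map_iSup]
    exact iSup_mono fun i => inf_ker_le_map_range_inclHom (hA' i)
  exact mem_of_ofPiTwo_mem_map hA' (h2 h1)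

end RelPath
end

noncomputable section

/-! ## Concatenation of finitely many loops -/

section Concat

variable {Y : Type*} [TopologicalSpace Y] {y : Y}

/-- The concatenation of the first `k` loops of a sequence, the loop `δ i` being run through on
`[i, i + 1]`. -/
def concatFun (δ : ℕ → Path y y) : ℕ → ℝ → Y
  | 0, _ => y
  | k + 1, r => if r ≤ k then concatFun δ k r else (δ k).extend (r - k)

lemma concatFun_of_le (δ : ℕ → Path y y) : ∀ (k : ℕ) {r : ℝ}, (k : ℝ) ≤ r → concatFun δ k r = y
  | 0, _, _ => rfl
  | k + 1, r, hr => by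
    push_cast at hr
    rw [concatFun, if_neg (by linarith), (δ k).extend_of_one_le (by linarith)]

lemma continuous_concatFun (δ : ℕ → Path y y) : ∀ k, Continuous (concatFun δ k)
  | 0 => continuous_const
  | k + 1 => by
    refine Continuous.if_le (continuous_concatFun δ k) (by fun_prop) continuous_id
      continuous_const ?_
    rintro r rfl
    rw [concatFun_of_le δ k le_rfl, sub_self, (δ k).extend_zero]

/-- Integers are the break points between consecutive loops. In the sphere they become the vertical
segments that are collapsed. -/
lemma concatFun_natCast (δ : ℕ → Path y y) (j : ℕ) : ∀ k, concatFun δ k j = y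
  | 0 => rfl
  | k + 1 => by
    rw [concatFun]
    split_ifs with h
    · exact concatFun_natCast δ j k
    · refine (δ k).extend_of_one_le ?_
      have h1 : k < j := by exact_mod_cast not_le.1 h
      have h2 : (k : ℝ) + 1 ≤ j := by exact_mod_cast h1
      linarith

lemma concatFun_of_mem (δ : ℕ → Path y y) {i : ℕ} {r : ℝ} (h1 : (i : ℝ) ≤ r) (h2 : r ≤ i + 1) :
    ∀ {k}, i < k → concatFun δ k r = (δ i).extend (r - i)
  | 0, h => absurd h (Nat.not_lt_zero _)
  | k + 1, h => by
    rw [concatFun]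
    rcases Nat.lt_succ_iff_lt_or_eq.1 h with h | rfl
    · have h3 : (i : ℝ) + 1 ≤ k := by exact_mod_cast h
      rw [if_pos (by linarith)]
      exact concatFun_of_mem δ h1 h2 h
    · split_ifs with h3
      · rw [concatFun_of_le δ i h1, (δ i).extend_of_le_zero (by linarith)]
      · rfl

/-- Concatenation multiplies in reverse order, so running through the inverses of the c i yields the
inverse of their product in the natural order. -/
lemma edgeClass_concatFun (δ : ℕ → Path y y) {c : ℕ → FundamentalGroup Y y}
    (hc : ∀ i, FundamentalGroup.fromPath (.mk (δ i)) = (c i)⁻¹) : ∀ (k : ℕ)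
    (h0 : (⟨concatFun δ k, continuous_concatFun δ k⟩ : C(ℝ, Y)) 0 = y)
    (hk : (⟨concatFun δ k, continuous_concatFun δ k⟩ : C(ℝ, Y)) k = y),
    edgeClass ⟨concatFun δ k, continuous_concatFun δ k⟩ h0 hk =
      (((List.range k).map c).prod)⁻¹
  | 0, h0, hk => by
    simp only [List.range_zero, List.map_nil, List.prod_nil, inv_one]
    exact edgeClass_eq _ _ _ (Path.refl y) fun s => rfl
  | k + 1, h0, hk => by
    have hk' : (⟨concatFun δ (k + 1), continuous_concatFun δ (k + 1)⟩ : C(ℝ, Y)) k = y :=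
      concatFun_natCast δ k (k + 1)
    have h0' : (⟨concatFun δ k, continuous_concatFun δ k⟩ : C(ℝ, Y)) 0 = y := by
      have := concatFun_natCast δ 0 k
      rwa [Nat.cast_zero] at this
    have hkk : (⟨concatFun δ k, continuous_concatFun δ k⟩ : C(ℝ, Y)) k = y :=
      concatFun_natCast δ k k
    rw [← edgeClass_mul _ h0 hk' hk, List.range_succ, List.map_append, List.prod_append,
      mul_inv_rev, ← edgeClass_concatFun δ hc k h0' hkk]
    congr 1
    · simp only [List.map_cons, List.map_nil, List.prod_singleton]
      rw [← hc k]
      refine edgeClass_eq _ _ _ _ fun s => ?_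
      have hl : AffineMap.lineMap (k : ℝ) ((k + 1 : ℕ) : ℝ) (s : ℝ) = k + (s : ℝ) := by
        rw [AffineMap.lineMap_apply_module]; push_cast; simp only [smul_eq_mul]; ring
      change concatFun δ (k + 1) _ = _
      rw [hl, concatFun_of_mem δ (by linarith [s.2.1]) (by linarith [s.2.2]) (Nat.lt_succ_self k),
        add_sub_cancel_left, Path.extend_extends']
    · refine edgeClass_eq _ _ _ _ fun s => ?_
      change concatFun δ (k + 1) _ = concatFun δ k _
      rw [concatFun, if_pos]
      · rfl
      rw [AffineMap.lineMap_apply_module]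
      simp only [smul_eq_mul, mul_zero, zero_add]
      exact mul_le_of_le_one_left (Nat.cast_nonneg k) s.2.2

end Concat

/-- Indexing by ℕ matches the recursion of `concatFun`; the values beyond the range are set to 1. -/
lemma exists_range_prod_of_mem_iSup {G : Type*} [Group G] {m : ℕ} {N : Fin m → Subgroup G}
    [∀ i, (N i).Normal] {g : G} (hg : g ∈ ⨆ i, N i) :
    ∃ c : ℕ → G, (∀ i : Fin m, c i ∈ N i) ∧ g = ((List.range m).map c).prod := by
  obtain ⟨c, hc, rfl⟩ := exists_prod_of_mem_iSup hg
  refine ⟨fun i => if h : i < m then c ⟨i, h⟩ else 1, fun i => by simpa using hc i, ?_⟩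
  congr 1
  refine List.ext_getElem (by simp) fun i h1 h2 => ?_
  have h3 : i < m := by simpa using h1
  simp [h3]

/-! ## Maps from the sphere -/

namespace SphereSpace

variable {n : ℕ}

/-- The map from the sphere that a map of the square defines. -/
def lift {X : Type u} [TopologicalSpace X] {x : X} (W : C(ℝ × ℝ, X))
    (hW : ∀ c ∈ Icc (0 : ℝ) 1 ×ˢ Icc (0 : ℝ) 1, IsBad n c → W c = x) : C(SphereSpace n, X) :=
  ⟨Quotient.lift (fun p : I^ Fin 2 => W (p 0, p 1)) (by
    rintro p q (rfl | ⟨hp, hq⟩)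
    · rfl
    · rw [hW _ ⟨(p 0).2, (p 1).2⟩ (mem_collapsed_iff.1 hp),
        hW _ ⟨(q 0).2, (q 1).2⟩ (mem_collapsed_iff.1 hq)]), by
    refine Continuous.quotient_lift ?_ _
    fun_prop⟩

lemma lift_pt {X : Type u} [TopologicalSpace X] {x : X} (W : C(ℝ × ℝ, X))
    (hW : ∀ c ∈ Icc (0 : ℝ) 1 ×ˢ Icc (0 : ℝ) 1, IsBad n c → W c = x) {c : ℝ × ℝ}
    (hc : c ∈ Icc (0 : ℝ) 1 ×ˢ Icc (0 : ℝ) 1) : lift W hW (pt n c) = W c := by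
  obtain ⟨a, b⟩ := c
  change W ((projIcc 0 1 zero_le_one a : I), (projIcc 0 1 zero_le_one b : I)) = _
  rw [projIcc_of_mem _ hc.1, projIcc_of_mem _ hc.2]

/-- Reduces conditions on the 1-skeleton to the corner and the line at height 1/2 of the square. -/
lemma exists_pt_of_mem_skeleton (hn : 2 ≤ n) {z : SphereSpace n} (hz : letI := cwComplex n hn
    z ∈ (skeleton (univ : Set (SphereSpace n)) 1 : Set (SphereSpace n))) :
    ∃ c ∈ Icc (0 : ℝ) 1 ×ˢ Icc (0 : ℝ) 1, pt n c = z ∧ (c = (0, 0) ∨ c.2 = 1 / 2) := by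
  let _ := cwComplex n hn
  obtain ⟨d, hd, j, hj⟩ := CWComplex.mem_skeleton_iff.1 hz
  obtain ⟨y, hy, rfl⟩ := hj
  have h1 := insideClosed_of_mem_closedBall (n := n) j (Metric.ball_subset_closedBall hy)
  refine ⟨cellCoord n d j y, mem_square_of_insideClosed (n := n) j h1, rfl, ?_⟩
  have hd' : d ≤ 1 := by exact_mod_cast hd
  have key : ∀ (d : ℕ) (j : Cell n d) (c : ℝ × ℝ), d ≤ 1 → InsideClosed n d j c →
      c = (0, 0) ∨ c.2 = 1 / 2
    | 0, _, _, _, h => Or.inl h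
    | 1, _, _, _, h => Or.inr h.2.2
  exact key d j _ hd' h1

lemma exists_pt_of_mem_closedCell (hn : 2 ≤ n) (i : Fin n) {z : SphereSpace n}
    (hz : letI := cwComplex n hn; z ∈ closedCell (C := (univ : Set (SphereSpace n))) 2
      (sphereFace n hn i)) :
    ∃ c ∈ Icc (0 : ℝ) 1 ×ˢ Icc (0 : ℝ) 1, pt n c = z ∧ InsideClosed n 2 i c := by
  let _ := cwComplex n hn
  obtain ⟨y, hy, rfl⟩ := hz
  have h1 := insideClosed_of_mem_closedBall (n := n) (d := 2) i hy
  exact ⟨_, mem_square_of_insideClosed (n := n) (d := 2) i h1, rfl, h1⟩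

end SphereSpace

end

/-! ### Construction of morphisms from the sphere -/

noncomputable section

namespace KObj

open RelPath SphereSpace

variable {n : ℕ}

/-- A map of the square into `K` that is subordinate to the cells of the sphere defines a
morphism. -/
lemma exists_hom_of_square (hn : 2 ≤ n) (K : KObj.{u} n) (W : C(ℝ × ℝ, K.X))
    (hW : ∀ c ∈ Icc (0 : ℝ) 1 ×ˢ Icc (0 : ℝ) 1, IsBad n c → W c = K.base)
    (hskel : ∀ a ∈ Icc (0 : ℝ) 1, W (a, 1 / 2) ∈ K.skel)
    (hsub : ∀ (i : Fin n) (c : ℝ × ℝ), c ∈ Icc (0 : ℝ) 1 ×ˢ Icc (0 : ℝ) 1 →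
      InsideClosed n 2 i c → W c ∈ K.sub i) :
    ∃ f : Hom (sphereObj n hn) K, IsExtension f.toMap (SphereSpace.lift W hW) := by
  have h1 : ∀ z ∈ (sphereObj n hn).skel, SphereSpace.lift W hW z ∈ K.skel := fun z hz => by
    obtain ⟨c, hc, rfl, h⟩ := exists_pt_of_mem_skeleton hn hz
    rw [lift_pt W hW hc]
    rcases h with rfl | h
    · rw [hW _ hc (isBad_zero n)]
      exact K.base_mem_skel
    · obtain ⟨a, b⟩ := c
      obtain rfl : b = 1 / 2 := h
      exact hskel a hc.1
  let f : C((sphereObj n hn).skel, K.skel) :=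
    ⟨fun z => ⟨SphereSpace.lift W hW z.1, h1 z.1 z.2⟩,
      Continuous.subtype_mk ((SphereSpace.lift W hW).continuous.comp continuous_subtype_val) _⟩
  have hf : IsExtension f (SphereSpace.lift W hW) := by
    refine ⟨fun _ => rfl, fun i z hz => ?_⟩
    rcases hz with hz | hz
    · exact K.skel_subset_sub i (h1 z hz)
    · obtain ⟨c, hc, rfl, h⟩ := exists_pt_of_mem_closedCell hn i hz
      exact (congrArg (· ∈ (K.sub i : Set K.X)) (lift_pt W hW hc)).mpr (hsub i c hc h)
  refine ⟨⟨f, Subtype.ext ?_, _, hf⟩, hf⟩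
  exact (lift_pt W hW (by simp)).trans (hW _ (by simp) (isBad_zero n))

/-- Every element of the kernel of `srcHom ⊓ tgtHom` that is a product of classes of loops of paths
in the subcomplexes comes from a morphism from the sphere. -/
lemma exists_hom_of_prod (hn : 2 ≤ n) (K : KObj.{u} n)
    {c : ℕ → FundamentalGroup (RelPath K.skel) (const K.skelBase)}
    (hc : ∀ i : Fin n, c i ∈ confined (K.sub i : Set K.X) K.skelBase
      (K.skel_subset_sub i K.base_mem_skel) ⊓ (srcHom K.skelBase).ker)
    (hprod : tgtHom K.skelBase ((List.range n).map c).prod = 1) :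
    ∃ (f : Hom (sphereObj n hn) K) (F : C((sphereObj n hn).X, K.X))
      (hF : IsExtension f.toMap F),
      ofPiTwo K.skelBase (piTwoMap F (f.extension_base hF) (sphereClass n hn)) =
        ((List.range n).map c).prod := by
  -- The last factor is set apart: m faces lie in the upper half of the square, one in the lower
  -- half.
  obtain ⟨m, rfl⟩ : ∃ m, n = m + 1 := ⟨n - 1, by omega⟩
  have hm : (0 : ℝ) < m := by
    have : 0 < m := by omega
    exact_mod_cast this
  have hrep : ∀ i : Fin (m + 1), ∀ g ∈ confined (K.sub i : Set K.X) K.skelBase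
      (K.skel_subset_sub i K.base_mem_skel) ⊓ (srcHom K.skelBase).ker, ∃ θ : Loop K.skelBase,
      cls θ = g ∧ srcLoop θ = Path.refl _ ∧ ∀ s t, (θ s).1 t ∈ K.sub i := by
    rintro i _ ⟨⟨θ, rfl, hθ⟩, hs⟩
    obtain ⟨θ', h1, h2, -, h4⟩ := exists_adjust θ
      (Path.Homotopic.Quotient.exact (show Path.Homotopic.Quotient.mk (srcLoop θ) =
        .mk (Path.refl K.skelBase) from hs)) (Path.Homotopic.refl _)
    exact ⟨θ', h1, h2, h4 _ (K.skel_subset_sub i) hθ⟩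
  -- Inverses are represented because of the reversal in `edgeClass_concatFun`. Indices beyond the
  -- last face get an arbitrary representative.
  have hδ : ∀ i : ℕ, ∃ δ : Loop K.skelBase, cls δ = (c i)⁻¹ ∧ (i < m + 1 →
      srcLoop δ = Path.refl _) ∧ ∀ h : i < m + 1, ∀ s t, (δ s).1 t ∈ K.sub ⟨i, h⟩ := fun i => by
    by_cases h : i < m + 1
    · obtain ⟨δ, h1, h2, h3⟩ := hrep ⟨i, h⟩ _ (Subgroup.inv_mem _ (hc ⟨i, h⟩))
      exact ⟨δ, h1, fun _ => h2, fun _ => h3⟩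
    · obtain ⟨δ, hδ⟩ := cls_surjective (c i)⁻¹
      exact ⟨δ, hδ, fun h' => absurd h' h, fun h' => absurd h' h⟩
  choose δ hδ1 hδ2 hδ3 using hδ
  have hΘ0 : (⟨concatFun δ m, continuous_concatFun δ m⟩ : C(ℝ, RelPath K.skel)) 0 =
      const K.skelBase := by
    have := concatFun_natCast δ 0 m
    rwa [Nat.cast_zero] at this
  have hΘm : (⟨concatFun δ m, continuous_concatFun δ m⟩ : C(ℝ, RelPath K.skel)) m =
      const K.skelBase := concatFun_natCast δ m m
  -- the concatenation of the loops of paths on the upper half of the square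
  let θ : Loop K.skelBase :=
    ⟨⟨fun s => concatFun δ m (m * s), (continuous_concatFun δ m).comp (by fun_prop)⟩,
      by simpa using hΘ0, by
        change concatFun δ m (m * ((1 : I) : ℝ)) = _
        rw [Icc.coe_one, mul_one]
        exact hΘm⟩
  have hθ : cls θ = (((List.range m).map c).prod)⁻¹ := by
    rw [← edgeClass_concatFun δ hδ1 m hΘ0 hΘm]
    refine (edgeClass_eq _ _ _ _ fun s => ?_).symm
    change concatFun δ m _ = concatFun δ m _
    congr 1
    rw [AffineMap.lineMap_apply_module]
    simp [mul_comm]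
  have hθi : ∀ (i : ℕ) (_ : i < m) (s : I), (i : ℝ) ≤ m * s → m * (s : ℝ) ≤ i + 1 →
      θ s = δ i (projIcc 0 1 zero_le_one (m * (s : ℝ) - i)) := fun i hi s h1 h2 =>
    concatFun_of_mem δ h1 h2 hi
  have hθex : ∀ s : I, ∃ i : ℕ, i < m ∧ (i : ℝ) ≤ m * s ∧ m * (s : ℝ) ≤ i + 1 := fun s => by
    obtain ⟨j, h1, h2⟩ := exists_between hn s.2
    exact ⟨j, j.2, by simpa using h1, by simpa using h2⟩
  have hθsrc : ∀ s, (θ s).1 0 = K.base := fun s => by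
    obtain ⟨i, hi, h1, h2⟩ := hθex s
    rw [hθi i hi s h1 h2, ← srcLoop_apply, hδ2 i (by omega)]
    rfl
  have hθker : cls θ ∈ (srcHom K.skelBase).ker := by
    rw [MonoidHom.mem_ker, srcHom_cls]
    have : srcLoop θ = Path.refl _ := by ext s; exact hθsrc s
    rw [this]
    rfl
  -- the loop of paths on the lower half of the square
  obtain ⟨e₀, he₀, he₁, he₂⟩ := hrep (Fin.last m) _ (hc (Fin.last m))
  -- The product is (upper half)⁻¹ · (lower half), so its triviality under `tgtHom` says that the
  -- end loops of the two halves are homotopic in K¹.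
  have hprod' : ((List.range (m + 1)).map c).prod = (cls θ)⁻¹ * cls e₀ := by
    rw [hθ, he₀, List.range_succ, List.map_append, List.prod_append, inv_inv]
    simp
  rw [hprod'] at hprod ⊢
  rw [map_mul, map_inv, inv_mul_eq_one, tgtHom_cls, tgtHom_cls] at hprod
  -- A collar in K¹ makes the end loop of the lower disc equal to that of θ, so that the halves fit
  -- along the seam t = 1/2.
  obtain ⟨e, he1, he2, he3, he4⟩ := exists_adjust e₀ (Path.Homotopic.refl _)
    (Path.Homotopic.Quotient.exact hprod.symm)
  replace he4 := he4 _ (K.skel_subset_sub (Fin.last m)) he₂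
  rw [he₁] at he2
  have heθ : ∀ s, (e s).1 1 = (θ s).1 1 := fun s => by
    rw [← tgtLoop_apply, ← tgtLoop_apply, he3]
  -- the map of the square
  let W : C(ℝ × ℝ, K.X) :=
    ⟨fun p => if p.2 ≤ 1 / 2 then sheet e p.1 (2 * p.2) else sheet θ p.1 (2 - 2 * p.2), by
      refine Continuous.if_le (by fun_prop) (by fun_prop) (by fun_prop) (by fun_prop) ?_
      rintro ⟨s, t⟩ (rfl : t = 1 / 2)
      rw [sheet_of_le_snd e _ (by norm_num), sheet_of_le_snd θ _ (by norm_num)]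
      exact heθ _⟩
  have hWdef : ∀ s t, W (s, t) = if t ≤ 1 / 2 then sheet e s (2 * t) else
    sheet θ s (2 - 2 * t) := fun _ _ => rfl
  have hWl : ∀ t, W (0, t) = K.base := fun t => by
    rw [hWdef, sheet_of_fst_le e le_rfl, sheet_of_fst_le θ le_rfl, ite_self]
  have hWr : ∀ t, W (1, t) = K.base := fun t => by
    rw [hWdef, sheet_of_le_fst e le_rfl, sheet_of_le_fst θ le_rfl, ite_self]
  have hWb : ∀ s, W (s, 0) = K.base := fun s => by
    rw [hWdef, if_pos (by norm_num), sheet_of_snd_le e _ (by norm_num)]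
    change ((srcLoop e _ : K.skel) : K.X) = _
    rw [he2]
    rfl
  have hWt : ∀ s, W (s, 1) = K.base := fun s => by
    rw [hWdef, if_neg (by norm_num), sheet_of_snd_le θ _ (by norm_num)]
    exact hθsrc _
  have hWhalf : ∀ s, W (s, 1 / 2) ∈ K.skel := fun s => by
    rw [hWdef, if_pos le_rfl]
    exact sheet_mem_of_le_snd e _ (by norm_num)
  have hWbad : ∀ p ∈ Icc (0 : ℝ) 1 ×ˢ Icc (0 : ℝ) 1, IsBad (m + 1) p → W p = K.base := by
    rintro ⟨s, t⟩ hp (h | h | h | h | ⟨h, k, hk⟩) <;> dsimp only at h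
    · rw [h, hWl]
    · rw [h, hWr]
    · rw [h, hWb]
    · rw [h, hWt]
    -- On a collapsed vertical segment θ is at a break point of the concatenation, where the whole
    -- path is constant.
    · have h1 : θ ⟨s, hp.1⟩ = const K.skelBase := by
        change concatFun δ m (m * s) = _
        rw [Nat.add_sub_cancel] at hk
        rw [hk]
        exact concatFun_natCast δ k m
      have h2 : sheet θ s (2 - 2 * t) = K.base := by
        rw [sheet, projIcc_of_mem _ hp.1, h1]
        rfl
      rw [hWdef]
      split_ifs with h3
      -- The foot of the segment lies on the seam, where W is read through e.
      · have h4 : t = 1 / 2 := le_antisymm h3 h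
        have h5 := heθ ⟨s, hp.1⟩
        rw [h1] at h5
        rw [sheet, projIcc_of_mem _ hp.1, projIcc_of_right_le _ (by linarith)]
        exact h5
      · exact h2
  have hWsub : ∀ (i : Fin (m + 1)) (p : ℝ × ℝ), p ∈ Icc (0 : ℝ) 1 ×ˢ Icc (0 : ℝ) 1 →
      InsideClosed (m + 1) 2 i p → W p ∈ K.sub i := by
    rintro i ⟨s, t⟩ hp h
    simp only [InsideClosed, Nat.add_sub_cancel] at h
    split_ifs at h with hi
    · obtain ⟨h1, h2, h3, -⟩ := h
      rw [hWdef]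
      split_ifs with h4
      · exact K.skel_subset_sub i (sheet_mem_of_le_snd e _ (by linarith))
      · rw [sheet, projIcc_of_mem _ hp.1, hθi i hi ⟨s, hp.1⟩ h1 h2]
        exact hδ3 i (by omega) _ _
    · obtain rfl : i = Fin.last m := Fin.ext (by simp only [Fin.val_last]; omega)
      rw [hWdef, if_pos h.2.2.2]
      exact he4 _ _
  obtain ⟨f, hf⟩ := exists_hom_of_square hn K W hWbad (fun a _ => hWhalf a) hWsub
  refine ⟨f, _, hf, ?_⟩
  let a : Ω^ (Fin 2) K.X K.base := genLoopMap _ (f.extension_base hf)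
    (⟨SphereSpace.proj (m + 1), fun p hp => by
      refine SphereSpace.proj_eq_iff.2 (Or.inr ⟨Or.inl hp, ?_⟩)
      exact SphereSpace.mem_collapsed_iff.2 (by simp [SphereSpace.isBad_zero])⟩)
  change cls (ofGenLoop (x := K.skelBase) a) = _
  have hglue : ∀ s t : I, (ofGenLoop (x := K.skelBase) a s).1 t = if (t : ℝ) ≤ 1 / 2 then
      sheet e s (2 * t) else sheet θ s (2 - 2 * t) := fun s t => by
    change W ((squarePt s t 0 : I), (squarePt s t 1 : I)) = _
    rw [squarePt_apply_zero, squarePt_apply_one, hWdef]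
  -- Gluing gives cls e = (sphere) · cls θ. The sphere lies in ker t and θ in ker s, so they
  -- commute, and the sphere is (cls θ)⁻¹ · cls e.
  have h1 := cls_eq_mul_of_glue (ofGenLoop (x := K.skelBase) a) e θ hθsrc heθ hglue
  have h2 : Commute (cls (ofGenLoop (x := K.skelBase) a)) (cls θ) :=
    commute_ker _ (tgtHom_ofPiTwo (x := K.skelBase) (piTwoMk a)) _ hθker
  rw [h2.eq, he1] at h1
  rw [h1, inv_mul_cancel_left]

/-- If the classes of loops of paths in the subcomplexes generate, then every class in the quotient
comes from a morphism from the sphere. -/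
lemma exists_hom_of_iSup_confined (hn : 2 ≤ n) (K : KObj.{u} n)
    (hgen : ⨆ i, confined (K.sub i : Set K.X) K.skelBase
      (K.skel_subset_sub i K.base_mem_skel) = ⊤) (z : π_ 2 K.X K.base) :
    ∃ (f : Hom (sphereObj n hn) K) (F : C((sphereObj n hn).X, K.X))
      (hF : IsExtension f.toMap F),
      piTwoMap F (f.extension_base hF) (sphereClass n hn) * z⁻¹ ∈
        ⨆ i, (K.inclPiTwo i).range := by
  have : Nonempty (Fin n) := ⟨⟨0, by omega⟩⟩
  have hnormal : ∀ i : Fin n, (confined (K.sub i : Set K.X) K.skelBase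
      (K.skel_subset_sub i K.base_mem_skel) ⊓ (srcHom K.skelBase).ker).Normal := fun i =>
    normal_inf_ker (e := constHom K.skelBase) tgtHom_constHom commute_ker
      fun g => constHom_mem_confined (K.skel_subset_sub i) g
  -- A join of normal subgroups is their product set in any prescribed order, so one factor per
  -- subcomplex suffices.
  have h1 : ofPiTwo K.skelBase z ∈ ⨆ i : Fin n, confined (K.sub i : Set K.X) K.skelBase
      (K.skel_subset_sub i K.base_mem_skel) ⊓ (srcHom K.skelBase).ker :=
    ker_le_iSup_inf_ker (e := constHom K.skelBase) srcHom_constHom tgtHom_constHom commute_ker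
      (fun i g => constHom_mem_confined (K.skel_subset_sub i) g) hgen (srcHom_ofPiTwo _)
  obtain ⟨c, hc, hcz⟩ := exists_range_prod_of_mem_iSup h1
  obtain ⟨f, F, hF, h⟩ := exists_hom_of_prod hn K hc (by rw [← hcz]; exact tgtHom_ofPiTwo _)
  refine ⟨f, F, hF, ?_⟩
  -- The two spheres have equal images under `ofPiTwo`. They may still differ by its kernel, which
  -- dies in the quotient.
  refine mem_of_ofPiTwo_mem_map (x := K.skelBase) (Y := fun i => (K.sub i : Set K.X))
    K.skel_subset_sub ?_
  rw [map_mul, map_inv, h, hcz, mul_inv_cancel]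
  exact Subgroup.one_mem _

end KObj
end

noncomputable section

/-! ## Loops of paths given by a map of the plane that is subordinate to a grid -/

section Segments

variable {E : Type*} [AddCommGroup E] [Module ℝ E] [TopologicalSpace E] [IsTopologicalAddGroup E]
  [ContinuousSMul ℝ E] {B : Set E}

/-- Paths in a convex subset with the same endpoints are homotopic. -/
lemma homotopic_of_mem_convex {C : Set E} (hC : Convex ℝ C) (hCB : C ⊆ B) {a b : B}
    (p q : Path a b) (hp : ∀ s, (p s : E) ∈ C) (hq : ∀ s, (q s : E) ∈ C) : p.Homotopic q := by
  refine ⟨⟨⟨⟨fun z => ⟨AffineMap.lineMap (p z.2 : E) (q z.2 : E) (z.1 : ℝ),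
    hCB (hC.lineMap_mem (hp _) (hq _) z.1.2)⟩, ?_⟩, fun s => ?_, fun s => ?_⟩, ?_⟩⟩
  · refine Continuous.subtype_mk ?_ _
    simp only [AffineMap.lineMap_apply_module]
    fun_prop
  · exact Subtype.ext (by simp)
  · exact Subtype.ext (by simp)
  · rintro r s (rfl | rfl) <;> exact Subtype.ext (by simp)

/-- The straight path between two points of a subset that contains the segment between them. -/
def segIn (a b : B) (h : segment ℝ (a : E) b ⊆ B) : Path a b where
  toFun t := ⟨AffineMap.lineMap (a : E) (b : E) (t : ℝ), h (by
    rw [segment_eq_image_lineMap]; exact mem_image_of_mem _ t.2)⟩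
  continuous_toFun := by
    refine Continuous.subtype_mk ?_ _
    simp only [AffineMap.lineMap_apply_module]
    fun_prop
  source' := Subtype.ext (by simp)
  target' := Subtype.ext (by simp)

lemma segIn_mem {a b : B} (h : segment ℝ (a : E) b ⊆ B) (s : I) :
    (segIn a b h s : E) ∈ segment ℝ (a : E) b := by
  rw [segment_eq_image_lineMap]; exact mem_image_of_mem _ s.2

end Segments

namespace RelPath

variable {X : Type u} [TopologicalSpace X] {A : Set X} (S : C(ℝ × ℝ, X))

/-- The path of the images of the points of the segment between two points. -/
def chord : C((S ⁻¹' A) × (S ⁻¹' A), RelPath A) :=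
  ofFamily (fun e t => S (AffineMap.lineMap (e.1 : ℝ × ℝ) (e.2 : ℝ × ℝ) t)) (by
    simp only [AffineMap.lineMap_apply_module]
    fun_prop) (fun e => by rw [AffineMap.lineMap_apply_zero]; exact e.1.2)
    (fun e => by rw [AffineMap.lineMap_apply_one]; exact e.2.2)

lemma chord_apply (b c : S ⁻¹' A) (t : I) :
    (chord S (b, c)).1 t = S (AffineMap.lineMap (b : ℝ × ℝ) (c : ℝ × ℝ) (t : ℝ)) := rfl

variable {x : A} {S}

lemma chord_self {b : S ⁻¹' A} (hb : S b = x) : chord S (b, b) = const x :=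
  Subtype.ext (ContinuousMap.ext fun t => by rw [chord_apply, AffineMap.lineMap_same_apply, hb]; rfl)

/-- The loop of chords of a loop of pairs of points. -/
def chordLoop {b : S ⁻¹' A} (hb : S b = x) (κ : Path (b, b) (b, b)) : Loop x :=
  (κ.map (chord S).continuous).cast (chord_self hb).symm (chord_self hb).symm

lemma chordLoop_apply {b : S ⁻¹' A} (hb : S b = x) (κ : Path (b, b) (b, b)) (s : I) :
    chordLoop hb κ s = chord S (κ s) := rfl

/-- Only the ends of the chords must stay in the preimage of A; the interiors are unrestricted
because S is defined on the whole plane. -/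
lemma cls_chordLoop_eq {b : S ⁻¹' A} (hb : S b = x) {κ κ' : Path (b, b) (b, b)}
    (h : κ.Homotopic κ') : cls (chordLoop hb κ) = cls (chordLoop hb κ') :=
  congrArg FundamentalGroup.fromPath
    (Path.Homotopic.Quotient.eq.2 ((h.map (chord S)).pathCast _ _))

/-- The homomorphism that joins the base point to the points of a loop by chords. -/
def fanHom {b : S ⁻¹' A} (hb : S b = x) :
    FundamentalGroup (S ⁻¹' A) b →* FundamentalGroup (RelPath A) (const x) :=
  FundamentalGroup.mapOfEq ((chord S).comp ⟨fun c => (b, c), by fun_prop⟩) (chord_self hb)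

lemma fanHom_mk {b : S ⁻¹' A} (hb : S b = x) (p : Path b b) :
    fanHom hb (FundamentalGroup.fromPath (.mk p)) = cls (chordLoop hb ((Path.refl b).prod p)) :=
  FundamentalGroup.mapOfEq_apply _ _ _

/-- A loop that runs along a path, then around a loop in a convex set that is mapped to `Y`, then
back. -/
lemma fanHom_conj_mem_confined {Y : Set X} (hA : A ⊆ Y) {R : Set (ℝ × ℝ)} (hR : Convex ℝ R)
    (hRY : MapsTo S R Y) {b v : S ⁻¹' A} (hb : S b = x) (p : Path b v) (q : Path v v)
    (hq : ∀ s, (q s : ℝ × ℝ) ∈ R) :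
    fanHom hb (FundamentalGroup.fromPath (.mk ((p.trans q).trans p.symm))) ∈
      confined Y x (hA x.2) := by
  -- The start of the chord, constantly b in the fan, is replaced by a trip along p and back. Then
  -- the chords along p are degenerate, and those during q lie in R.
  have h1 : (((p.prod p).trans ((Path.refl v).prod q)).trans (p.prod p).symm) =
      ((p.trans (Path.refl v)).trans p.symm).prod ((p.trans q).trans p.symm) := by
    rw [Path.trans_prod_eq_prod_trans]
    change Path.trans _ (p.symm.prod p.symm) = _
    rw [Path.trans_prod_eq_prod_trans]
  have h2 : ((p.trans (Path.refl v)).trans p.symm).Homotopic (Path.refl b) := by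
    refine Path.Homotopic.Quotient.exact ?_
    simp
  rw [fanHom_mk]
  refine ⟨chordLoop hb (((p.prod p).trans ((Path.refl v).prod q)).trans (p.prod p).symm), ?_, ?_⟩
  · rw [h1]
    refine cls_chordLoop_eq hb ?_
    obtain ⟨H⟩ := h2
    exact ⟨Path.Homotopic.prodHomotopy H (Path.Homotopy.refl _)⟩
  · intro s t
    rw [chordLoop_apply]
    have hpp : ∀ s, (chord S ((p.prod p) s)).1 t ∈ Y := fun s => by
      change S (AffineMap.lineMap (p s : ℝ × ℝ) (p s : ℝ × ℝ) (t : ℝ)) ∈ Y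
      rw [AffineMap.lineMap_same_apply]
      exact hA (p s).2
    rw [Path.trans_apply]
    split_ifs with h
    · rw [Path.trans_apply]
      split_ifs with h
      · exact hpp _
      · refine hRY (hR.lineMap_mem ?_ (hq _) t.2)
        have := hq 0
        rwa [q.source] at this
    · exact hpp _

open CategoryTheory in
/-- A loop of paths given by a map of the plane that carries the lines of the integral grid to `A`
and each square of the grid to one of the subsets `Y i` is a product of loops of paths that lie in
one of these subsets. -/
theorem mem_iSup_confined_of_grid {ι : Type*} [Nonempty ι] {Y : ι → Set X} (hA : ∀ i, A ⊆ Y i)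
    (hv : ∀ (k : ℕ) (y : ℝ), S (k, y) ∈ A) (hh : ∀ (l : ℕ) (y : ℝ), S (y, l) ∈ A)
    (hY : ∀ k l : ℕ, ∃ i, MapsTo S (Icc (k : ℝ) (k + 1) ×ˢ Icc (l : ℝ) (l + 1)) (Y i))
    (m : ℕ) (θ : Loop x) (hθ : ∀ s t : I, (θ s).1 t = S (m * s, m * t)) :
    cls θ ∈ ⨆ i, confined (Y i) x (hA i x.2) := by
  set N := ⨆ i, confined (Y i) x (hA i x.2) with hN
  let p : ℕ → ℕ → S ⁻¹' A := fun k l => ⟨(k, l), hv k l⟩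
  let H : ℕ → Set (ℝ × ℝ) := fun l => {z | z.2 = l}
  let V : ℕ → Set (ℝ × ℝ) := fun k => {z | z.1 = k}
  have hHc : ∀ l, Convex ℝ (H l) := fun l => convex_hyperplane (LinearMap.snd ℝ ℝ ℝ).isLinear _
  have hVc : ∀ k, Convex ℝ (V k) := fun k => convex_hyperplane (LinearMap.fst ℝ ℝ ℝ).isLinear _
  have hHB : ∀ l, H l ⊆ S ⁻¹' A := by rintro l ⟨a, b⟩ (rfl : b = l); exact hh l a
  have hVB : ∀ k, V k ⊆ S ⁻¹' A := by rintro k ⟨a, b⟩ (rfl : a = k); exact hv k b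
  have hHs : ∀ k k' l, segment ℝ (p k l : ℝ × ℝ) (p k' l) ⊆ H l := fun k k' l =>
    (hHc l).segment_subset rfl rfl
  have hVs : ∀ k l l', segment ℝ (p k l : ℝ × ℝ) (p k l') ⊆ V k := fun k l l' =>
    (hVc k).segment_subset rfl rfl
  let hp : ∀ k k' l, Path (p k l) (p k' l) := fun k k' l => segIn _ _ ((hHs k k' l).trans (hHB l))
  let vp : ∀ k l l', Path (p k l) (p k l') := fun k l l' => segIn _ _ ((hVs k l l').trans (hVB k))
  -- Routes along grid lines become arrows of the fundamental groupoid of S ⁻¹' A, where paths in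
  -- one grid line depend only on their ends.
  let arr : ∀ {b c : S ⁻¹' A}, Path b c → (FundamentalGroupoid.mk b ⟶ FundamentalGroupoid.mk c) :=
    fun q => Path.Homotopic.Quotient.mk q
  have harr : ∀ {b c : S ⁻¹' A} (C : Set (ℝ × ℝ)), Convex ℝ C → C ⊆ S ⁻¹' A → ∀ q q' : Path b c,
      (∀ s, (q s : ℝ × ℝ) ∈ C) → (∀ s, (q' s : ℝ × ℝ) ∈ C) → arr q = arr q' :=
    fun C h h' q q' hq hq' => Path.Homotopic.Quotient.eq.2 (homotopic_of_mem_convex h h' q q' hq hq')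
  have harr_symm : ∀ {b c : S ⁻¹' A} (q : Path b c), arr q.symm = inv (arr q) := fun q =>
    Groupoid.inv_eq_inv (arr q)
  have hpm : ∀ k k' l s, (hp k k' l s : ℝ × ℝ) ∈ H l := fun k k' l s => hHs k k' l (segIn_mem _ s)
  have vpm : ∀ k l l' s, (vp k l l' s : ℝ × ℝ) ∈ V k := fun k l l' s => hVs k l l' (segIn_mem _ s)
  have htrans : ∀ {b c d : S ⁻¹' A} {C : Set (ℝ × ℝ)} (q : Path b c) (q' : Path c d),
      (∀ s, (q s : ℝ × ℝ) ∈ C) → (∀ s, (q' s : ℝ × ℝ) ∈ C) →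
      ∀ s, (q.trans q' s : ℝ × ℝ) ∈ C := fun q q' hq hq' s => by
    rw [Path.trans_apply]
    split_ifs
    · exact hq _
    · exact hq' _
  have hcomp : ∀ k k' k'' l, arr (hp k k' l) ≫ arr (hp k' k'' l) = arr (hp k k'' l) :=
    fun k k' k'' l => harr (H l) (hHc l) (hHB l) ((hp k k' l).trans (hp k' k'' l)) _
      (htrans _ _ (hpm _ _ _) (hpm _ _ _)) (hpm _ _ _)
  have vcomp : ∀ k l l' l'', arr (vp k l l') ≫ arr (vp k l' l'') = arr (vp k l l'') :=
    fun k l l' l'' => harr (V k) (hVc k) (hVB k) ((vp k l l').trans (vp k l' l'')) _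
      (htrans _ _ (vpm _ _ _) (vpm _ _ _)) (vpm _ _ _)
  have hself : ∀ k l, arr (hp k k l) = 𝟙 _ := fun k l =>
    harr (H l) (hHc l) (hHB l) _ (Path.refl _) (hpm _ _ _) fun _ => rfl
  have vself : ∀ k l, arr (vp k l l) = 𝟙 _ := fun k l =>
    harr (V k) (hVc k) (hVB k) _ (Path.refl _) (vpm _ _ _) fun _ => rfl
  have h0 : S (p 0 0) = x := by
    have h1 := hθ 0 0
    have h2 : (θ 0).1 0 = x := congrArg (fun γ : RelPath A => γ.1 0) θ.source
    rw [h2] at h1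
    rw [h1]
    congr 1
    simp [p]
  -- Two routes from the corner are related when the fan over the loop they bound lies in N. N is
  -- not known to be normal: a common tail cancels, and a common initial route is handled by
  -- `fanHom_conj_mem_confined`.
  let Rel : ∀ {b : S ⁻¹' A} (γ γ' : FundamentalGroupoid.mk (p 0 0) ⟶ FundamentalGroupoid.mk b),
      Prop := fun γ γ' => fanHom h0 (γ ≫ inv γ' : End (FundamentalGroupoid.mk (p 0 0))) ∈ N
  have hrefl : ∀ {b : S ⁻¹' A} (γ : FundamentalGroupoid.mk (p 0 0) ⟶ FundamentalGroupoid.mk b),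
      Rel γ γ := fun γ => by
    change fanHom h0 (γ ≫ inv γ : End (FundamentalGroupoid.mk (p 0 0))) ∈ N
    rw [IsIso.hom_inv_id]
    exact (map_one (fanHom h0)).symm ▸ N.one_mem
  have hRtrans : ∀ {b : S ⁻¹' A}
      (γ γ' γ'' : FundamentalGroupoid.mk (p 0 0) ⟶ FundamentalGroupoid.mk b),
      Rel γ γ' → Rel γ' γ'' → Rel γ γ'' := fun γ γ' γ'' h1 h2 => by
    have h3 := N.mul_mem h2 h1
    rw [← map_mul, End.mul_def] at h3
    change fanHom h0 _ ∈ N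
    convert h3 using 2
    simp
  have hRcomp : ∀ {b c : S ⁻¹' A}
      (γ γ' : FundamentalGroupoid.mk (p 0 0) ⟶ FundamentalGroupoid.mk b)
      (δ : FundamentalGroupoid.mk b ⟶ FundamentalGroupoid.mk c),
      Rel γ γ' → Rel (γ ≫ δ) (γ' ≫ δ) := fun γ γ' δ h => by
    change fanHom h0 _ ∈ N
    convert h using 2
    simp
  -- The elementary move: pushing a route across one square of the grid, after an arbitrary initial
  -- route.
  have hsq : ∀ (k l : ℕ) (γ : FundamentalGroupoid.mk (p 0 0) ⟶ FundamentalGroupoid.mk (p k l)),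
      Rel (γ ≫ arr (vp k l (l + 1)) ≫ arr (hp k (k + 1) (l + 1)))
        (γ ≫ arr (hp k (k + 1) l) ≫ arr (vp (k + 1) l (l + 1))) := fun k l γ => by
    obtain ⟨γ, rfl⟩ := Path.Homotopic.Quotient.mk_surjective γ
    obtain ⟨i, hi⟩ := hY k l
    have hR : Convex ℝ (Icc (k : ℝ) (k + 1) ×ˢ Icc (l : ℝ) (l + 1)) :=
      (convex_Icc _ _).prod (convex_Icc _ _)
    have hpR : ∀ k' l', (k ≤ k' ∧ k' ≤ k + 1) → (l ≤ l' ∧ l' ≤ l + 1) →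
        (p k' l' : ℝ × ℝ) ∈ Icc (k : ℝ) (k + 1) ×ˢ Icc (l : ℝ) (l + 1) := fun k' l' h1 h2 =>
      ⟨⟨Nat.cast_le.2 h1.1, (Nat.cast_le.2 h1.2).trans_eq (Nat.cast_succ k)⟩,
        ⟨Nat.cast_le.2 h2.1, (Nat.cast_le.2 h2.2).trans_eq (Nat.cast_succ l)⟩⟩
    have hhR : ∀ l', (l ≤ l' ∧ l' ≤ l + 1) → ∀ s, (hp k (k + 1) l' s : ℝ × ℝ) ∈
        Icc (k : ℝ) (k + 1) ×ˢ Icc (l : ℝ) (l + 1) := fun l' hl s =>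
      hR.segment_subset (hpR _ _ (by simp) hl) (hpR _ _ (by simp) hl) (segIn_mem _ s)
    have hvR : ∀ k', (k ≤ k' ∧ k' ≤ k + 1) → ∀ s, (vp k' l (l + 1) s : ℝ × ℝ) ∈
        Icc (k : ℝ) (k + 1) ×ˢ Icc (l : ℝ) (l + 1) := fun k' hk s =>
      hR.segment_subset (hpR _ _ hk (by simp)) (hpR _ _ hk (by simp)) (segIn_mem _ s)
    have h1 := fanHom_conj_mem_confined (hA i) hR hi h0 γ
      (((vp k l (l + 1)).trans (hp k (k + 1) (l + 1))).trans
        ((hp k (k + 1) l).trans (vp (k + 1) l (l + 1))).symm)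
      (htrans _ _ (htrans _ _ (hvR _ (by simp)) (hhR _ (by simp)))
        fun s => htrans _ _ (hhR _ (by simp)) (hvR _ (by simp)) _)
    have h2 := Subgroup.mem_iSup_of_mem (S := fun i => confined (Y i) x (hA i x.2)) i h1
    change fanHom h0 _ ∈ N
    convert h2 using 2
    change _ = (arr γ ≫ (arr (vp k l (l + 1)) ≫ arr (hp k (k + 1) (l + 1))) ≫
      arr ((hp k (k + 1) l).trans (vp (k + 1) l (l + 1))).symm) ≫ arr γ.symm
    rw [harr_symm, harr_symm]
    change _ = (arr γ ≫ (arr (vp k l (l + 1)) ≫ arr (hp k (k + 1) (l + 1))) ≫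
      inv (arr (hp k (k + 1) l) ≫ arr (vp (k + 1) l (l + 1)))) ≫ inv (arr γ)
    change (arr γ ≫ _) ≫ inv (arr γ ≫ _) = _
    simp
  -- Pushing across one column, square by square from the bottom.
  have hE : ∀ k l, Rel (arr (hp 0 k 0) ≫ arr (vp k 0 l) ≫ arr (hp k (k + 1) l))
      (arr (hp 0 (k + 1) 0) ≫ arr (vp (k + 1) 0 l)) := fun k l => by
    induction l with
    | zero =>
      rw [vself, vself, Category.id_comp, hcomp, Category.comp_id]
      exact hrefl _
    | succ l ih =>
      have h1 := hsq k l (arr (hp 0 k 0) ≫ arr (vp k 0 l))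
      have h2 := hRcomp _ _ (arr (vp (k + 1) l (l + 1))) ih
      simp only [Category.assoc] at h1 h2
      rw [vcomp] at h2
      rw [← Category.assoc (arr (vp k 0 l)), vcomp] at h1
      exact hRtrans _ _ _ h1 h2
  -- Column by column, the route along the left side and the top is pushed to the one along the
  -- bottom and up a vertical line.
  have hT : ∀ k, Rel (arr (vp 0 0 m) ≫ arr (hp 0 k m)) (arr (hp 0 k 0) ≫ arr (vp k 0 m)) :=
      fun k => by
    induction k with
    | zero =>
      rw [hself, hself, Category.id_comp, Category.comp_id]
      exact hrefl _
    | succ k ih =>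
      have h1 := hRcomp _ _ (arr (hp k (k + 1) m)) ih
      simp only [Category.assoc] at h1
      rw [hcomp] at h1
      exact hRtrans _ _ _ h1 (hE k m)
  -- the boundary of the large square
  let κ := ((((Path.refl (p 0 0)).prod (vp 0 0 m)).trans ((hp 0 m 0).prod (hp 0 m m))).trans
    ((Path.refl (p m 0)).prod (vp m 0 m)).symm).trans ((hp 0 m 0).prod (hp 0 m 0)).symm
  have hκ : κ = ((((Path.refl (p 0 0)).trans (hp 0 m 0)).trans (Path.refl (p m 0)).symm).trans
      (hp 0 m 0).symm).prod ((((vp 0 0 m).trans (hp 0 m m)).trans (vp m 0 m).symm).trans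
        (hp 0 m 0).symm) := by
    simp only [← Path.trans_prod_eq_prod_trans]
    rfl
  have h1 : cls (chordLoop h0 κ) ∈ N := by
    have h2 : ((((Path.refl (p 0 0)).trans (hp 0 m 0)).trans (Path.refl (p m 0)).symm).trans
        (hp 0 m 0).symm).Homotopic (Path.refl _) := by
      refine Path.Homotopic.Quotient.exact ?_
      simp
    obtain ⟨H⟩ := h2
    rw [hκ, cls_chordLoop_eq h0 ⟨Path.Homotopic.prodHomotopy H (Path.Homotopy.refl _)⟩,
      ← fanHom_mk]
    convert hT m using 2
    change ((arr (vp 0 0 m) ≫ arr (hp 0 m m)) ≫ arr (vp m 0 m).symm) ≫ arr (hp 0 m 0).symm = _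
    rw [harr_symm, harr_symm]
    simp
  have hm0 : S (p m 0) = x := by
    have h1 := hθ 1 0
    have h2 : (θ 1).1 0 = x := congrArg (fun γ : RelPath A => γ.1 0) θ.target
    rw [h2] at h1
    rw [h1]
    congr 1
    simp [p]
  let ω : Loop x := (((hp 0 m 0).prod (hp 0 m 0)).map (chord S).continuous).cast
    (chord_self h0).symm (chord_self hm0).symm
  have hω : ∀ s t, (ω s).1 t ∈ A := fun s t => by
    change S (AffineMap.lineMap (hp 0 m 0 s : ℝ × ℝ) (hp 0 m 0 s : ℝ × ℝ) (t : ℝ)) ∈ A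
    rw [AffineMap.lineMap_same_apply]
    exact (hp 0 m 0 s).2
  have hl : ∀ s t : I, S (AffineMap.lineMap (p 0 0 : ℝ × ℝ) (vp 0 0 m s : ℝ × ℝ) (t : ℝ)) = x :=
      fun s t => by
    have h2 : (θ 0).1 (t * s) = x := congrArg (fun γ : RelPath A => γ.1 (t * s)) θ.source
    rw [hθ] at h2
    rw [← h2]
    congr 1
    change AffineMap.lineMap (p 0 0 : ℝ × ℝ)
      (AffineMap.lineMap (p 0 0 : ℝ × ℝ) (p 0 m : ℝ × ℝ) (s : ℝ)) (t : ℝ) = _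
    ext <;> simp [AffineMap.lineMap_apply_module, p]
    ring
  have hr : ∀ s t : I, S (AffineMap.lineMap (p m 0 : ℝ × ℝ) (vp m 0 m s : ℝ × ℝ) (t : ℝ)) = x :=
      fun s t => by
    have h2 : (θ 1).1 (t * s) = x := congrArg (fun γ : RelPath A => γ.1 (t * s)) θ.target
    rw [hθ] at h2
    rw [← h2]
    congr 1
    change AffineMap.lineMap (p m 0 : ℝ × ℝ)
      (AffineMap.lineMap (p m 0 : ℝ × ℝ) (p m m : ℝ × ℝ) (s : ℝ)) (t : ℝ) = _
    ext <;> simp [AffineMap.lineMap_apply_module, p] <;> ring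
  have hc : ∀ s t : I, S (AffineMap.lineMap (hp 0 m 0 s : ℝ × ℝ) (hp 0 m m s : ℝ × ℝ) (t : ℝ)) =
      (θ s).1 t := fun s t => by
    rw [hθ]
    congr 1
    change AffineMap.lineMap (AffineMap.lineMap (p 0 0 : ℝ × ℝ) (p m 0 : ℝ × ℝ) (s : ℝ))
      (AffineMap.lineMap (p 0 m : ℝ × ℝ) (p m m : ℝ × ℝ) (s : ℝ)) (t : ℝ) = _
    ext <;> simp [AffineMap.lineMap_apply_module, p] <;> ring
  have hl' : ∀ s, chord S (p 0 0, vp 0 0 m s) = const x := fun s =>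
    Subtype.ext (ContinuousMap.ext (hl s))
  have hr' : ∀ s, chord S (p m 0, vp m 0 m s) = const x := fun s =>
    Subtype.ext (ContinuousMap.ext (hr s))
  have hc' : ∀ s, chord S (hp 0 m 0 s, hp 0 m m s) = θ s := fun s =>
    Subtype.ext (ContinuousMap.ext (hc s))
  -- The boundary loop read with moving chords: constant at x on the left and right sides, the
  -- vertical chords that form θ in between, and constant paths in A on the way back.
  have h2 : chordLoop h0 κ = (((Path.refl (const x)).trans θ).trans (Path.refl (const x))).trans
      ω.symm := by
    refine Path.ext (funext fun s => ?_)
    rw [chordLoop_apply]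
    simp only [κ, Path.trans_apply]
    split_ifs
    · exact hl' _
    · exact hc' _
    · exact hr' _
    · rfl
  rw [h2, cls_trans, cls_trans, cls_trans, cls_refl, one_mul, mul_one, cls_symm] at h1
  have i₀ : ι := Classical.arbitrary ι
  have h3 : cls ω ∈ N := Subgroup.mem_iSup_of_mem i₀ ⟨ω, rfl, fun s t => hA i₀ (hω s t)⟩
  exact (N.mul_mem_cancel_left (N.inv_mem h3)).1 h1

end RelPath
end

noncomputable section

/-! ## Functions on a two-dimensional complex that are given on the cells -/

section Cellwise

variable {X : Type u} [TopologicalSpace X] [CWComplex (univ : Set X)]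

/-- The characteristic map of a 2-cell, extended to the plane. -/
def charMap (e : cell (univ : Set X) 2) : C(Fin 2 → ℝ, X) where
  toFun z := map 2 e ((max 1 ‖z‖)⁻¹ • z)
  continuous_toFun := by
    refine (continuousOn 2 e).comp_continuous ?_ fun z => ?_
    · exact ((continuous_const.max continuous_norm).inv₀
        fun z => (zero_lt_one.trans_le (le_max_left _ _)).ne').smul continuous_id
    · have h : 0 < max 1 ‖z‖ := zero_lt_one.trans_le (le_max_left _ _)
      rw [mem_closedBall_zero_iff, norm_smul, norm_inv, Real.norm_of_nonneg h.le,
        inv_mul_le_iff₀ h, mul_one]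
      exact le_max_right _ _

lemma charMap_eq (e : cell (univ : Set X) 2) {z : Fin 2 → ℝ} (hz : ‖z‖ ≤ 1) :
    charMap e z = map 2 e z := by
  change map 2 e _ = _
  rw [max_eq_left hz, inv_one, one_smul]

lemma charMap_mem_closedCell (e : cell (univ : Set X) 2) (z : Fin 2 → ℝ) :
    charMap e z ∈ closedCell (C := (univ : Set X)) 2 e := by
  refine mem_image_of_mem _ ?_
  have h : 0 < max 1 ‖z‖ := zero_lt_one.trans_le (le_max_left _ _)
  rw [mem_closedBall_zero_iff, norm_smul, norm_inv, Real.norm_of_nonneg h.le,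
    inv_mul_le_iff₀ h, mul_one]
  exact le_max_right _ _

lemma charMap_mem_openCell (e : cell (univ : Set X) 2) {z : Fin 2 → ℝ} (hz : ‖z‖ < 1) :
    charMap e z ∈ openCell (C := (univ : Set X)) 2 e := by
  rw [charMap_eq e hz.le]
  exact mem_image_of_mem _ (mem_ball_zero_iff.2 hz)

lemma exists_charMap_eq {e : cell (univ : Set X) 2} {y : X}
    (hy : y ∈ openCell (C := (univ : Set X)) 2 e) : ∃ z, ‖z‖ < 1 ∧ charMap e z = y := by
  obtain ⟨z, hz, rfl⟩ := hy
  rw [mem_ball_zero_iff] at hz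
  exact ⟨z, hz, charMap_eq e hz.le⟩

variable {Z : Type*}

open Classical in
/-- The function on a two-dimensional complex that is given by `Φ e` on the open 2-cells and by `φ`
on the 1-skeleton. -/
def cellwise (Φ : cell (univ : Set X) 2 → (Fin 2 → ℝ) → Z) (φ : X → Z) (y : X) : Z :=
  if h : ∃ e : cell (univ : Set X) 2, y ∈ openCell (C := (univ : Set X)) 2 e then
    Φ h.choose ((map 2 h.choose).symm y) else φ y

variable {Φ : cell (univ : Set X) 2 → (Fin 2 → ℝ) → Z} {φ : X → Z}

lemma cellwise_charMap_of_lt (e : cell (univ : Set X) 2) {z : Fin 2 → ℝ} (hz : ‖z‖ < 1) :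
    cellwise Φ φ (charMap e z) = Φ e z := by
  have h : ∃ e' : cell (univ : Set X) 2, charMap e z ∈ openCell (C := (univ : Set X)) 2 e' :=
    ⟨e, charMap_mem_openCell e hz⟩
  have he : h.choose = e := by
    by_contra hne
    refine (disjoint_openCell_of_ne (C := (univ : Set X)) (n := 2) (m := 2) (i := h.choose)
      (j := e) fun h' => hne ?_).notMem_of_mem_left h.choose_spec (charMap_mem_openCell e hz)
    exact eq_of_heq (Sigma.mk.inj h').2
  rw [cellwise, dif_pos h, he, charMap_eq e hz.le, (map 2 e).left_inv]
  rw [source_eq 2 e]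
  exact mem_ball_zero_iff.2 hz

variable [T2Space X]

lemma charMap_mem_skeleton (e : cell (univ : Set X) 2) {z : Fin 2 → ℝ} (hz : 1 ≤ ‖z‖) :
    charMap e z ∈ skeleton (univ : Set X) 1 := by
  refine cellFrontier_subset_skeleton (C := (univ : Set X)) 1 e (mem_image_of_mem _ ?_)
  have h : 0 < ‖z‖ := zero_lt_one.trans_le hz
  rw [mem_sphere_zero_iff_norm, max_eq_right hz, norm_smul, norm_inv, norm_norm,
    inv_mul_cancel₀ h.ne']

/-- Every point of a two-dimensional complex is in the 1-skeleton or in an open 2-cell. -/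
lemma mem_skeleton_or_charMap (hdim : ∀ m, 2 < m → IsEmpty (cell (univ : Set X) m)) (y : X) :
    y ∈ skeleton (univ : Set X) 1 ∨ ∃ e z, ‖z‖ < 1 ∧ charMap e z = y := by
  have hy : y ∈ ⋃ (m : ℕ) (j : cell (univ : Set X) m), openCell m j := by
    rw [CWComplex.iUnion_openCell_eq_complex]; trivial
  simp only [mem_iUnion] at hy
  obtain ⟨m, j, hy⟩ := hy
  rcases lt_trichotomy m 2 with h | rfl | h
  · exact Or.inl (skeleton_mono (by exact_mod_cast Nat.lt_succ_iff.1 h)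
      (openCell_subset_skeleton m j hy))
  · exact Or.inr ⟨j, exists_charMap_eq hy⟩
  · exact (hdim m h).elim j

lemma cellwise_of_mem_skeleton {y : X} (hy : y ∈ skeleton (univ : Set X) 1) :
    cellwise Φ φ y = φ y := by
  refine dif_neg ?_
  rintro ⟨e, he⟩
  exact (disjoint_skeleton_openCell (C := (univ : Set X)) (n := 1) (m := 2) (j := e)
    (by norm_num)).notMem_of_mem_left hy he

lemma cellwise_charMap (hb : ∀ e z, ‖z‖ = 1 → Φ e z = φ (charMap e z))
    (e : cell (univ : Set X) 2) {z : Fin 2 → ℝ} (hz : ‖z‖ ≤ 1) :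
    cellwise Φ φ (charMap e z) = Φ e z := by
  rcases hz.lt_or_eq with hz | hz
  · exact cellwise_charMap_of_lt e hz
  · rw [cellwise_of_mem_skeleton (charMap_mem_skeleton e hz.ge), hb e z hz]

/-- Closedness of preimages is tested on closed cells. On a 2-cell the preimage is the image of a
compact set under the characteristic map, so no local finiteness is required. -/
lemma continuous_cellwise [TopologicalSpace Z]
    (hdim : ∀ m, 2 < m → IsEmpty (cell (univ : Set X) m))
    (hφ : ContinuousOn φ (skeleton (univ : Set X) 1))
    (hΦ : ∀ e, ContinuousOn (Φ e) (Metric.closedBall 0 1))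
    (hb : ∀ e z, ‖z‖ = 1 → Φ e z = φ (charMap e z)) : Continuous (cellwise Φ φ) := by
  rw [continuous_iff_isClosed]
  intro T hT
  rw [CWComplex.closed (univ : Set X) _ (subset_univ _)]
  intro m j
  have h1 : m ≤ 1 → IsClosed (cellwise Φ φ ⁻¹' T ∩ closedCell (C := (univ : Set X)) m j) :=
      fun hm => by
    have hsub : closedCell (C := (univ : Set X)) m j ⊆ skeleton (univ : Set X) 1 :=
      (closedCell_subset_skeleton m j).trans (skeleton_mono (by exact_mod_cast hm))
    have hc : ContinuousOn (cellwise Φ φ) (closedCell (C := (univ : Set X)) m j) :=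
      (hφ.mono hsub).congr fun y hy => cellwise_of_mem_skeleton (hsub hy)
    rw [inter_comm]
    exact hc.preimage_isClosed_of_isClosed isClosed_closedCell hT
  rcases lt_trichotomy m 2 with h | rfl | h
  · exact h1 (by omega)
  · have h2 : cellwise Φ φ ⁻¹' T ∩ closedCell (C := (univ : Set X)) 2 j =
        charMap j '' (Metric.closedBall 0 1 ∩ Φ j ⁻¹' T) := by
      ext y
      constructor
      · rintro ⟨hy, z, hz, rfl⟩
        have hz' := mem_closedBall_zero_iff.1 hz
        rw [← charMap_eq j hz', mem_preimage, cellwise_charMap hb j hz'] at hy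
        exact ⟨z, ⟨hz, hy⟩, charMap_eq j hz'⟩
      · rintro ⟨z, ⟨hz, hy⟩, rfl⟩
        refine ⟨?_, charMap_mem_closedCell j z⟩
        rw [mem_preimage, cellwise_charMap hb j (mem_closedBall_zero_iff.1 hz)]
        exact hy
    rw [h2]
    refine (IsCompact.image ?_ (charMap j).continuous).isClosed
    exact (isCompact_closedBall _ _).of_isClosed_subset
      ((hΦ j).preimage_isClosed_of_isClosed Metric.isClosed_closedBall hT) inter_subset_left
  · exact (hdim m h).elim j

/-! ### Radial functions and moves -/

/-- The distance from the centre of the 2-cell; it is `1` on the 1-skeleton. -/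
def radius : X → ℝ := cellwise (fun _ z => ‖z‖) fun _ => 1

lemma continuous_radius (hdim : ∀ m, 2 < m → IsEmpty (cell (univ : Set X) m)) :
    Continuous (radius : X → ℝ) :=
  continuous_cellwise hdim continuousOn_const (fun _ => continuous_norm.continuousOn)
    fun _ _ h => h

lemma radius_of_mem_skeleton {y : X} (hy : y ∈ skeleton (univ : Set X) 1) : radius y = 1 :=
  cellwise_of_mem_skeleton hy

lemma radius_charMap (e : cell (univ : Set X) 2) {z : Fin 2 → ℝ} (hz : ‖z‖ ≤ 1) :
    radius (charMap e z) = ‖z‖ :=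
  cellwise_charMap (fun _ _ h => h) e hz

/-- The coordinates in the 2-cell, scaled near the boundary so that they vanish on the
1-skeleton. -/
def coord : X → Fin 2 → ℝ := cellwise (fun _ z => min 1 (2 * (1 - ‖z‖)) • z) fun _ => 0

lemma continuous_coord (hdim : ∀ m, 2 < m → IsEmpty (cell (univ : Set X) m)) :
    Continuous (coord : X → Fin 2 → ℝ) := by
  refine continuous_cellwise (φ := fun _ => (0 : Fin 2 → ℝ)) hdim continuousOn_const (fun _ => ?_)
    fun _ z h => ?_
  · fun_prop
  · simp [h]

omit [T2Space X] in
-- `shift` moves only points with ‖z‖ < 1/2, and there the scaling factor is 1.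
lemma coord_charMap (e : cell (univ : Set X) 2) {z : Fin 2 → ℝ} (hz : ‖z‖ ≤ 1 / 2) :
    coord (charMap e z) = z := by
  rw [coord, cellwise_charMap_of_lt e (by linarith), min_eq_left (by linarith), one_smul]

/-- A cutoff function. -/
def cutoff (r : ℝ) : ℝ := max 0 (min 1 (2 - 4 * r))

lemma continuous_cutoff : Continuous cutoff := by
  unfold cutoff; fun_prop

lemma cutoff_nonneg (r : ℝ) : 0 ≤ cutoff r := le_max_left _ _

lemma cutoff_le_one (r : ℝ) : cutoff r ≤ 1 := max_le zero_le_one (min_le_left _ _)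

lemma cutoff_of_le {r : ℝ} (h : r ≤ 1 / 4) : cutoff r = 1 := by
  rw [cutoff, min_eq_left (by linarith), max_eq_right zero_le_one]

lemma cutoff_of_ge {r : ℝ} (h : 1 / 2 ≤ r) : cutoff r = 0 := by
  rw [cutoff, max_eq_left ((min_le_right _ _).trans (by linarith))]

/-- Move the points near the centre of a 2-cell by a vector. -/
def shift : X → C(Fin 2 → ℝ, X) :=
  cellwise (fun e z => (charMap e).comp ⟨fun v => z + cutoff ‖z‖ • v, by fun_prop⟩)
    fun y => ContinuousMap.const _ y

/-- Values in a function space give joint continuity in point and vector by evaluation, so no cell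
structure on a product is needed. The pieces match on the boundary because the cutoff vanishes
there. -/
lemma continuous_shift (hdim : ∀ m, 2 < m → IsEmpty (cell (univ : Set X) m)) :
    Continuous (shift : X → C(Fin 2 → ℝ, X)) := by
  refine continuous_cellwise (φ := fun y => ContinuousMap.const (Fin 2 → ℝ) y) hdim
    ContinuousMap.const'.continuous.continuousOn (fun e => ?_) fun e z h => ?_
  · refine (ContinuousMap.continuous_of_continuous_uncurry _ ?_).continuousOn
    change Continuous fun p : (Fin 2 → ℝ) × (Fin 2 → ℝ) => charMap e (p.1 + cutoff ‖p.1‖ • p.2)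
    have := continuous_cutoff
    fun_prop
  · ext v
    change charMap e (z + cutoff ‖z‖ • v) = charMap e z
    rw [cutoff_of_ge (by rw [h]; norm_num), zero_smul, add_zero]

lemma shift_of_mem_skeleton {y : X} (hy : y ∈ skeleton (univ : Set X) 1) (v : Fin 2 → ℝ) :
    shift y v = y := by
  rw [shift, cellwise_of_mem_skeleton hy]; rfl

omit [T2Space X] in
lemma shift_charMap (e : cell (univ : Set X) 2) {z : Fin 2 → ℝ} (hz : ‖z‖ < 1) (v : Fin 2 → ℝ) :
    shift (charMap e z) v = charMap e (z + cutoff ‖z‖ • v) := by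
  rw [shift, cellwise_charMap_of_lt e hz]; rfl

lemma shift_zero (hdim : ∀ m, 2 < m → IsEmpty (cell (univ : Set X) m)) (y : X) :
    shift y 0 = y := by
  rcases mem_skeleton_or_charMap hdim y with hy | ⟨e, z, hz, rfl⟩
  · exact shift_of_mem_skeleton hy 0
  · rw [shift_charMap e hz, smul_zero, add_zero]

lemma shift_of_le_radius (hdim : ∀ m, 2 < m → IsEmpty (cell (univ : Set X) m)) {y : X}
    (hy : 1 / 2 ≤ radius y) (v : Fin 2 → ℝ) : shift y v = y := by
  rcases mem_skeleton_or_charMap hdim y with h | ⟨e, z, hz, rfl⟩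
  · exact shift_of_mem_skeleton h v
  · rw [radius_charMap e hz.le] at hy
    rw [shift_charMap e hz, cutoff_of_ge hy, zero_smul, add_zero]

/-- A shift that moves the coordinates to a nonzero vector misses the centre. -/
lemma radius_shift_pos (hdim : ∀ m, 2 < m → IsEmpty (cell (univ : Set X) m)) {y : X}
    {g : Fin 2 → ℝ} (hg : g ≠ 0) (hgy : ‖g - coord y‖ < 1 / 8) :
    0 < radius (shift y (g - coord y)) := by
  rcases mem_skeleton_or_charMap hdim y with h | ⟨e, z, hz, rfl⟩
  · rw [shift_of_mem_skeleton h, radius_of_mem_skeleton h]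
    exact one_pos
  · rcases le_total (1 / 2) ‖z‖ with h | h
    · rw [shift_of_le_radius hdim (by rwa [radius_charMap e hz.le]), radius_charMap e hz.le]
      linarith
    · rw [coord_charMap e h] at hgy ⊢
      rw [shift_charMap e hz]
      have h1 : ‖cutoff ‖z‖ • (g - z)‖ < 1 / 8 := by
        rw [norm_smul, Real.norm_of_nonneg (cutoff_nonneg _)]
        exact (mul_le_of_le_one_left (norm_nonneg _) (cutoff_le_one _)).trans_lt hgy
      rw [radius_charMap e ((norm_add_le _ _).trans (by linarith)), norm_pos_iff]
      -- For ‖z‖ ≤ 1/4 the cutoff is 1 and the point is moved exactly to g ≠ 0. Farther out, a move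
      -- by less than 1/8 cannot reach the centre.
      rcases le_total ‖z‖ (1 / 4) with h2 | h2
      · rw [cutoff_of_le h2, one_smul, add_sub_cancel]
        exact hg
      · intro h3
        rw [eq_neg_of_add_eq_zero_left h3, norm_neg] at h2
        linarith

/-- Stretch the 2-cells radially from the centre. -/
def stretch : X → C(ℝ, X) :=
  cellwise (fun e z => (charMap e).comp ⟨fun r => (1 + |r|) • z, by fun_prop⟩)
    fun y => ContinuousMap.const _ y

/-- A stretched boundary point leaves the cube along its own ray, and `charMap` brings it back to
where it was, so the pieces match on the 1-skeleton. -/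
lemma continuous_stretch (hdim : ∀ m, 2 < m → IsEmpty (cell (univ : Set X) m)) :
    Continuous (stretch : X → C(ℝ, X)) := by
  refine continuous_cellwise (φ := fun y => ContinuousMap.const ℝ y) hdim
    ContinuousMap.const'.continuous.continuousOn (fun e => ?_) fun e z h => ?_
  · refine (ContinuousMap.continuous_of_continuous_uncurry _ ?_).continuousOn
    change Continuous fun p : (Fin 2 → ℝ) × ℝ => charMap e ((1 + |p.2|) • p.1)
    fun_prop
  · ext r
    have h1 : 0 < 1 + |r| := by positivity
    change map 2 e ((max 1 ‖(1 + |r|) • z‖)⁻¹ • (1 + |r|) • z) = map 2 e ((max 1 ‖z‖)⁻¹ • z)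
    rw [norm_smul, Real.norm_of_nonneg h1.le, h, mul_one, max_self, inv_one, one_smul,
      max_eq_right (by linarith [abs_nonneg r]), smul_smul, inv_mul_cancel₀ h1.ne', one_smul]

lemma stretch_of_mem_skeleton {y : X} (hy : y ∈ skeleton (univ : Set X) 1) (r : ℝ) :
    stretch y r = y := by
  rw [stretch, cellwise_of_mem_skeleton hy]; rfl

omit [T2Space X] in
lemma stretch_charMap (e : cell (univ : Set X) 2) {z : Fin 2 → ℝ} (hz : ‖z‖ < 1) (r : ℝ) :
    stretch (charMap e z) r = charMap e ((1 + |r|) • z) := by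
  rw [stretch, cellwise_charMap_of_lt e hz]; rfl

lemma stretch_zero (hdim : ∀ m, 2 < m → IsEmpty (cell (univ : Set X) m)) (y : X) :
    stretch y 0 = y := by
  rcases mem_skeleton_or_charMap hdim y with hy | ⟨e, z, hz, rfl⟩
  · exact stretch_of_mem_skeleton hy 0
  · rw [stretch_charMap e hz, abs_zero, add_zero, one_smul]

/-- Once the stretched coordinate has left the open cube, `charMap` projects it to the frontier of
the cell. -/
lemma stretch_mem_skeleton (hdim : ∀ m, 2 < m → IsEmpty (cell (univ : Set X) m)) {y : X} {r : ℝ}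
    (h : 1 ≤ (1 + |r|) * radius y) : stretch y r ∈ skeleton (univ : Set X) 1 := by
  rcases mem_skeleton_or_charMap hdim y with hy | ⟨e, z, hz, rfl⟩
  · rwa [stretch_of_mem_skeleton hy]
  · rw [radius_charMap e hz.le] at h
    rw [stretch_charMap e hz]
    refine charMap_mem_skeleton e ?_
    rwa [norm_smul, Real.norm_of_nonneg (by positivity)]

/-- Shifts and stretches preserve the closed 2-cells. -/
lemma stretch_shift_mem_closedCell (hdim : ∀ m, 2 < m → IsEmpty (cell (univ : Set X) m))
    {e : cell (univ : Set X) 2} {y : X} (hy : y ∈ openCell (C := (univ : Set X)) 2 e)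
    (v : Fin 2 → ℝ) (r : ℝ) :
    stretch (shift y v) r ∈ closedCell (C := (univ : Set X)) 2 e := by
  obtain ⟨z, hz, rfl⟩ := exists_charMap_eq hy
  rw [shift_charMap e hz]
  have h := charMap_mem_closedCell e (z + cutoff ‖z‖ • v)
  set y := charMap e (z + cutoff ‖z‖ • v)
  rcases mem_skeleton_or_charMap hdim y with hs | ⟨e', z', hz', h'⟩
  · rwa [stretch_of_mem_skeleton hs]
  · rw [← cellFrontier_union_openCell_eq_closedCell] at h
    rcases h with h | h
    -- The vector is arbitrary, so the shift may reach the frontier; stretching does nothing there.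
    · rw [stretch_of_mem_skeleton
        (cellFrontier_subset_skeleton (C := (univ : Set X)) 1 e h)]
      exact cellFrontier_subset_closedCell 2 e h
    · obtain ⟨z₁, hz₁, h₁⟩ := exists_charMap_eq h
      rw [← h₁, stretch_charMap e hz₁]
      exact charMap_mem_closedCell e _

/-- The homotopy that shifts by multiples of a vector and stretches. -/
lemma exists_stretch_shift_homotopy (hdim : ∀ m, 2 < m → IsEmpty (cell (univ : Set X) m))
    {E : Type*} [TopologicalSpace E] (u : C(E, X)) (d : C(E, Fin 2 → ℝ)) (r : ℝ) :
    ∃ H : C(ℝ × E, X), (∀ p, H (0, p) = u p) ∧ (∀ p, H (1, p) = stretch (shift (u p) (d p)) r) ∧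
      ∀ q p, u p ∈ skeleton (univ : Set X) 1 → H (q, p) = u p := by
  have h1 : Continuous fun p : ℝ × E => shift (u p.2) (p.1 • d p.2) :=
    continuous_eval.comp (((continuous_shift hdim).comp (u.continuous.comp continuous_snd)).prodMk
      (continuous_fst.smul (d.continuous.comp continuous_snd)))
  refine ⟨⟨fun p => stretch (shift (u p.2) (p.1 • d p.2)) (p.1 * r),
    continuous_eval.comp (((continuous_stretch hdim).comp h1).prodMk
      (continuous_fst.mul continuous_const))⟩, fun p => ?_, fun p => ?_, fun q p h => ?_⟩
  · simp only [ContinuousMap.coe_mk, zero_smul, zero_mul, shift_zero hdim, stretch_zero hdim]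
  · simp only [ContinuousMap.coe_mk, one_smul, one_mul]
  · simp only [ContinuousMap.coe_mk, shift_of_mem_skeleton h, stretch_of_mem_skeleton h]

/-- The 2-cells are top-dimensional: the function 1 − ‖z‖ on this cell, extended by 0, is continuous
and positive exactly on it. -/
lemma isOpen_openCell_two (hdim : ∀ m, 2 < m → IsEmpty (cell (univ : Set X) m))
    (e : cell (univ : Set X) 2) : IsOpen (openCell (C := (univ : Set X)) 2 e) := by
  classical
  let f : X → ℝ := cellwise (fun e' z => if e' = e then 1 - ‖z‖ else 0) fun _ => 0
  have hf : Continuous f := by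
    refine continuous_cellwise hdim continuousOn_const (fun e' => ?_) fun e' z h => ?_
    · split_ifs <;> fun_prop
    · simp [h]
  have h : openCell (C := (univ : Set X)) 2 e = f ⁻¹' Ioi 0 := by
    ext y
    constructor
    · intro hy
      obtain ⟨z, hz, rfl⟩ := exists_charMap_eq hy
      rw [mem_preimage, show f (charMap e z) = _ from cellwise_charMap_of_lt e hz, if_pos rfl, mem_Ioi]
      linarith
    · intro (hy : 0 < f y)
      rcases mem_skeleton_or_charMap hdim y with h | ⟨e', z, hz, rfl⟩
      · rw [show f y = 0 from cellwise_of_mem_skeleton h] at hy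
        exact absurd hy (lt_irrefl _)
      · rw [show f (charMap e' z) = _ from cellwise_charMap_of_lt e' hz] at hy
        split_ifs at hy with h
        · rw [← h]
          exact charMap_mem_openCell e' hz
        · exact absurd hy (lt_irrefl _)
  rw [h]
  exact isOpen_Ioi.preimage hf

/-- Supplies the open cover for the Lebesgue number: sets of the first kind meet a single 2-cell,
and on the second kind `shift` does nothing. -/
lemma exists_mem_openCell_or_lt_radius (hdim : ∀ m, 2 < m → IsEmpty (cell (univ : Set X) m))
    (y : X) : (∃ e, y ∈ openCell (C := (univ : Set X)) 2 e) ∨ 1 / 2 < radius y := by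
  rcases mem_skeleton_or_charMap hdim y with h | ⟨e, z, hz, rfl⟩
  · rw [radius_of_mem_skeleton h]
    norm_num
  · exact Or.inl ⟨e, charMap_mem_openCell e hz⟩

end Cellwise
end

noncomputable section

/-! ## Generation by loops of paths in the subcomplexes -/

/-- A continuous map from the plane to the plane can be approximated by maps that do not vanish on
countably many given smooth curves. -/
lemma exists_approx_ne_zero (f : C(ℝ × ℝ, Fin 2 → ℝ)) {ε : ℝ} (hε : 0 < ε) {ι : Type*} [Countable ι]
    {c : ι → ℝ → ℝ × ℝ} (hc : ∀ i, ContDiff ℝ 1 (c i)) :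
    ∃ g : C(ℝ × ℝ, Fin 2 → ℝ), (∀ p, ‖g p - f p‖ < ε) ∧ ∀ i t, g (c i t) ≠ 0 := by
  obtain ⟨g, hg, hgf, -⟩ := f.continuous.exists_contDiff_approx 1
    (continuous_const (y := ε / 2)) fun _ => half_pos hε
  -- A C¹ curve has image of Hausdorff dimension at most 1, and a countable union keeps this bound,
  -- below the dimension 2 of the plane. So arbitrarily small vectors avoid all the images, and
  -- subtracting one of them clears the value 0.
  have hdim : dimH (⋃ i, range (g ∘ c i)) < Module.finrank ℝ (Fin 2 → ℝ) := by
    have h1 : dimH (⋃ i, range (g ∘ c i)) ≤ 1 := by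
      rw [dimH_iUnion]
      refine iSup_le fun i => ?_
      simpa using (ContDiff.comp (n := 1) hg (hc i)).dimH_range_le
    refine h1.trans_lt ?_
    rw [Module.finrank_fin_fun]
    norm_num
  obtain ⟨q, hq, hqε⟩ := (dense_compl_of_dimH_lt_finrank hdim).exists_mem_open Metric.isOpen_ball
    ⟨0, Metric.mem_ball_self (half_pos hε)⟩
  refine ⟨⟨fun p => g p - q, hg.continuous.sub continuous_const⟩, fun p => ?_, fun i t h => hq ?_⟩
  · have h1 := hgf p
    rw [dist_eq_norm] at h1
    rw [mem_ball_zero_iff] at hqε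
    calc ‖g p - q - f p‖ = ‖(g p - f p) - q‖ := by rw [sub_right_comm]
      _ ≤ ‖g p - f p‖ + ‖q‖ := norm_sub_le _ _
      _ < ε := by linarith
  · exact mem_iUnion.2 ⟨i, t, sub_eq_zero.1 h⟩

namespace KObj

open RelPath

variable {n : ℕ}

/-- Some K i contains the centre of the cell, and a subcomplex that meets an open cell contains the
closed one. -/
lemma exists_closedCell_subset_sub (K : KObj.{u} n) (e : cell (univ : Set K.X) 2) :
    ∃ i, closedCell (C := (univ : Set K.X)) 2 e ⊆ K.sub i := by
  have h : map (C := (univ : Set K.X)) 2 e 0 ∈ ⋃ i, (K.sub i : Set K.X) := by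
    rw [K.iUnion_sub]; trivial
  obtain ⟨i, hi⟩ := mem_iUnion.1 h
  refine ⟨i, Subcomplex.closedCell_subset_of_mem _ ?_⟩
  by_contra he
  exact (Subcomplex.disjoint_openCell_subcomplex_of_not_mem _ he).notMem_of_mem_left
    (map_zero_mem_openCell 2 e) hi

/-- The classes of loops of paths in the subcomplexes generate. -/
theorem iSup_confined_eq_top (hn : 2 ≤ n) (K : KObj.{u} n) :
    ⨆ i, confined (K.sub i : Set K.X) K.skelBase
      (K.skel_subset_sub i K.base_mem_skel) = ⊤ := by
  have : Nonempty (Fin n) := ⟨⟨0, by omega⟩⟩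
  refine eq_top_iff.2 fun z _ => ?_
  obtain ⟨θ, rfl⟩ := cls_surjective z
  have hdim := K.dim_le_two
  have hcoord := continuous_coord (X := K.X) hdim
  have hradius := continuous_radius (X := K.X) hdim
  have hshift := continuous_shift (X := K.X) hdim
  have hstretch := continuous_stretch (X := K.X) hdim
  let u : ℝ × ℝ → K.X := fun p => sheet θ p.1 p.2
  have hu : Continuous u := continuous_sheet θ
  -- a grid whose squares are mapped to the open cells or close to the 1-skeleton
  let c : Option (cell (univ : Set K.X) 2) → Set (ℝ × ℝ) := fun o =>
    o.elim {p | 1 / 2 < radius (u p)} fun e => u ⁻¹' openCell (C := (univ : Set K.X)) 2 e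
  have hc : ∀ o, IsOpen (c o) := by
    rintro (_ | e)
    · exact isOpen_lt continuous_const (hradius.comp hu)
    · exact (isOpen_openCell_two hdim e).preimage hu
  obtain ⟨δ, hδ, hcδ⟩ := lebesgue_number_lemma_of_metric (s := Icc (0 : ℝ) 1 ×ˢ Icc (0 : ℝ) 1)
    (isCompact_Icc.prod isCompact_Icc) hc fun p _ => by
      rcases exists_mem_openCell_or_lt_radius hdim (u p) with ⟨e, h⟩ | h
      · exact mem_iUnion.2 ⟨some e, h⟩
      · exact mem_iUnion.2 ⟨none, h⟩
  obtain ⟨m, hm, hmδ⟩ : ∃ m : ℕ, (0 : ℝ) < m ∧ (1 : ℝ) / m < δ := by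
    obtain ⟨m, hm⟩ := exists_nat_one_div_lt hδ
    exact ⟨m + 1, by positivity, by exact_mod_cast hm⟩
  -- the perturbation
  obtain ⟨g, hg, hg0⟩ := exists_approx_ne_zero (ι := ℕ ⊕ ℕ) ⟨fun p => coord (u p), hcoord.comp hu⟩
    (ε := 1 / 8) (by norm_num)
    (c := Sum.elim (fun k t => ((k : ℝ) / m, t)) fun k t => (t, (k : ℝ) / m)) (by
      rintro (k | k)
      · exact contDiff_const.prodMk contDiff_id
      · exact contDiff_id.prodMk contDiff_const)
  let d : ℝ × ℝ → Fin 2 → ℝ := fun p => g p - coord (u p)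
  have hd : Continuous d := g.continuous.sub (hcoord.comp hu)
  let Γ : Set (ℝ × ℝ) := Icc (0 : ℝ) 1 ×ˢ Icc (0 : ℝ) 1 ∩
    ((fun p => m * p.1) ⁻¹' range ((↑) : ℕ → ℝ) ∪ (fun p => m * p.2) ⁻¹' range ((↑) : ℕ → ℝ))
  have hΓ : IsCompact Γ := by
    have hcl := Nat.isClosedEmbedding_coe_real.isClosed_range
    exact (isCompact_Icc.prod isCompact_Icc).inter_right
      ((hcl.preimage (by fun_prop)).union (hcl.preimage (by fun_prop)))
  have hVc : Continuous fun p => shift (u p) (d p) := by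
    have h1 := hshift.comp hu
    exact continuous_eval.comp (h1.prodMk hd)
  have hgΓ : ∀ p ∈ Γ, g p ≠ 0 := by
    rintro ⟨a, b⟩ ⟨-, ⟨k, hk⟩ | ⟨k, hk⟩⟩
    · have h1 : a = k / m := by rw [hk]; field_simp
      rw [h1]
      exact hg0 (Sum.inl k) b
    · have h1 : b = k / m := by rw [hk]; field_simp
      rw [h1]
      exact hg0 (Sum.inr k) a
  -- After the shift the grid misses every centre; compactness gives a uniform lower bound r for the
  -- radius on it.
  obtain ⟨r, hr, hrΓ⟩ := hΓ.exists_forall_le' (a := 0) (hradius.comp hVc).continuousOn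
    fun p hp => radius_shift_pos hdim (hgΓ p hp) (hg p)
  -- C · r ≥ 1 sends the grid lines to K¹, and C ≥ 1 does the same for every point of radius at
  -- least 1/2.
  obtain ⟨C, hC1, hCr⟩ : ∃ C : ℝ, 1 ≤ C ∧ 1 ≤ C * r :=
    ⟨max 1 (1 / r), le_max_left _ _, by
      rw [← div_le_iff₀ hr]; exact le_max_right _ _⟩
  have hskel : ∀ y : K.X, (r ≤ radius y ∨ 1 / 2 ≤ radius y) → stretch y C ∈ K.skel :=
      fun y hy => by
    refine stretch_mem_skeleton hdim ?_
    rw [abs_of_nonneg (by linarith)]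
    rcases hy with h | h <;> nlinarith
  obtain ⟨H, hH0, hH1, hHskel⟩ := exists_stretch_shift_homotopy hdim ⟨u, hu⟩ ⟨d, hd⟩ C
  simp only [ContinuousMap.coe_mk] at hH0 hH1 hHskel
  -- The homotopy fixes K¹ pointwise, so the sides of the square keep their constraints and the
  -- class does not change.
  have hHsnd : ∀ q s t, (t ≤ 0 ∨ 1 ≤ t) → H (q, s, t) ∈ K.skel := fun q s t ht => by
    have h : u (s, t) ∈ K.skel :=
      ht.elim (fun h => sheet_mem_of_snd_le θ s h) fun h => sheet_mem_of_le_snd θ s h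
    rw [hHskel _ _ h]
    exact h
  have hHfst : ∀ q s t, (s ≤ 0 ∨ 1 ≤ s) → H (q, s, t) = K.base := fun q s t hs => by
    have h : u (s, t) = K.base :=
      hs.elim (fun h => sheet_of_fst_le θ h t) fun h => sheet_of_le_fst θ h t
    rw [hHskel _ _ (by rw [h]; exact K.base_mem_skel), h]
  let θ' : Loop K.skelBase := loopOf (fun s t => H (1, s, t)) (by fun_prop) (fun s => hHsnd 1 s 0 (Or.inl le_rfl))
    (fun s => hHsnd 1 s 1 (Or.inr le_rfl)) (fun t => hHfst 1 0 t (Or.inl le_rfl))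
    (fun t => hHfst 1 1 t (Or.inr le_rfl))
  have hθ : cls θ = cls θ' :=
    cls_eq_of_homotopy (fun r s t => H (r, s, t)) (by fun_prop) (fun r s => hHsnd r s 0 (Or.inl le_rfl))
      (fun r s => hHsnd r s 1 (Or.inr le_rfl)) (fun r t => hHfst r 0 t (Or.inl le_rfl))
      (fun r t => hHfst r 1 t (Or.inr le_rfl)) (fun s t => (hH0 (s, t)).trans (sheet_coe θ s t))
      fun s t => rfl
  rw [hθ]
  -- the perturbed map on the grid
  let P : ℝ → ℝ := fun a => projIcc (0 : ℝ) 1 zero_le_one (a / m)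
  have hP : Continuous P :=
    continuous_subtype_val.comp (continuous_projIcc.comp (continuous_id.div_const _))
  have hPmem : ∀ a, P a ∈ Icc (0 : ℝ) 1 := fun a => Subtype.coe_prop _
  have hPm : ∀ s : I, P (m * s) = s := fun s => by
    simp only [P]
    rw [mul_div_cancel_left₀ _ hm.ne', projIcc_val]
  -- The grid lemma refers to all natural indices; lines beyond m are clamped to the last one.
  have hPk : ∀ k : ℕ, m * P k ∈ range ((↑) : ℕ → ℝ) := fun k => by
    rcases le_total k m with h | h
    · refine ⟨k, ?_⟩
      have : P k = k / m := by
        simp only [P]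
        rw [projIcc_of_mem _ ⟨by positivity, (div_le_one hm).2 (by exact_mod_cast h)⟩]
      rw [this]
      field_simp
    · refine ⟨m, ?_⟩
      have : P k = 1 := by
        simp only [P]
        rw [projIcc_of_right_le _ ((one_le_div hm).2 (by exact_mod_cast h))]
      rw [this, mul_one]
  have hPd : ∀ (k : ℕ) (a : ℝ), a ∈ Icc (k : ℝ) (k + 1) → dist (P a) (P k) < δ := fun k a ha => by
    refine lt_of_le_of_lt ?_ hmδ
    refine (abs_projIcc_sub_projIcc _).trans ?_
    rw [← sub_div, abs_of_nonneg (div_nonneg (by linarith [ha.1]) hm.le)]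
    gcongr
    linarith [ha.2]
  have hΓskel : ∀ p ∈ Γ, H (1, p) ∈ K.skel := fun p hp => by
    rw [hH1]
    exact hskel _ (Or.inl (hrΓ p hp))
  refine mem_iSup_confined_of_grid (S := ⟨fun p => H (1, P p.1, P p.2), by fun_prop⟩)
    (Y := fun i => (K.sub i : Set K.X)) K.skel_subset_sub (fun k y => ?_) (fun l y => ?_)
    (fun k l => ?_) m θ' fun s t => ?_
  · exact hΓskel (P k, P y) ⟨⟨hPmem _, hPmem _⟩, Or.inl (hPk k)⟩
  · exact hΓskel (P y, P l) ⟨⟨hPmem _, hPmem _⟩, Or.inr (hPk l)⟩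
  · obtain ⟨o, ho⟩ := hcδ (P k, P l) ⟨hPmem _, hPmem _⟩
    have hball : ∀ p ∈ Icc (k : ℝ) (k + 1) ×ˢ Icc (l : ℝ) (l + 1), (P p.1, P p.2) ∈ c o :=
      fun p hp => ho (max_lt (hPd k _ hp.1) (hPd l _ hp.2))
    -- Grid squares near K¹ are not shifted and are stretched into K¹. Those in an open 2-cell stay
    -- in the closed cell, which lies in one K i.
    rcases o with _ | e
    · refine ⟨Classical.arbitrary _, fun p hp => K.skel_subset_sub _ ?_⟩
      have h1 : 1 / 2 < radius (u (P p.1, P p.2)) := hball p hp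
      change H (1, _) ∈ _
      rw [hH1, shift_of_le_radius hdim h1.le]
      exact hskel _ (Or.inr h1.le)
    · obtain ⟨i, hi⟩ := K.exists_closedCell_subset_sub e
      refine ⟨i, fun p hp => hi ?_⟩
      change H (1, _) ∈ _
      rw [hH1]
      exact stretch_shift_mem_closedCell hdim (hball p hp) _ _
  · change H (1, s, t) = H (1, P (m * s), P (m * t))
    rw [hPm, hPm]

end KObj
end

noncomputable section

/-! ## The main theorem -/

lemma piTwoMap_comp {X : Type u} {Y : Type v} {Z : Type w} [TopologicalSpace X]
    [TopologicalSpace Y] [TopologicalSpace Z] (G : C(Y, Z)) (F : C(X, Y)) {x : X} {y : Y} {z : Z}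
    (hF : F x = y) (hG : G y = z) (h : (G.comp F) x = z) (a : π_ 2 X x) :
    piTwoMap (G.comp F) h a = piTwoMap G hG (piTwoMap F hF a) := by
  obtain ⟨a, rfl⟩ := Quotient.exists_rep a
  rfl

lemma piTwoMap_id {X : Type u} [TopologicalSpace X] {x : X} (h : ContinuousMap.id X x = x)
    (a : π_ 2 X x) : piTwoMap (ContinuousMap.id X) h a = a := by
  obtain ⟨a, rfl⟩ := Quotient.exists_rep a
  rfl

namespace KObj

variable {n : ℕ}

lemma IsExtension.comp {K : KObj.{u} n} {L : KObj.{v} n} {M : KObj.{w} n} {g : C(L.skel, M.skel)}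
    {G : C(L.X, M.X)} (hG : IsExtension g G) {f : C(K.skel, L.skel)} {F : C(K.X, L.X)}
    (hF : IsExtension f F) : IsExtension (g.comp f) (G.comp F) :=
  ⟨fun x => by rw [ContinuousMap.comp_apply, hF.eq_on_skel, hG.eq_on_skel,
    ContinuousMap.comp_apply], fun i => (hG.mapsTo_sub i).comp (hF.mapsTo_sub i)⟩

/-- Extensions of homotopic morphisms induce the same map to the quotient. -/
lemma mk_piTwoMap_eq (hn : 2 ≤ n) {K : KObj.{u} n} {L : KObj.{v} n} {f g : Hom K L}
    (hfg : f.Homotopic g) {F G : C(K.X, L.X)} (hF : IsExtension f.toMap F)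
    (hG : IsExtension g.toMap G) (a : π_ 2 K.X K.base) :
    (QuotientGroup.mk (piTwoMap F (f.extension_base hF) a) : L.PiTwoQuot) =
      QuotientGroup.mk (piTwoMap G (g.extension_base hG) a) := by
  have : Nonempty (Fin n) := ⟨⟨0, by omega⟩⟩
  -- Applied to a⁻¹, so that the result has the form x⁻¹ * y of the left coset relation.
  have h := RelPath.piTwoMap_mul_inv_mem (x := K.skelBase) (x' := L.skelBase)
    (Y := fun i => (K.sub i : Set K.X)) (Y' := fun i => (L.sub i : Set L.X))
    K.skel_subset_sub L.skel_subset_sub (iSup_confined_eq_top hn K) hfg hF.eq_on_skel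
    hG.eq_on_skel hF.mapsTo_sub hG.mapsTo_sub (f.extension_base hF) (g.extension_base hG) a⁻¹
  refine QuotientGroup.eq.2 ?_
  rwa [map_inv, map_inv, inv_inv] at h

/-- The homomorphism between the quotients that a morphism induces. -/
def pushHom {K : KObj.{u} n} {L : KObj.{v} n} (g : Hom K L) : K.PiTwoQuot →* L.PiTwoQuot :=
  QuotientGroup.map _ _ (piTwoMap g.exists_extension.choose
    (g.extension_base g.exists_extension.choose_spec)) (by
      refine iSup_le fun i => ?_
      rintro _ ⟨a, rfl⟩
      refine Subgroup.mem_iSup_of_mem i ?_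
      have hG := g.exists_extension.choose_spec
      -- The extension restricts to K i → L i, so it preserves the subgroups that are divided out.
      let G' : C((K.sub i : Set K.X), (L.sub i : Set L.X)) :=
        ⟨(hG.mapsTo_sub i).restrict, g.exists_extension.choose.continuous.restrict _⟩
      refine ⟨piTwoMap (x := K.subBase i) (y := L.subBase i) G'
        (Subtype.ext (g.extension_base hG)) a, ?_⟩
      obtain ⟨a, rfl⟩ := Quotient.exists_rep a
      rfl)

/-- The constant homotopy shows that the extension chosen in `pushHom` is immaterial. -/
lemma pushHom_mk (hn : 2 ≤ n) {K : KObj.{u} n} {L : KObj.{v} n} (g : Hom K L) {G : C(K.X, L.X)}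
    (hG : IsExtension g.toMap G) (a : π_ 2 K.X K.base) :
    pushHom g (QuotientGroup.mk a) =
      QuotientGroup.mk (piTwoMap G (g.extension_base hG) a) :=
  mk_piTwoMap_eq hn (ContinuousMap.HomotopicRel.refl _) g.exists_extension.choose_spec hG a

lemma pushHom_eq (hn : 2 ≤ n) {K : KObj.{u} n} {L : KObj.{v} n} {g g' : Hom K L}
    (h : g.Homotopic g') : pushHom g = pushHom g' := by
  refine MonoidHom.ext fun z => ?_
  obtain ⟨a, rfl⟩ := QuotientGroup.mk_surjective z
  exact mk_piTwoMap_eq hn h g.exists_extension.choose_spec g'.exists_extension.choose_spec a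

lemma pushHom_comp (hn : 2 ≤ n) {K : KObj.{u} n} {L : KObj.{v} n} {M : KObj.{w} n} (h : Hom L M)
    (g : Hom K L) (z : K.PiTwoQuot) : pushHom (h.comp g) z = pushHom h (pushHom g z) := by
  obtain ⟨a, rfl⟩ := QuotientGroup.mk_surjective z
  obtain ⟨G, hG⟩ := g.exists_extension
  obtain ⟨H, hH⟩ := h.exists_extension
  have hHG : IsExtension (h.comp g).toMap (H.comp G) := hH.comp hG
  rw [pushHom_mk hn (h.comp g) hHG, pushHom_mk hn g hG, pushHom_mk hn h hH,
    piTwoMap_comp H G (g.extension_base hG) (h.extension_base hH)]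

/-- The class in the quotient of a morphism from the sphere. -/
def sphereQuot (hn : 2 ≤ n) {K : KObj.{u} n} (f : Hom (sphereObj n hn) K) : K.PiTwoQuot :=
  pushHom f (QuotientGroup.mk (sphereClass n hn))

end KObj

end

open KObj

theorem mainTheorem4 (n : ℕ) (hn : 2 ≤ n) :
    ∃ q : (K : KObj.{u} n) → KObj.Hom (sphereObj n hn) K → K.PiTwoQuot,
      -- `q` is the class of the underlying map `S² → K`, whichever extension is chosen
      (∀ (K : KObj.{u} n) (f : KObj.Hom (sphereObj n hn) K) (F : C((sphereObj n hn).X, K.X))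
        (hF : KObj.IsExtension f.toMap F),
        q K f = QuotientGroup.mk (piTwoMap F (f.extension_base hF) (sphereClass n hn))) ∧
      -- `q` depends only on the homotopy class of the map of 1-skeletons
      (∀ (K : KObj.{u} n) (f g : KObj.Hom (sphereObj n hn) K), f.Homotopic g → q K f = q K g) ∧
      -- the target is a functor, and `q` is natural
      (∃ push : (K L : KObj.{u} n) → KObj.Hom K L → (K.PiTwoQuot →* L.PiTwoQuot),
        (∀ (K L : KObj.{u} n) (g : KObj.Hom K L) (G : C(K.X, L.X))
          (hG : KObj.IsExtension g.toMap G) (a : π_ 2 K.X K.base),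
          push K L g (QuotientGroup.mk a) =
            QuotientGroup.mk (piTwoMap G (g.extension_base hG) a)) ∧
        (∀ (K L : KObj.{u} n) (g g' : KObj.Hom K L), g.Homotopic g' → push K L g = push K L g') ∧
        (∀ K : KObj.{u} n, push K K (KObj.Hom.id K) = MonoidHom.id K.PiTwoQuot) ∧
        (∀ (K L M : KObj.{u} n) (h : KObj.Hom L M) (g : KObj.Hom K L),
          push K M (h.comp g) = (push L M h).comp (push K L g)) ∧
        (∀ (K L : KObj.{u} n) (g : KObj.Hom K L) (f : KObj.Hom (sphereObj n hn) K),
          push K L g (q K f) = q L (g.comp f))) ∧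
      -- `q` is surjective
      (∀ K : KObj.{u} n, Function.Surjective (q K)) := by
  refine ⟨fun K f => sphereQuot hn f, fun K f F hF => pushHom_mk hn f hF _, fun K f g h => ?_,
    ⟨fun K L g => pushHom g, fun K L g G hG a => pushHom_mk hn g hG a, fun K L g g' h => ?_,
      fun K => ?_, fun K L M h g => ?_, fun K L g f => ?_⟩, fun K z => ?_⟩
  · exact DFunLike.congr_fun (pushHom_eq hn h) _
  · exact pushHom_eq hn h
  · refine MonoidHom.ext fun z => ?_
    obtain ⟨a, rfl⟩ := QuotientGroup.mk_surjective z
    have hid : IsExtension (Hom.id K).toMap (ContinuousMap.id _) :=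
      ⟨fun _ => rfl, fun _ => mapsTo_id _⟩
    rw [pushHom_mk hn _ hid, piTwoMap_id]
    rfl
  · exact MonoidHom.ext fun z => pushHom_comp hn h g z
  · exact (pushHom_comp hn g f _).symm
  · obtain ⟨a, rfl⟩ := QuotientGroup.mk_surjective z
    -- A class is realized only modulo the images of the π₂(K i), which is all that the quotient
    -- sees.
    obtain ⟨f, F, hF, h⟩ := exists_hom_of_iSup_confined hn K (iSup_confined_eq_top hn K) a
    refine ⟨f, (pushHom_mk hn f hF _).trans ?_⟩
    exact QuotientGroup.eq_iff_div_mem.2 (by rwa [div_eq_mul_inv])
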